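/- Let $V$ be a complex vector space of dimension $\aleph_0$, in one of three situations: (A) $V$ is equipped with a countable-dimensional subspace $V_*\subset V^*=\mathrm{Hom}(V,\mathbb C)$ such that the pairing $V_*\times V\to\mathbb C$ is nondegenerate; (BD) $V$ is equipped with a nondegenerate symmetric bilinear form $\omega$; (C) $V$ is equipped with a symplectic bilinear form $\omega$. In types (BD) and (C) put $V_*=\{\omega(v,\cdot):v\in V\}$. Let $GL(\infty)$ be the group of all $g\in GL(V)$ such that $g(V_*)=V_*$ and $g$ fixes pointwise a finite-codimensional subspace of $V$ and a finite-codimensional subspace of $V_*$. Let $G$ be $GL(\infty)$ in type (A), and the subgroup of elements of $GL(\infty)$ preserving $\omega$ in types (BD) and (C), where it is denoted $O(\infty)$ and $Sp(\infty)$ respectively. A basis $E$ of $V$ is admissible if, in type (A), its dual family of linear forms spans $V_*$, and, in types (BD) and (C), there is an involution $i_E:E\to E$ with at most one fixed point such that $\omega(e,e')\neq0$ if and only if $e'=i_E(e)$. For a finite subset $E'\subset E$ let $G(E')$ be the group of all $g\in G$ that stabilize $\langle E'\rangle$ and fix every element of $E\setminus E'$. A subgroup $P\subset G$ is a splitting parabolic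 subgroup if there are an admissible basis $E$ and an exhaustion $E=\bigcup_n E_n$ by an increasing sequence of finite subsets ($i_E$-stable in types (BD) and (C)) such that $P$ contains all elements of $G$ that are diagonal in the basis $E$, and for every $n$ the group $P\cap G(E_n)$ is a parabolic subgroup of $G(E_n)$, that is, the stabilizer in $G(E_n)$ of a flag of subspaces of $\langle E_n\rangle$ (of an isotropic flag, i.e. one stable under $F\mapsto F^\perp$, in types (BD) and (C)). A splitting parabolic subgroup $P$ is semilarge if only finitely many subspaces of $V$ are invariant under $P$. It is large if, moreover, $P$ is the stabilizer in $G$ of a finite chain of subspaces $0=F_0\subsetneq F_1\subsetneq\dots\subsetneq F_m=V$ (with $F_k^\perp=F_{m-k}$ for all $k$ in types (BD) and (C)) in which each $F_k$ is finite dimensional or finite codimensional. Theorem. Let $P_1,P_2\subsetneq G$ be proper splitting parabolic subgroups of $G$. Then the diagonal action of $G$ on $G/P_1\times G/P_2$ has finitely many orbits if and only if one of $P_1,P_2$ is large and the other one is semilarge. -/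

import Mathlib

universe u

/-- The data defining one of the classical ind-groups on a complex vector space `V`:
* type A: a countable-dimensional space `Vs` of linear forms on `V` such that the pairing
  `Vs × V → ℂ` is nondegenerate (nondegeneracy on the `Vs` side is automatic);
* type BD: a nondegenerate symmetric bilinear form on `V`;
* type C: a symplectic (nondegenerate alternating) bilinear form on `V`. -/
inductive ClassicalDatum (V : Type u) [AddCommGroup V] [Module ℂ V] : Type u
  | typeA (Vs : Submodule ℂ (Module.Dual ℂ V)) (hdim : Module.rank ℂ Vs = Cardinal.aleph0)
      (hsep : ∀ v : V, (∀ φ ∈ Vs, φ v = 0) → v = 0)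
  | typeBD (ω : LinearMap.BilinForm ℂ V) (hnd : ω.Nondegenerate) (hsymm : ω.IsSymm)
  | typeC (ω : LinearMap.BilinForm ℂ V) (hnd : ω.Nondegenerate) (halt : ω.IsAlt)

namespace ClassicalDatum

variable {V : Type u} [AddCommGroup V] [Module ℂ V]

/-- The bilinear form `ω`; there is none in type A. -/
def form : ClassicalDatum V → Option (LinearMap.BilinForm ℂ V)
  | typeA _ _ _ => none
  | typeBD ω _ _ => some ω
  | typeC ω _ _ => some ω

/-- The space `V_*` of linear forms: the given one in type A, and `{ω(v, ·) : v ∈ V}` in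
types BD and C. -/
def dualSpace : ClassicalDatum V → Submodule ℂ (Module.Dual ℂ V)
  | typeA Vs _ _ => Vs
  | typeBD ω _ _ => LinearMap.range ω
  | typeC ω _ _ => LinearMap.range ω

/-- The group `GL(∞)` attached to `Vs`: all `g ∈ GL(V)` with `g(Vs) = Vs` that fix pointwise
a finite-codimensional subspace of `V` and a finite-codimensional subspace of `Vs`.
Here `g` acts on linear forms by `φ ↦ φ ∘ g⁻¹`, which is `g.symm.dualMap`. -/
def glInfty (Vs : Submodule ℂ (Module.Dual ℂ V)) : Subgroup (V ≃ₗ[ℂ] V) where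
  carrier := {g |
    Vs.map (g.symm.dualMap : Module.Dual ℂ V →ₗ[ℂ] Module.Dual ℂ V) = Vs ∧
    (∃ U : Submodule ℂ V, U.CoFG ∧ ∀ v ∈ U, g v = v) ∧
    (∃ W : Submodule ℂ Vs, W.CoFG ∧
      ∀ φ ∈ W, g.symm.dualMap (φ : Module.Dual ℂ V) = (φ : Module.Dual ℂ V))}
  one_mem' := by
    refine ⟨?_, ⟨⊤, Submodule.CoFG.top, fun v _ => rfl⟩, ⟨⊤, Submodule.CoFG.top, fun φ _ => rfl⟩⟩
    exact Submodule.map_id Vs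
  mul_mem' := by
    rintro a b ⟨ha, ⟨U, hU, hUa⟩, ⟨W, hW, hWa⟩⟩ ⟨hb, ⟨U', hU', hUb⟩, ⟨W', hW', hWb⟩⟩
    refine ⟨?_, ⟨U ⊓ U', hU.inf hU', fun v hv => ?_⟩, ⟨W ⊓ W', hW.inf hW', fun φ hφ => ?_⟩⟩
    · have h : (((a * b).symm.dualMap : Module.Dual ℂ V ≃ₗ[ℂ] Module.Dual ℂ V) :
          Module.Dual ℂ V →ₗ[ℂ] Module.Dual ℂ V) =
          (a.symm.dualMap : Module.Dual ℂ V →ₗ[ℂ] Module.Dual ℂ V).comp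
            (b.symm.dualMap : Module.Dual ℂ V →ₗ[ℂ] Module.Dual ℂ V) := rfl
      rw [h, Submodule.map_comp, hb, ha]
    · change a (b v) = v
      rw [hUb v hv.2, hUa v hv.1]
    · change a.symm.dualMap (b.symm.dualMap (φ : Module.Dual ℂ V)) = φ
      rw [hWb φ hφ.2, hWa φ hφ.1]
  inv_mem' := by
    rintro a ⟨ha, ⟨U, hU, hUa⟩, ⟨W, hW, hWa⟩⟩
    refine ⟨?_, ⟨U, hU, fun v hv => ?_⟩, ⟨W, hW, fun φ hφ => ?_⟩⟩
    · have h : (((a⁻¹).symm.dualMap : Module.Dual ℂ V ≃ₗ[ℂ] Module.Dual ℂ V) :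
          Module.Dual ℂ V →ₗ[ℂ] Module.Dual ℂ V).comp
          (a.symm.dualMap : Module.Dual ℂ V →ₗ[ℂ] Module.Dual ℂ V) = LinearMap.id := by
        ext φ v
        change φ (a.symm (a v)) = φ v
        rw [a.symm_apply_apply]
      conv_lhs => rw [← ha]
      rw [← Submodule.map_comp, h, Submodule.map_id]
    · change a.symm v = v
      rw [LinearEquiv.symm_apply_eq, hUa v hv]
    · ext v
      have h := LinearMap.congr_fun (hWa φ hφ) (a v)
      change (φ : Module.Dual ℂ V) (a.symm (a v)) = (φ : Module.Dual ℂ V) (a v) at h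
      rw [a.symm_apply_apply] at h
      exact h.symm

/-- The classical ind-group `GL(∞)`, `O(∞)` or `Sp(∞)`: the elements of `GL(∞)` that
preserve `ω` (if there is one). -/
def group (D : ClassicalDatum V) : Subgroup (V ≃ₗ[ℂ] V) where
  carrier := {g | g ∈ glInfty D.dualSpace ∧ ∀ ω ∈ D.form, ∀ x y : V, ω (g x) (g y) = ω x y}
  one_mem' := ⟨one_mem _, fun _ _ _ _ => rfl⟩
  mul_mem' := by
    rintro a b ⟨ha, ha'⟩ ⟨hb, hb'⟩
    refine ⟨mul_mem ha hb, fun ω hω x y => ?_⟩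
    change ω (a (b x)) (a (b y)) = ω x y
    rw [ha' ω hω, hb' ω hω]
  inv_mem' := by
    rintro a ⟨ha, ha'⟩
    refine ⟨inv_mem ha, fun ω hω x y => ?_⟩
    change ω (a.symm x) (a.symm y) = ω x y
    rw [← ha' ω hω, a.apply_symm_apply, a.apply_symm_apply]

/-- The basis `e` carries an involution `i` of its index set, with at most one fixed point,
such that `ω(e_j, e_k) ≠ 0` if and only if `k = i(j)`. -/
def HasBasisInvolution (ω : LinearMap.BilinForm ℂ V) (e : Module.Basis ℕ ℂ V) : Prop :=
  ∃ i : ℕ → ℕ, Function.Involutive i ∧ {j | i j = j}.Subsingleton ∧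
    ∀ j k : ℕ, ω (e j) (e k) ≠ 0 ↔ k = i j

/-- Admissible bases (indexed by `ℕ`, since `V` will have dimension `ℵ₀`). In type A the dual
family of linear forms spans `V_*`. -/
def IsAdmissible : ClassicalDatum V → Module.Basis ℕ ℂ V → Prop
  | typeA Vs _ _, e => Submodule.span ℂ (Set.range e.coord) = Vs
  | typeBD ω _ _, e => HasBasisInvolution ω e
  | typeC ω _ _, e => HasBasisInvolution ω e

/-- The subgroup `H(E)` of `G` formed by the elements that are diagonal in the basis `E`. -/
def diagonalSubgroup (D : ClassicalDatum V) (e : Module.Basis ℕ ℂ V) : Subgroup D.group where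
  carrier := {g | ∀ j : ℕ, ∃ c : ℂ, (g : V ≃ₗ[ℂ] V) (e j) = c • e j}
  one_mem' := fun j => ⟨1, (one_smul ℂ (e j)).symm⟩
  mul_mem' := by
    intro a b ha hb j
    obtain ⟨c, hc⟩ := ha j
    obtain ⟨d, hd⟩ := hb j
    refine ⟨d * c, ?_⟩
    change (a : V ≃ₗ[ℂ] V) ((b : V ≃ₗ[ℂ] V) (e j)) = (d * c) • e j
    rw [hd, map_smul, hc, mul_smul]
  inv_mem' := by
    intro a ha j
    obtain ⟨c, hc⟩ := ha j
    refine ⟨c⁻¹, ?_⟩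
    change (a : V ≃ₗ[ℂ] V).symm (e j) = c⁻¹ • e j
    have hc0 : c ≠ 0 := by
      rintro rfl
      rw [zero_smul, LinearEquiv.map_eq_zero_iff] at hc
      exact e.ne_zero j hc
    rw [LinearEquiv.symm_apply_eq, map_smul, hc, smul_smul, inv_mul_cancel₀ hc0, one_smul]

/-- The span `⟨E_I⟩` of the basis vectors with index in `I`. -/
def partSpan (e : Module.Basis ℕ ℂ V) (I : Finset ℕ) : Submodule ℂ V :=
  Submodule.span ℂ (e '' (I : Set ℕ))

/-- `g ∈ G` belongs to `G(E_I) = G ∩ GL(⟨E_I⟩)`, where `GL(⟨E_I⟩)` is viewed as a group of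
automorphisms of `V` that fix the other basis vectors. -/
def MemFiniteLevel (D : ClassicalDatum V) (e : Module.Basis ℕ ℂ V) (I : Finset ℕ)
    (g : D.group) : Prop :=
  (partSpan e I).map ((g : V ≃ₗ[ℂ] V) : V →ₗ[ℂ] V) = partSpan e I ∧
    ∀ j ∉ I, (g : V ≃ₗ[ℂ] V) (e j) = e j

/-- An exhaustion of `ℕ` (that is, of the basis `E`) by an increasing sequence of finite sets,
stable under the involution `i_E` if there is a form. -/
def IsFiltration (D : ClassicalDatum V) (e : Module.Basis ℕ ℂ V) (I : ℕ → Finset ℕ) : Prop :=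
  Monotone I ∧ (∀ j, ∃ n, j ∈ I n) ∧
    ∀ ω ∈ D.form, ∀ n, ∀ j ∈ I n, ∀ k, ω (e j) (e k) ≠ 0 → k ∈ I n

/-- `P ∩ G(E_I)` is a parabolic subgroup of the finite-dimensional classical group `G(E_I)`:
it is the stabilizer in `G(E_I)` of a flag of subspaces of `⟨E_I⟩`, which has to be isotropic
(stable under taking orthogonals in `⟨E_I⟩`) if there is a form. -/
def IsParabolicAtLevel (D : ClassicalDatum V) (e : Module.Basis ℕ ℂ V) (I : Finset ℕ)
    (P : Subgroup D.group) : Prop :=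
  ∃ 𝓕 : Set (Submodule ℂ V), (∀ F ∈ 𝓕, F ≤ partSpan e I) ∧ IsChain (· ≤ ·) 𝓕 ∧
    (∀ ω ∈ D.form, ∀ F ∈ 𝓕, partSpan e I ⊓ ω.orthogonal F ∈ 𝓕) ∧
    ∀ g : D.group, MemFiniteLevel D e I g →
      (g ∈ P ↔ ∀ F ∈ 𝓕, F.map ((g : V ≃ₗ[ℂ] V) : V →ₗ[ℂ] V) = F)

/-- Splitting parabolic subgroups of `G`. -/
def IsSplittingParabolic (D : ClassicalDatum V) (P : Subgroup D.group) : Prop :=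
  ∃ e : Module.Basis ℕ ℂ V, D.IsAdmissible e ∧ D.diagonalSubgroup e ≤ P ∧
    ∃ I : ℕ → Finset ℕ, D.IsFiltration e I ∧ ∀ n, D.IsParabolicAtLevel e (I n) P

/-- `P` is semilarge: only finitely many subspaces of `V` are invariant under `P`. -/
def IsSemilarge (D : ClassicalDatum V) (P : Subgroup D.group) : Prop :=
  {W : Submodule ℂ V | ∀ g ∈ P, ∀ w ∈ W, (g : V ≃ₗ[ℂ] V) w ∈ W}.Finite

/-- `P` is large: it is semilarge and, moreover, the stabilizer in `G` of a finite chain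
`0 = F_0 ⊊ F_1 ⊊ ⋯ ⊊ F_m = V`, with `F_k^⊥ = F_{m-k}` if there is a form, whose members are
all finite dimensional or finite codimensional. -/
def IsLarge (D : ClassicalDatum V) (P : Subgroup D.group) : Prop :=
  D.IsSemilarge P ∧
  ∃ (m : ℕ) (F : Fin (m + 1) → Submodule ℂ V), StrictMono F ∧ F 0 = ⊥ ∧ F (Fin.last m) = ⊤ ∧
    (∀ ω ∈ D.form, ∀ k, ω.orthogonal (F k) = F k.rev) ∧
    (∀ g : D.group, g ∈ P ↔ ∀ k, (F k).map ((g : V ≃ₗ[ℂ] V) : V →ₗ[ℂ] V) = F k) ∧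
    ∀ k, FiniteDimensional ℂ (F k) ∨ (F k).CoFG

end ClassicalDatum

/-! ### Finitary automorphisms and anti-diagonal bases -/

namespace ClassicalDatum

variable {V : Type u} [AddCommGroup V] [Module ℂ V]

/-! A splitting parabolic `P` is governed by its invariant subspaces. They are coordinate subspaces
for the splitting basis, because `P` contains the diagonal torus, and `P` is exactly their common
stabilizer (`SplittingBasis.mem_of_invariants`). They preorder the basis vectors by `Below`.
Transvections and Siegel transformations show that this preorder is total, except that for a
symmetric form the two members of a hyperbolic pair may be incomparable (`below_total_of_none`,
`below_total`).

Finitely many orbits force the conditions. Given a finite family u taken from the first basis and a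
family w taken from the second, far apart from each other, and a suitable permutation π, some
element g of the group sends u_a to a multiple of w_{π a} and acts on the common kernel of the forms
dual to u in a way that does not depend on π (`DualFamily.exists_link`). Elements of the group are
finitary, so relative dimensions of the spaces gM ∩ F, with M invariant under P₁ and F under P₂,
distinguish orbits; here they count the indices a with u_a in M and w_{π a} in F
(`le_card_orbits_of_links`). If P₁ has infinitely many invariants, there are arbitrarily many
pairwise separated basis vectors, and varying which of them receives an exceptional position
relative to F yields arbitrarily many orbits. Hence both groups are semilarge. If neither is large,
both have invariant subspaces of infinite dimension and codimension (`SplittingBasis.isLarge`), and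
the count can again take arbitrarily many values.

Conversely, let P₁ be large and P₂ semilarge. Orbits on the product are P₂-orbits on G/P₁, and a
point of G/P₁ is a flag determined by finite-dimensional data: the finite-dimensional members and,
for the finite-codimensional ones, their orthogonals or finite-dimensional spaces of forms in V_*.
Such data are normalized by Gaussian elimination inside P₂. The support of an isotropic vector has a
highest index for `Below`; a transvection in P₂ reduces the vector to that basis vector, which is
then exchanged with a canonical one of the same type; one splits it off and continues
(`EliminationData.exists_normalList`). There are finitely many types, hence finitely many normal
forms and finitely many orbits (`finite_orbits_of_normalForm`). -/

lemma comp_sub_mem_of_fixes {Φ : Submodule ℂ (Module.Dual ℂ V)} [FiniteDimensional ℂ Φ]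
    {g : V →ₗ[ℂ] V} (h : ∀ x, (∀ φ ∈ Φ, φ x = 0) → g x = x) (ψ : Module.Dual ℂ V) :
    ψ ∘ₗ g - ψ ∈ Φ := by
  -- A finite-dimensional space of forms is the annihilator of its common kernel, so it is enough to
  -- evaluate there.
  rw [← Subspace.dualCoannihilator_dualAnnihilator_eq (W := Φ), Submodule.mem_dualAnnihilator]
  intro x hx
  rw [Submodule.mem_dualCoannihilator] at hx
  simp [h x hx]

/-- A linear automorphism fixing the common kernel of finitely many forms in `Vs` lies
in `GL(∞)`. -/
lemma mem_glInfty_of_fixes {Vs : Submodule ℂ (Module.Dual ℂ V)} {g : V ≃ₗ[ℂ] V}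
    {Φ : Submodule ℂ (Module.Dual ℂ V)} (hΦ : Φ ≤ Vs) [FiniteDimensional ℂ Φ]
    (h : ∀ x, (∀ φ ∈ Φ, φ x = 0) → g x = x) : g ∈ glInfty Vs := by
  have h' : ∀ x, (∀ φ ∈ Φ, φ x = 0) → g.symm x = x := fun x hx => by
    rw [LinearEquiv.symm_apply_eq, h x hx]
  have key : ∀ ψ : Module.Dual ℂ V, g.dualMap ψ - ψ ∈ Φ := fun ψ =>
    comp_sub_mem_of_fixes (g := (g : V →ₗ[ℂ] V)) h ψ
  have key' : ∀ ψ : Module.Dual ℂ V, g.symm.dualMap ψ - ψ ∈ Φ := fun ψ =>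
    comp_sub_mem_of_fixes (g := (g.symm : V →ₗ[ℂ] V)) h' ψ
  refine ⟨?_, ⟨Φ.dualCoannihilator, ?_, ?_⟩, ?_⟩
  · apply le_antisymm
    · rintro _ ⟨ψ, hψ, rfl⟩
      have := Vs.add_mem (hΦ (key' ψ)) hψ
      simpa using this
    · intro ψ hψ
      refine ⟨g.dualMap ψ, ?_, ?_⟩
      · have := Vs.add_mem (hΦ (key ψ)) hψ
        simpa using this
      · ext x
        simp [LinearEquiv.dualMap_apply]
  · exact Subspace.finiteDimensional_quot_dualCoannihilator_iff.2 inferInstance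
  · intro v hv
    exact h v ((Submodule.mem_dualCoannihilator _).1 hv)
  · let f : Vs →ₗ[ℂ] Φ := LinearMap.codRestrict Φ
      (((g.symm.dualMap : Module.Dual ℂ V →ₗ[ℂ] Module.Dual ℂ V) - LinearMap.id) ∘ₗ Vs.subtype)
      (fun ψ => key' ψ)
    refine ⟨LinearMap.ker f, Submodule.CoFG.ker f, fun φ hφ => ?_⟩
    have h1 : g.symm.dualMap (φ : Module.Dual ℂ V) - φ = 0 :=
      congrArg Subtype.val (LinearMap.mem_ker.1 hφ)
    exact sub_eq_zero.1 h1

/-- Converse of `mem_glInfty_of_fixes`. The map g - 1 has finite rank, so the forms φ ∘ (g - 1) with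
φ in V_* make up a finite-dimensional space. They lie in V_* because g preserves V_*, and since V_*
separates points, their common kernel is the fixed space of g. -/
lemma exists_fixes_of_mem_glInfty {Vs : Submodule ℂ (Module.Dual ℂ V)}
    (hsep : ∀ v : V, (∀ φ ∈ Vs, φ v = 0) → v = 0) {g : V ≃ₗ[ℂ] V} (hg : g ∈ glInfty Vs) :
    ∃ Φ ≤ Vs, FiniteDimensional ℂ Φ ∧ ∀ x, (∀ φ ∈ Φ, φ x = 0) → g x = x := by
  obtain ⟨hmap, ⟨U, hU, hUg⟩, -⟩ := hg
  let N : V →ₗ[ℂ] V := (g : V →ₗ[ℂ] V) - LinearMap.id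
  have hN : FiniteDimensional ℂ (LinearMap.range N) := by
    have : (LinearMap.ker N).CoFG := hU.of_le fun v hv => by simp [N, hUg v hv]
    exact Module.Finite.iff_fg.2 (Submodule.range_fg_iff_ker_cofg.2 this)
  refine ⟨Vs.map N.dualMap, ?_, ?_, ?_⟩
  · rintro _ ⟨φ, hφ, rfl⟩
    have h1 : N.dualMap φ = g.dualMap φ - φ := by
      ext x; simp [N]
    rw [h1]
    refine Vs.sub_mem ?_ hφ
    have h2 : φ ∈ Vs.map (g.symm.dualMap : Module.Dual ℂ V →ₗ[ℂ] Module.Dual ℂ V) := by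
      rw [hmap]; exact hφ
    obtain ⟨ψ, hψ, rfl⟩ := h2
    have h3 : g.dualMap (g.symm.dualMap ψ) = ψ := by
      ext x
      simp [LinearEquiv.dualMap_apply]
    simpa [h3] using hψ
  · have : FiniteDimensional ℂ (LinearMap.range N.dualMap) := by
      have h2 : N.dualMap = (N.rangeRestrict).dualMap ∘ₗ (LinearMap.range N).subtype.dualMap := by
        ext; rfl
      rw [h2]
      exact Submodule.finiteDimensional_of_le (LinearMap.range_comp_le_range _ _)
    exact Submodule.finiteDimensional_of_le (LinearMap.map_le_range)
  · intro x hx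
    have : N x = 0 := hsep _ fun φ hφ => hx _ ⟨φ, hφ, rfl⟩
    simpa [N, sub_eq_zero] using this

/-- A bilinear form with its symmetry sign and a basis that is anti-diagonal for it. -/
structure IsotropicBasis (ω : LinearMap.BilinForm ℂ V) (ε : ℂ) (e : Module.Basis ℕ ℂ V)
    (i : ℕ → ℕ) : Prop where
  sign : (ε = 1) ∨ (ε = -1)
  symm : ∀ x y, ω x y = ε * ω y x
  invol : ∀ j, i (i j) = j
  fixed : ∀ j k, i j = j → i k = k → j = k
  gram : ∀ j k, ω (e j) (e k) ≠ 0 ↔ k = i j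

namespace IsotropicBasis

variable {ω : LinearMap.BilinForm ℂ V} {ε : ℂ} {e : Module.Basis ℕ ℂ V} {i : ℕ → ℕ}

lemma apply_left (h : IsotropicBasis ω ε e i) (j : ℕ) (x : V) :
    ω (e j) x = ω (e j) (e (i j)) * e.repr x (i j) := by
  have h1 : ω (e j) = ω (e j) (e (i j)) • e.coord (i j) := by
    refine e.ext fun k => ?_
    by_cases hk : k = i j
    · subst hk; simp
    · have : ω (e j) (e k) = 0 := by
        by_contra h0
        exact hk ((h.gram j k).1 h0)
      simp [this, Ne.symm hk]
  rw [h1]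
  simp

lemma gram_ne (h : IsotropicBasis ω ε e i) (j : ℕ) : ω (e j) (e (i j)) ≠ 0 := (h.gram j _).2 rfl

lemma gram_eq_zero (h : IsotropicBasis ω ε e i) {j k : ℕ} (hk : k ≠ i j) :
    ω (e j) (e k) = 0 := by
  by_contra h0
  exact hk ((h.gram j k).1 h0)

lemma eps_mul (h : IsotropicBasis ω ε e i) : ε * ε = 1 := by
  rcases h.sign with h | h <;> simp [h]

lemma eps_ne (h : IsotropicBasis ω ε e i) : ε ≠ 0 := by
  rcases h.sign with h | h <;> simp [h]

lemma apply_right (h : IsotropicBasis ω ε e i) (j : ℕ) (x : V) :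
    ω x (e j) = ω (e (i j)) (e j) * e.repr x (i j) := by
  rw [h.symm x, h.apply_left, h.symm (e (i j)) (e j)]
  ring

lemma apply_self_of_neg (h : IsotropicBasis ω ε e i) (hε : ε = -1) (x : V) : ω x x = 0 := by
  have := h.symm x x
  rw [hε] at this
  linear_combination this / 2

lemma apply_left_eq_zero_iff (h : IsotropicBasis ω ε e i) (j : ℕ) (x : V) :
    ω (e j) x = 0 ↔ e.repr x (i j) = 0 := by
  rw [h.apply_left]; simp [h.gram_ne]

lemma invol_ne (h : IsotropicBasis ω ε e i) {j k : ℕ} (hjk : j ≠ i k) : k ≠ i j := by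
  rintro rfl; exact hjk (h.invol _).symm

/-- Each form ω(e j, ·) is a nonzero multiple of the coordinate form at i j, and i is a bijection.
Thus the types with a form can be treated with coordinate forms exactly as type A. -/
lemma span_coord (h : IsotropicBasis ω ε e i) :
    Submodule.span ℂ (Set.range e.coord) = LinearMap.range ω := by
  apply le_antisymm
  · rw [Submodule.span_le]
    rintro _ ⟨j, rfl⟩
    refine ⟨(ω (e (i j)) (e j))⁻¹ • e (i j), ?_⟩
    ext x
    have h1 := h.apply_left (i j) x
    have h2 := h.gram_ne (i j)
    rw [h.invol] at h1 h2
    simp [h1, h2]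
  · rw [LinearMap.range_eq_map, ← e.span_eq, Submodule.map_span, Submodule.span_le]
    rintro _ ⟨_, ⟨j, rfl⟩, rfl⟩
    have h1 : ω (e j) = ω (e j) (e (i j)) • e.coord (i j) := by
      ext x; simpa using h.apply_left j x
    rw [SetLike.mem_coe, h1]
    exact Submodule.smul_mem _ _ (Submodule.subset_span ⟨_, rfl⟩)

end IsotropicBasis

lemma dualSpace_of_form {D : ClassicalDatum V} {ω : LinearMap.BilinForm ℂ V}
    (h : D.form = some ω) : D.dualSpace = LinearMap.range ω := by
  cases D <;> simp_all [form, dualSpace]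

lemma exists_isotropicBasis {D : ClassicalDatum V} {ω : LinearMap.BilinForm ℂ V}
    (h : D.form = some ω) : ∃ ε, ∀ e, D.IsAdmissible e → ∃ i, IsotropicBasis ω ε e i := by
  cases D with
  | typeA Vs h1 h2 => simp [form] at h
  | typeBD ω' hnd hs =>
    simp only [form, Option.some.injEq] at h
    subst h
    refine ⟨1, fun e he => ?_⟩
    obtain ⟨i, h1, h2, h3⟩ := he
    exact ⟨i, Or.inl rfl, fun x y => by simpa using hs.eq x y, h1,
      fun j k hj hk => h2 hj hk, h3⟩
  | typeC ω' hnd ha =>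
    simp only [form, Option.some.injEq] at h
    subst h
    refine ⟨-1, fun e he => ?_⟩
    obtain ⟨i, h1, h2, h3⟩ := he
    refine ⟨i, Or.inr rfl, fun x y => ?_, h1, fun j k hj hk => h2 hj hk, h3⟩
    rw [neg_one_mul]
    rw [← LinearMap.BilinForm.IsAlt.neg_eq ha y x]

lemma span_coord_of_isAdmissible {D : ClassicalDatum V} {e : Module.Basis ℕ ℂ V}
    (he : D.IsAdmissible e) : Submodule.span ℂ (Set.range e.coord) = D.dualSpace := by
  rcases hD : D.form with _ | ω
  · cases D with
    | typeA Vs h1 h2 => exact he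
    | typeBD => simp [form] at hD
    | typeC => simp [form] at hD
  · obtain ⟨ε, h⟩ := exists_isotropicBasis hD
    obtain ⟨i, hi⟩ := h e he
    rw [dualSpace_of_form hD, hi.span_coord]

lemma coord_mem_dualSpace {D : ClassicalDatum V} {e : Module.Basis ℕ ℂ V}
    (he : D.IsAdmissible e) (j : ℕ) : e.coord j ∈ D.dualSpace := by
  rw [← span_coord_of_isAdmissible he]
  exact Submodule.subset_span ⟨j, rfl⟩

lemma apply_form_mem_dualSpace {D : ClassicalDatum V} {ω : LinearMap.BilinForm ℂ V}
    (h : D.form = some ω) (x : V) : ω x ∈ D.dualSpace := by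
  rw [dualSpace_of_form h]; exact ⟨x, rfl⟩

lemma eq_zero_of_dualSpace {D : ClassicalDatum V} {e : Module.Basis ℕ ℂ V}
    (he : D.IsAdmissible e) (v : V) (h : ∀ φ ∈ D.dualSpace, φ v = 0) : v = 0 := by
  refine e.repr.map_eq_zero_iff.1 (Finsupp.ext fun j => ?_)
  simpa using h _ (coord_mem_dualSpace he j)

/-- An automorphism that fixes almost all vectors of an admissible basis in the weak sense that
it fixes the common kernel of finitely many forms, and preserves the form, as an element of `G`. -/
lemma mem_group_of_fixes {D : ClassicalDatum V} {g : V ≃ₗ[ℂ] V} {s : Set (Module.Dual ℂ V)}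
    (hs : s.Finite) (hsV : s ⊆ D.dualSpace) (h : ∀ x, (∀ φ ∈ s, φ x = 0) → g x = x)
    (hω : ∀ ω ∈ D.form, ∀ x y : V, ω (g x) (g y) = ω x y) : g ∈ D.group := by
  have : FiniteDimensional ℂ (Submodule.span ℂ s) := FiniteDimensional.span_of_finite ℂ hs
  exact ⟨mem_glInfty_of_fixes (Φ := Submodule.span ℂ s) (Submodule.span_le.2 hsV)
    fun x hx => h x fun φ hφ => hx φ (Submodule.subset_span hφ), hω⟩

end ClassicalDatum

/-! ### Explicit elements of the group: monomial maps, Siegel transformations, dilatransvections -/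

namespace ClassicalDatum

variable {V : Type u} [AddCommGroup V] [Module ℂ V]

section Monomial

variable {κ : Type*} [Fintype κ]

/-- V is the direct sum of the span of u and the common kernel of us. -/
lemma linearMap_ext_of_biorthogonal [DecidableEq κ] {W : Type*} [AddCommGroup W] [Module ℂ W]
    {u : κ → V} {us : κ → Module.Dual ℂ V}
    (hb : ∀ a b, us a (u b) = if a = b then 1 else 0) {f g : V →ₗ[ℂ] W}
    (h1 : ∀ a, f (u a) = g (u a)) (h2 : ∀ x, (∀ a, us a x = 0) → f x = g x) : f = g := by
  ext x
  have h3 := h2 (x - ∑ a, us a x • u a) fun a => by simp [hb]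
  simpa [map_sub, map_sum, h1] using h3

/-- The linear map permuting a biorthogonal family up to scalars and fixing the common kernel of
the dual family. -/
def monomialMap (u : κ → V) (us : κ → Module.Dual ℂ V) (σ : Equiv.Perm κ) (c : κ → ℂ) :
    V →ₗ[ℂ] V :=
  LinearMap.id + ∑ a, (us a).smulRight (c a • u (σ a) - u a)

lemma monomialMap_apply [DecidableEq κ] (u : κ → V) (us : κ → Module.Dual ℂ V)
    (hb : ∀ a b, us a (u b) = if a = b then 1 else 0) (σ : Equiv.Perm κ) (c : κ → ℂ) (a : κ) :
    monomialMap u us σ c (u a) = c a • u (σ a) := by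
  simp [monomialMap, hb]

lemma monomialMap_fix (u : κ → V) (us : κ → Module.Dual ℂ V) (σ : Equiv.Perm κ) (c : κ → ℂ)
    {x : V} (hx : ∀ a, us a x = 0) : monomialMap u us σ c x = x := by
  simp [monomialMap, hx]

lemma monomialMap_comp [DecidableEq κ] (u : κ → V) (us : κ → Module.Dual ℂ V)
    (hb : ∀ a b, us a (u b) = if a = b then 1 else 0) (σ τ : Equiv.Perm κ) (c d : κ → ℂ)
    (h : ∀ a, τ (σ a) = a) (hcd : ∀ a, c a * d (σ a) = 1) :
    monomialMap u us τ d ∘ₗ monomialMap u us σ c = LinearMap.id := by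
  refine linearMap_ext_of_biorthogonal hb (fun a => ?_) fun x hx => ?_
  · simp [monomialMap_apply u us hb, smul_smul, h, hcd]
  · simp [monomialMap_fix u us _ _ hx]

/-- The span of u is orthogonal to the common kernel of us, which is fixed pointwise; the isometry
condition therefore reduces to the Gram matrix of u. -/
lemma exists_monomial [DecidableEq κ] (D : ClassicalDatum V) {u : κ → V} {us : κ → Module.Dual ℂ V}
    (hus : ∀ a, us a ∈ D.dualSpace) (hb : ∀ a b, us a (u b) = if a = b then 1 else 0)
    (σ : Equiv.Perm κ) {c : κ → ℂ} (hc : ∀ a, c a ≠ 0)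
    (hω : ∀ ω ∈ D.form, (∀ a b, ω (c a • u (σ a)) (c b • u (σ b)) = ω (u a) (u b)) ∧
      ∀ x, (∀ a, us a x = 0) → ∀ b, ω (u b) x = 0 ∧ ω x (u b) = 0) :
    ∃ g : D.group, (∀ a, g.1 (u a) = c a • u (σ a)) ∧ ∀ x, (∀ a, us a x = 0) → g.1 x = x := by
  let g : V ≃ₗ[ℂ] V := LinearEquiv.ofLinearMap (monomialMap u us σ c)
    (monomialMap u us σ⁻¹ fun b => (c (σ⁻¹ b))⁻¹)
    (monomialMap_comp u us hb _ _ _ _ (by simp) (fun a => inv_mul_cancel₀ (hc _)))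
    (monomialMap_comp u us hb _ _ _ _ (by simp) (fun a => by simp [hc]))
  have h1 : ∀ a, g (u a) = c a • u (σ a) := monomialMap_apply u us hb σ c
  have h2 : ∀ x, (∀ a, us a x = 0) → g x = x := fun x hx => monomialMap_fix u us σ c hx
  refine ⟨⟨g, mem_group_of_fixes (s := Set.range us) (Set.finite_range us) ?_ ?_ ?_⟩, h1, h2⟩
  · rintro _ ⟨a, rfl⟩; exact hus a
  · intro x hx
    exact h2 x fun a => hx _ ⟨a, rfl⟩
  · intro ω hD x y
    obtain ⟨h3, h4⟩ := hω ω hD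
    have : ω.compl₁₂ (g : V →ₗ[ℂ] V) (g : V →ₗ[ℂ] V) = ω := by
      refine linearMap_ext_of_biorthogonal hb (fun a => ?_) fun x hx => ?_
      · refine linearMap_ext_of_biorthogonal hb (fun b => ?_) fun y hy => ?_
        · simpa [h1] using h3 a b
        · simp [h1, h2 y hy, (h4 y hy _).1]
      · refine linearMap_ext_of_biorthogonal hb (fun b => ?_) fun y hy => ?_
        · simp [h1, h2 x hx, (h4 x hx _).2]
        · simp [h2 x hx, h2 y hy]
    exact LinearMap.congr_fun₂ this x y

end Monomial

/-- Siegel transformations: an isotropic vector with `k`-th coordinate `1` is the image of the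
basis vector `e k` under an element of the group that moves the other basis vectors only by
multiples of `e (i k)`. -/
lemma exists_siegel {D : ClassicalDatum V} {ω : LinearMap.BilinForm ℂ V} (hD : D.form = some ω)
    {ε : ℂ} {e : Module.Basis ℕ ℂ V} {i : ℕ → ℕ} (h : IsotropicBasis ω ε e i)
    {k : ℕ} (hk : i k ≠ k) {v : V} (hv : ω v v = 0) (hvk : e.repr v k = 1) :
    ∃ g : D.group, g.1 (e k) = v ∧
      ∀ l ≠ k, ∃ b : ℂ, g.1 (e l) = e l + b • e (i k) ∧ (e.repr v (i l) = 0 → b = 0) := by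
  obtain ⟨z, hz⟩ : ∃ z, v = e k + z := ⟨v - e k, by abel⟩
  have hκ := h.gram_ne k
  obtain ⟨q, hq⟩ : ∃ q, q = ω (e k) (e (i k)) := ⟨_, rfl⟩
  rw [← hq] at hκ
  have hzk : e.repr z k = 0 := by
    have h1 := hvk
    rw [hz] at h1
    simpa using h1
  have hright : ∀ x, ω x (e (i k)) = q * e.repr x k := fun x => by
    rw [h.apply_right, h.invol, hq]
  have hleft : ∀ x, ω (e (i k)) x = ε * (q * e.repr x k) := fun x => by rw [h.symm, hright]
  have hkk : ω (e k) (e k) = 0 := h.gram_eq_zero (Ne.symm hk)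
  -- Isotropy of v = e k + z, expanded; this relation closes the isometry check below.
  have hiso : (1 + ε) * ω z (e k) + ω z z = 0 := by
    have h1 := hv
    rw [hz] at h1
    simp only [map_add, LinearMap.add_apply, hkk, h.symm (e k) z] at h1
    linear_combination h1
  let a : V →ₗ[ℂ] ℂ := e.coord k
  -- The term ω z compensates the change of ω caused by adding multiples of z; the correction by the
  -- k-th coordinate makes b (e k) vanish, so that e k goes exactly to v.
  let b : V →ₗ[ℂ] ℂ := (-q⁻¹) • (ω z - ω z (e k) • e.coord k)
  have hb : ∀ y, q * b y = -(ω z y - e.repr y k * ω z (e k)) := fun y => by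
    simp only [b, LinearMap.smul_apply, LinearMap.sub_apply, Module.Basis.coord_apply, smul_eq_mul]
    field_simp
  have hbik : b (e (i k)) = 0 := by
    have := hb (e (i k))
    rw [hright, hzk] at this
    simpa [hk, hκ] using this
  let N : V →ₗ[ℂ] V := a.smulRight z + b.smulRight (e (i k))
  have hN : ∀ x, N x = e.repr x k • z + b x • e (i k) := fun x => rfl
  have hNik : N (e (i k)) = 0 := by simp [hN, hbik, hk]
  have hNz : N z = b z • e (i k) := by simp [hN, hzk]
  -- N sends z to a multiple of e (i k) and kills e (i k), so N³ = 0 and the inverse of 1 + N is 1 -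
  -- N + N².
  let g : V ≃ₗ[ℂ] V := LinearEquiv.ofLinearMap (LinearMap.id + N) (LinearMap.id - N + N ∘ₗ N)
    (by
      ext x
      simp only [LinearMap.comp_apply, LinearMap.add_apply, LinearMap.sub_apply,
        LinearMap.id_apply, map_add, map_sub]
      have : N (N (N x)) = 0 := by rw [hN x]; simp [hNz, hNik]
      rw [this]; abel)
    (by
      ext x
      simp only [LinearMap.comp_apply, LinearMap.add_apply, LinearMap.sub_apply,
        LinearMap.id_apply, map_add]
      have : N (N (N x)) = 0 := by rw [hN x]; simp [hNz, hNik]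
      rw [this]; abel)
  have hg : ∀ x, g x = x + e.repr x k • z + b x • e (i k) := fun x => by
    rw [add_assoc, ← hN]; rfl
  have hbl : ∀ l, l ≠ k → e.repr v (i l) = 0 → b (e l) = 0 := fun l hl h0 => by
    have h1 := hb (e l)
    have h2 : e.repr z (i l) = 0 := by
      rw [hz] at h0
      by_cases hlk : k = i l
      · rw [← hlk, hzk]
      · simpa [hlk] using h0
    rw [h.apply_right, h2] at h1
    simpa [hl, hκ] using h1
  refine ⟨⟨g, mem_group_of_fixes (s := {a, b}) (by simp) ?_ ?_ ?_⟩, ?_, ?_⟩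
  · have hz' : ω z ∈ D.dualSpace := apply_form_mem_dualSpace hD z
    have ha' : e.coord k ∈ D.dualSpace := by
      rw [dualSpace_of_form hD, ← h.span_coord]
      exact Submodule.subset_span ⟨k, rfl⟩
    rintro _ (rfl | rfl)
    · exact ha'
    · exact Submodule.smul_mem _ _ (Submodule.sub_mem _ hz' (Submodule.smul_mem _ _ ha'))
  · intro x hx
    have h1 : e.repr x k = 0 := hx a (by simp)
    have h2 : b x = 0 := hx b (by simp)
    rw [hg, h1, h2]; simp
  · intro ω' hω' x y
    obtain rfl : ω = ω' := by simpa [hD] using hω'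
    rw [hg, hg]
    simp only [map_add, map_smul, LinearMap.add_apply, LinearMap.smul_apply, smul_eq_mul, hright,
      hleft, hzk, h.symm x z]
    have e1 := hb x
    have e2 := hb y
    have e3 : e.repr (e (i k)) k = 0 := by simp [hk]
    rw [e3]
    linear_combination e.repr x k * e2 + ε * e.repr y k * e1 + e.repr x k * e.repr y k * hiso
  · change g (e k) = v
    have h1 : b (e k) = 0 := by
      have := hb (e k)
      simpa [hκ] using this
    rw [hg, h1, hz]; simp
  · intro l hl
    refine ⟨b (e l), ?_, hbl l hl⟩
    change g (e l) = _
    rw [hg]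
    simp [hl]

/-- The condition on f w is that of invertibility. This covers both the transvections (f w = 0) and
the rescaling of a single basis vector. -/
lemma exists_dilatransvection {D : ClassicalDatum V} (hD : D.form = none)
    {f : Module.Dual ℂ V} (hf : f ∈ D.dualSpace) {w : V} (hw : 1 + f w ≠ 0) :
    ∃ g : D.group, ∀ x, g.1 x = x + f x • w :=
  ⟨⟨LinearEquiv.dilatransvection (IsUnit.mk0 _ hw), mem_group_of_fixes (s := {f}) (by simp)
    (by simpa using hf)
    (fun x hx => by
      rw [LinearEquiv.dilatransvection.apply, hx f rfl]
      simp)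
    (fun ω hω => by simp [hD] at hω)⟩,
    fun x => LinearEquiv.dilatransvection.apply⟩

end ClassicalDatum

/-! ### Coordinate subspaces and finite levels -/

namespace ClassicalDatum

variable {V : Type u} [AddCommGroup V] [Module ℂ V]

/-- A subspace spanned by a part of the basis `e`. -/
def IsCoordinate (e : Module.Basis ℕ ℂ V) (M : Submodule ℂ V) : Prop :=
  ∀ x ∈ M, ∀ j, e.repr x j ≠ 0 → e j ∈ M

lemma mem_of_repr {e : Module.Basis ℕ ℂ V} {M : Submodule ℂ V} {x : V}
    (h : ∀ j, e.repr x j ≠ 0 → e j ∈ M) : x ∈ M := by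
  rw [← e.linearCombination_repr x, Finsupp.linearCombination_apply]
  exact Submodule.sum_mem _ fun j hj => M.smul_mem _ (h j (Finsupp.mem_support_iff.1 hj))

lemma IsCoordinate.le_of_forall {e : Module.Basis ℕ ℂ V} {M N : Submodule ℂ V}
    (hM : IsCoordinate e M) (h : ∀ j, e j ∈ M → e j ∈ N) : M ≤ N :=
  fun x hx => mem_of_repr fun j hj => h j (hM x hx j hj)

lemma IsCoordinate.map_le {e : Module.Basis ℕ ℂ V} {M N : Submodule ℂ V}
    (hM : IsCoordinate e M) {f : V →ₗ[ℂ] V} (h : ∀ j, e j ∈ M → f (e j) ∈ N) {x : V}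
    (hx : x ∈ M) : f x ∈ N := by
  have : M ≤ N.comap f := hM.le_of_forall h
  exact this hx

lemma mem_partSpan_iff {e : Module.Basis ℕ ℂ V} {I : Finset ℕ} {x : V} :
    x ∈ partSpan e I ↔ ∀ j, e.repr x j ≠ 0 → j ∈ I := by
  constructor
  · intro hx j hj
    have := e.mem_span_image.1 hx
    exact this (Finsupp.mem_support_iff.2 hj)
  · intro h
    exact e.mem_span_image.2 fun j hj => h j (Finsupp.mem_support_iff.1 hj)

lemma basis_mem_partSpan {e : Module.Basis ℕ ℂ V} {I : Finset ℕ} {j : ℕ} (hj : j ∈ I) :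
    e j ∈ partSpan e I := Submodule.subset_span ⟨j, hj, rfl⟩

lemma basis_mem_partSpan_iff {e : Module.Basis ℕ ℂ V} {I : Finset ℕ} {j : ℕ} :
    e j ∈ partSpan e I ↔ j ∈ I :=
  ⟨fun h => mem_partSpan_iff.1 h j (by simp), basis_mem_partSpan⟩

instance (e : Module.Basis ℕ ℂ V) (I : Finset ℕ) : FiniteDimensional ℂ (partSpan e I) :=
  FiniteDimensional.span_of_finite ℂ (I.finite_toSet.image e)

lemma isCoordinate_partSpan {e : Module.Basis ℕ ℂ V} {I : Finset ℕ} :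
    IsCoordinate e (partSpan e I) :=
  fun _ hx j hj => basis_mem_partSpan (mem_partSpan_iff.1 hx j hj)

lemma map_eq_of_forall_mem {M : Submodule ℂ V} [FiniteDimensional ℂ M] {g : V ≃ₗ[ℂ] V}
    (h : ∀ x ∈ M, g x ∈ M) : M.map (g : V →ₗ[ℂ] V) = M := by
  refine Submodule.eq_of_le_of_finrank_eq ?_ (LinearEquiv.finrank_map_eq g M)
  rintro _ ⟨x, hx, rfl⟩
  exact h x hx

lemma memFiniteLevel_of {D : ClassicalDatum V} {e : Module.Basis ℕ ℂ V} {I : Finset ℕ}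
    {g : D.group} (h1 : ∀ j ∈ I, g.1 (e j) ∈ partSpan e I) (h2 : ∀ j ∉ I, g.1 (e j) = e j) :
    MemFiniteLevel D e I g :=
  ⟨map_eq_of_forall_mem fun _ hx => isCoordinate_partSpan.map_le (f := (g.1 : V →ₗ[ℂ] V))
    (fun j hj => h1 j (basis_mem_partSpan_iff.1 hj)) hx, h2⟩

/-- The subspaces of `V` invariant under `P`. -/
def invariants {D : ClassicalDatum V} (P : Subgroup D.group) : Set (Submodule ℂ V) :=
  {W | ∀ g ∈ P, ∀ w ∈ W, (g : V ≃ₗ[ℂ] V) w ∈ W}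

lemma map_eq_of_mem_invariants {D : ClassicalDatum V} {P : Subgroup D.group}
    {M : Submodule ℂ V} (hM : M ∈ invariants P) {g : D.group} (hg : g ∈ P) :
    M.map (g.1 : V →ₗ[ℂ] V) = M := by
  apply le_antisymm
  · rintro _ ⟨x, hx, rfl⟩
    exact hM g hg x hx
  · intro x hx
    exact ⟨g.1.symm x, hM g⁻¹ (inv_mem hg) x hx, by simp⟩

lemma repr_diag {e : Module.Basis ℕ ℂ V} {g : V ≃ₗ[ℂ] V} {c : ℕ → ℂ}
    (h : ∀ l, g (e l) = c l • e l) (x : V) (l : ℕ) : e.repr (g x) l = c l * e.repr x l := by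
  have : e.coord l ∘ₗ (g : V →ₗ[ℂ] V) = c l • e.coord l := by
    refine e.ext fun k => ?_
    by_cases hk : k = l
    · subst hk; simp [h]
    · simp [h, hk]
  exact LinearMap.congr_fun this x

/-- A diagonal element that singles out the `j`-th coordinate. -/
lemma exists_diag (D : ClassicalDatum V) {e : Module.Basis ℕ ℂ V} (he : D.IsAdmissible e)
    (j : ℕ) : ∃ g ∈ D.diagonalSubgroup e,
      (∀ M : Submodule ℂ V, (∀ x ∈ M, g.1 x ∈ M) → ∀ x ∈ M, e.repr x j ≠ 0 → e j ∈ M) ∧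
      ∀ I : Finset ℕ, j ∈ I → (∀ ω ∈ D.form, ∀ l ∈ I, ∀ k, ω (e l) (e k) ≠ 0 → k ∈ I) →
        ∀ l ∉ I, g.1 (e l) = e l := by
  -- All eigenvalues other than the j-th are 1 or 1/2, so (g - 1)(g - 1/2) kills every coordinate
  -- except the j-th, on which it acts by a nonzero scalar.
  suffices H : ∃ g : D.group, ∃ c : ℕ → ℂ, (∀ l, g.1 (e l) = c l • e l) ∧ c j ≠ 1 ∧ c j ≠ 1 / 2 ∧
      (∀ l ≠ j, c l = 1 ∨ c l = 1 / 2) ∧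
      ∀ I : Finset ℕ, j ∈ I → (∀ ω ∈ D.form, ∀ l ∈ I, ∀ k, ω (e l) (e k) ≠ 0 → k ∈ I) →
        ∀ l ∉ I, c l = 1 by
    obtain ⟨g, c, h1, h2, h3, h4, h5⟩ := H
    refine ⟨g, fun l => ⟨c l, h1 l⟩, fun M hM x hx hj => ?_, fun I hI hI' l hl => ?_⟩
    · have hy : g.1 x - x ∈ M := M.sub_mem (hM x hx) hx
      obtain ⟨y, hy'⟩ : ∃ y, y = g.1 x - x := ⟨_, rfl⟩
      rw [← hy'] at hy
      have hz : g.1 y - (1 / 2 : ℂ) • y ∈ M := M.sub_mem (hM y hy) (M.smul_mem _ hy)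
      have key : g.1 y - (1 / 2 : ℂ) • y = ((c j - 1 / 2) * (c j - 1) * e.repr x j) • e j := by
        apply e.repr.injective
        ext l
        by_cases hl : l = j
        · subst hl
          simp [hy', repr_diag h1]
          ring
        · rcases h4 l hl with h | h
          · simp [hy', repr_diag h1, h, Ne.symm hl]
          · simp [hy', repr_diag h1, h, Ne.symm hl]
            ring
      rw [key] at hz
      refine (M.smul_mem_iff ?_).1 hz
      exact mul_ne_zero (mul_ne_zero (sub_ne_zero.2 h3) (sub_ne_zero.2 h2)) hj
    · rw [h1, h5 I hI hI' l hl, one_smul]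
  rcases hD : D.form with _ | ω
  · obtain ⟨g, hg⟩ := exists_dilatransvection hD (coord_mem_dualSpace he j) (w := e j)
      (by simp)
    refine ⟨g, fun l => if l = j then 2 else 1, fun l => ?_, ?_, ?_, ?_, ?_⟩
    · rw [hg]
      by_cases hl : l = j
      · subst hl; simp [two_smul]
      · simp [hl]
    · simp
    · norm_num
    · intro l hl; simp [hl]
    · intro I hI _ l hl
      have : l ≠ j := fun h => hl (h ▸ hI)
      simp [this]
  · obtain ⟨ε, h⟩ := exists_isotropicBasis hD
    obtain ⟨i, hi⟩ := h e he
    let J : Finset ℕ := {j, i j}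
    -- An isometry needs c l * c (i l) = 1: hence the values 2 and 1/2 on a genuine pair, and -1 at
    -- a fixed index.
    let c : ℕ → ℂ := fun l => if l = j then (if i j = j then -1 else 2) else
      if l = i j then 1 / 2 else 1
    have hJ : ∀ l, l ∈ J → i l ∈ J := by
      intro l hl
      simp only [J, Finset.mem_insert, Finset.mem_singleton] at hl ⊢
      rcases hl with rfl | rfl
      · simp
      · simp [hi.invol]
    have hc : ∀ l, c l * c (i l) = 1 := by
      intro l
      by_cases h1 : l = j
      · subst h1
        by_cases h2 : i l = l
        · simp [c, h2]
        · simp [c, h2]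
      · by_cases h2 : l = i j
        · subst h2
          simp only [c, hi.invol, if_neg h1, if_true]
          norm_num
        · have h3 : i l ≠ j := by rintro rfl; exact h2 (hi.invol _).symm
          have h4 : i l ≠ i j := fun h5 => h1 (by rw [← hi.invol l, h5, hi.invol])
          simp [c, h1, h2, h3, h4]
    obtain ⟨g, hg1, hg2⟩ := exists_monomial D (κ := J) (u := fun a => e a)
      (us := fun a => e.coord a) (fun a => coord_mem_dualSpace he a)
      (fun a b => by
        by_cases hab : a = b
        · subst hab; simp
        · simp [hab]) 1 (c := fun a => c a)
      (fun a h0 => by have := hc a; rw [h0] at this; simp at this) (by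
        intro ω' hω'
        obtain rfl : ω = ω' := by simpa [hD] using hω'
        refine ⟨fun a b => ?_, fun x hx b => ⟨?_, ?_⟩⟩
        · by_cases hab : (b : ℕ) = i a
          · have := hc a
            simp only [Equiv.Perm.coe_one, id_eq, map_smul, LinearMap.smul_apply, smul_eq_mul, hab]
            linear_combination (ω (e a) (e (i a))) * this
          · simp [hi.gram_eq_zero hab]
        · rw [hi.apply_left, show e.repr x (i b) = 0 from hx ⟨i b, hJ b b.2⟩, mul_zero]
        · rw [hi.apply_right, show e.repr x (i b) = 0 from hx ⟨i b, hJ b b.2⟩, mul_zero])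
    refine ⟨g, c, fun l => ?_, ?_, ?_, ?_, ?_⟩
    · by_cases hl : l ∈ J
      · exact hg1 ⟨l, hl⟩
      · rw [hg2]
        · have : l ≠ j ∧ l ≠ i j := by simpa [J] using hl
          simp [c, this]
        · intro a
          have : l ≠ a := fun h0 => hl (h0 ▸ a.2)
          simp [this]
    · by_cases h2 : i j = j
      · simp [c, h2]; norm_num
      · simp [c, h2]
    · by_cases h2 : i j = j
      · simp [c, h2]; norm_num
      · simp [c, h2]; norm_num
    · intro l hl
      by_cases h2 : l = i j
      · right; simp only [c]; rw [if_neg hl, if_pos h2]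
      · left; simp [c, hl, h2]
    · intro I hI hI' l hl
      have h1 : l ≠ j := fun h => hl (h ▸ hI)
      have h2 : l ≠ i j := fun h => hl (h ▸ hI' ω rfl j hI _ (hi.gram_ne j))
      simp [c, h1, h2]

/-- By `exists_fixes_of_mem_glInfty` an element of the group is trivial on the common kernel of
finitely many forms in V_*, and these involve only finitely many coordinates of an admissible basis.
-/
lemma exists_memFiniteLevel {D : ClassicalDatum V} {e : Module.Basis ℕ ℂ V}
    (he : D.IsAdmissible e) (g : D.group) :
    ∃ A : Finset ℕ, ∀ I, A ⊆ I → MemFiniteLevel D e I g := by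
  obtain ⟨Φ, hΦ, hfin, hfix⟩ := exists_fixes_of_mem_glInfty (eq_zero_of_dualSpace he) g.2.1
  rw [← span_coord_of_isAdmissible he] at hΦ
  have h1 : ∃ A : Finset ℕ, Φ ≤ Submodule.span ℂ (e.coord '' (A : Set ℕ)) := by
    obtain ⟨S, hS⟩ := (Module.Finite.iff_fg.1 hfin : Φ.FG)
    have h2 : ∀ φ : Module.Dual ℂ V, φ ∈ Φ →
        ∃ A : Finset ℕ, φ ∈ Submodule.span ℂ (e.coord '' (A : Set ℕ)) := by
      intro φ hφ
      have h3 := hΦ hφ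
      rw [← Set.image_univ] at h3
      obtain ⟨c, -, hc⟩ := (Finsupp.mem_span_image_iff_linearCombination ℂ).1 h3
      refine ⟨c.support, ?_⟩
      exact (Finsupp.mem_span_image_iff_linearCombination ℂ).2
        ⟨c, (Finsupp.mem_supported _ _).2 subset_rfl, hc⟩
    choose! A hA using h2
    refine ⟨S.biUnion A, ?_⟩
    rw [← hS, Submodule.span_le]
    intro φ hφ
    refine Submodule.span_mono ?_ (hA φ (hS ▸ Submodule.subset_span hφ))
    exact Set.image_mono (by exact_mod_cast Finset.subset_biUnion_of_mem A hφ)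
  obtain ⟨A, hA⟩ := h1
  -- Basis vectors with index outside A are fixed; the second set collects the supports of the
  -- images of the others.
  refine ⟨A ∪ A.biUnion fun j => (e.repr (g.1 (e j))).support, fun I hI => ?_⟩
  have hout : ∀ j ∉ A, g.1 (e j) = e j := by
    intro j hj
    refine hfix _ fun φ hφ => ?_
    have : Submodule.span ℂ (e.coord '' (A : Set ℕ)) ≤
        LinearMap.ker (LinearMap.applyₗ (R := ℂ) (M₂ := ℂ) (e j)) := by
      rw [Submodule.span_le]
      rintro _ ⟨l, hl, rfl⟩
      have : j ≠ l := fun h => hj (h ▸ hl)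
      simp [this]
    exact this (hA hφ)
  refine memFiniteLevel_of (fun j hj => ?_) fun j hj =>
    hout j fun h => hj (hI (Finset.mem_union_left _ h))
  by_cases hjA : j ∈ A
  · refine mem_partSpan_iff.2 fun l hl => hI (Finset.mem_union_right _ ?_)
    exact Finset.mem_biUnion.2 ⟨j, hjA, Finsupp.mem_support_iff.2 hl⟩
  · rw [hout j hjA]
    exact basis_mem_partSpan hj

end ClassicalDatum

/-! ### Invariant subspaces of a splitting parabolic and the preorder they induce -/

namespace ClassicalDatum

variable {V : Type u} [AddCommGroup V] [Module ℂ V]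

/-- The basis `e` and the exhaustion `I` exhibit `P` as a splitting parabolic subgroup. -/
structure SplittingBasis (D : ClassicalDatum V) (P : Subgroup D.group)
    (e : Module.Basis ℕ ℂ V) (I : ℕ → Finset ℕ) : Prop where
  adm : D.IsAdmissible e
  diag : D.diagonalSubgroup e ≤ P
  filt : D.IsFiltration e I
  par : ∀ n, D.IsParabolicAtLevel e (I n) P

/-- `j` precedes `k` if every `P`-invariant subspace containing `e k` contains `e j`. -/
def Below {D : ClassicalDatum V} (P : Subgroup D.group) (e : Module.Basis ℕ ℂ V) (j k : ℕ) :
    Prop :=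
  ∀ M ∈ invariants P, e k ∈ M → e j ∈ M

lemma IsCoordinate.mem_orthogonal {ω : LinearMap.BilinForm ℂ V} {ε : ℂ}
    {e : Module.Basis ℕ ℂ V} {i : ℕ → ℕ} (h : IsotropicBasis ω ε e i) {M : Submodule ℂ V}
    (hM : IsCoordinate e M) (j : ℕ) : e j ∈ ω.orthogonal M ↔ e (i j) ∉ M := by
  constructor
  · intro hj hij
    have h1 : ω (e (i j)) (e j) = 0 := hj _ hij
    have h2 := h.gram_ne (i j)
    rw [h.invol] at h2
    exact h2 h1
  · intro hij x hx
    change ω x (e j) = 0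
    rw [h.apply_right]
    by_contra h0
    exact hij (hM x hx _ (right_ne_zero_of_mul h0))

lemma IsCoordinate.orthogonal {ω : LinearMap.BilinForm ℂ V} {ε : ℂ}
    {e : Module.Basis ℕ ℂ V} {i : ℕ → ℕ} (h : IsotropicBasis ω ε e i) {M : Submodule ℂ V}
    (hM : IsCoordinate e M) : IsCoordinate e (ω.orthogonal M) := by
  intro x hx j hj
  rw [hM.mem_orthogonal h]
  intro h0
  have h1 : ω (e (i j)) x = 0 := hx _ h0
  rw [h.apply_left_eq_zero_iff, h.invol] at h1
  exact hj h1

lemma IsCoordinate.ext {e : Module.Basis ℕ ℂ V} {M N : Submodule ℂ V}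
    (hM : IsCoordinate e M) (hN : IsCoordinate e N) (h : ∀ j, e j ∈ M ↔ e j ∈ N) : M = N :=
  le_antisymm (hM.le_of_forall fun j => (h j).1) (hN.le_of_forall fun j => (h j).2)

lemma IsCoordinate.orthogonal_orthogonal {ω : LinearMap.BilinForm ℂ V} {ε : ℂ}
    {e : Module.Basis ℕ ℂ V} {i : ℕ → ℕ} (h : IsotropicBasis ω ε e i) {M : Submodule ℂ V}
    (hM : IsCoordinate e M) : ω.orthogonal (ω.orthogonal M) = M := by
  refine ((hM.orthogonal h).orthogonal h).ext hM fun j => ?_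
  rw [(hM.orthogonal h).mem_orthogonal h, hM.mem_orthogonal h, h.invol, not_not]

lemma orthogonal_mem_invariants {D : ClassicalDatum V} {P : Subgroup D.group}
    {ω : LinearMap.BilinForm ℂ V} (hD : D.form = some ω) {M : Submodule ℂ V}
    (hM : M ∈ invariants P) : ω.orthogonal M ∈ invariants P := by
  intro g hg x hx y hy
  have h1 : g⁻¹.1 y ∈ M := hM g⁻¹ (inv_mem hg) y hy
  have h2 : ω (g⁻¹.1 y) x = 0 := hx _ h1
  have h3 := g.2.2 ω (by simp [hD]) (g⁻¹.1 y) x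
  rw [h2] at h3
  convert h3 using 2
  change ω y = ω (g.1 (g.1.symm y))
  simp

lemma inf_mem_invariants {D : ClassicalDatum V} {P : Subgroup D.group} {M N : Submodule ℂ V}
    (hM : M ∈ invariants P) (hN : N ∈ invariants P) : M ⊓ N ∈ invariants P :=
  fun g hg x hx => ⟨hM g hg x hx.1, hN g hg x hx.2⟩

/-- A Siegel transformation stabilizes a coordinate subspace if it does so for the distinguished
vector, and dually. -/
lemma siegel_stabilizes {ω : LinearMap.BilinForm ℂ V} {ε : ℂ} {e : Module.Basis ℕ ℂ V}
    {i : ℕ → ℕ} (h : IsotropicBasis ω ε e i) {k : ℕ} {v : V} {g : V ≃ₗ[ℂ] V}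
    (h1 : g (e k) = v)
    (h2 : ∀ l ≠ k, ∃ b : ℂ, g (e l) = e l + b • e (i k) ∧ (e.repr v (i l) = 0 → b = 0))
    {M : Submodule ℂ V} (hM : IsCoordinate e M) (hv : e k ∈ M → v ∈ M)
    (hv' : e (i k) ∉ M → ∀ x ∈ M, ω x v = 0) {x : V} (hx : x ∈ M) : g x ∈ M := by
  refine hM.map_le (f := (g : V →ₗ[ℂ] V)) (fun l hl => ?_) hx
  change g (e l) ∈ M
  by_cases hlk : l = k
  · subst hlk; rw [h1]; exact hv hl
  · obtain ⟨b, hb, hb0⟩ := h2 l hlk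
    rw [hb]
    by_cases hik : e (i k) ∈ M
    · exact M.add_mem hl (M.smul_mem _ hik)
    · have h3 := hv' hik _ hl
      rw [h.apply_left_eq_zero_iff] at h3
      rw [hb0 h3]
      simpa using hl

namespace SplittingBasis

variable {D : ClassicalDatum V} {P : Subgroup D.group} {e : Module.Basis ℕ ℂ V} {I : ℕ → Finset ℕ}

lemma isCoordinate (h : SplittingBasis D P e I) {M : Submodule ℂ V} (hM : M ∈ invariants P) :
    IsCoordinate e M := by
  intro x hx j hj
  obtain ⟨g, hg, h1, -⟩ := exists_diag D h.adm j
  exact h1 M (hM g (h.diag hg)) x hx hj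

/-- The members of the flag are finite dimensional, so stability under inclusion already gives
equality. They are coordinate subspaces because the diagonal elements of `exists_diag` belong both
to P and to the finite level. -/
lemma exists_flag (h : SplittingBasis D P e I) (n : ℕ) :
    ∃ 𝓕 : Set (Submodule ℂ V), (∀ F ∈ 𝓕, F ≤ partSpan e (I n)) ∧ IsChain (· ≤ ·) 𝓕 ∧
    (∀ ω ∈ D.form, ∀ F ∈ 𝓕, partSpan e (I n) ⊓ ω.orthogonal F ∈ 𝓕) ∧
    (∀ g : D.group, MemFiniteLevel D e (I n) g →
      (g ∈ P ↔ ∀ F ∈ 𝓕, ∀ x ∈ F, g.1 x ∈ F)) ∧ ∀ F ∈ 𝓕, IsCoordinate e F := by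
  obtain ⟨𝓕, h1, h2, h3, h4⟩ := h.par n
  have h5 : ∀ g : D.group, MemFiniteLevel D e (I n) g →
      (g ∈ P ↔ ∀ F ∈ 𝓕, ∀ x ∈ F, g.1 x ∈ F) := by
    intro g hg
    rw [h4 g hg]
    constructor
    · intro h5 F hF x hx
      rw [← h5 F hF]
      exact ⟨x, hx, rfl⟩
    · intro h5 F hF
      have : FiniteDimensional ℂ F := Submodule.finiteDimensional_of_le (h1 F hF)
      exact map_eq_of_forall_mem (h5 F hF)
  refine ⟨𝓕, h1, h2, h3, h5, fun F hF x hx j hj => ?_⟩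
  obtain ⟨g, hg, h6, h7⟩ := exists_diag D h.adm j
  have hjI : j ∈ I n := mem_partSpan_iff.1 (h1 F hF hx) j hj
  have h8 := h7 (I n) hjI fun ω hω => h.filt.2.2 ω hω n
  have h9 : MemFiniteLevel D e (I n) g := by
    refine memFiniteLevel_of (fun l hl => ?_) h8
    obtain ⟨c, hc⟩ := hg l
    rw [hc]
    exact Submodule.smul_mem _ _ (basis_mem_partSpan hl)
  exact h6 F ((h5 g h9).1 (h.diag hg) F hF) x hx hj

lemma exists_subset (h : SplittingBasis D P e I) (A : Finset ℕ) : ∃ n, A ⊆ I n := by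
  choose f hf using h.filt.2.1
  refine ⟨A.sup f, fun j hj => ?_⟩
  exact h.filt.1 (Finset.le_sup hj) (hf j)

/-- A splitting parabolic subgroup is the stabilizer of its invariant subspaces. -/
lemma mem_of_invariants (h : SplittingBasis D P e I) {g : D.group}
    (hg : ∀ M ∈ invariants P, ∀ x ∈ M, g.1 x ∈ M) : g ∈ P := by
  obtain ⟨A, hA⟩ := exists_memFiniteLevel h.adm g
  obtain ⟨n, hn⟩ := h.exists_subset A
  have hgn := hA _ hn
  -- For each pair of indices realized by a nonzero matrix entry of some p in P, fix one such p
  -- together with a finite set bounding its level. Finitely many pairs matter, so a single level N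
  -- accommodates all of these p.
  have hwit : ∀ jk : ℕ × ℕ, ∃ B : Finset ℕ, (∃ p ∈ P, e.repr (p.1 (e jk.2)) jk.1 ≠ 0) →
      ∃ p ∈ P, (∀ J, B ⊆ J → MemFiniteLevel D e J p) ∧ e.repr (p.1 (e jk.2)) jk.1 ≠ 0 := by
    intro jk
    by_cases hp : ∃ p ∈ P, e.repr (p.1 (e jk.2)) jk.1 ≠ 0
    · obtain ⟨p, hp, hp'⟩ := hp
      obtain ⟨B, hB⟩ := exists_memFiniteLevel h.adm p
      exact ⟨B, fun _ => ⟨p, hp, hB, hp'⟩⟩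
    · exact ⟨∅, fun h => absurd h hp⟩
  choose B hB using hwit
  obtain ⟨N, hN⟩ := h.exists_subset (I n ∪ (I n ×ˢ I n).biUnion B)
  have hnN : I n ⊆ I N := Finset.subset_union_left.trans hN
  obtain ⟨𝓕, h1, h2, h3, h4, h5⟩ := h.exists_flag N
  rw [h4 g (hA _ (hn.trans hnN))]
  intro F hF x hx
  refine (h5 F hF).map_le (f := (g.1 : V →ₗ[ℂ] V)) (fun j hj => ?_) hx
  change g.1 (e j) ∈ F
  by_cases hjn : j ∈ I n
  · refine mem_of_repr (e := e) fun l hl => ?_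
    have hln : l ∈ I n := by
      have : g.1 (e j) ∈ partSpan e (I n) := by
        have h6 := hgn.1
        rw [← h6]
        exact ⟨e j, basis_mem_partSpan hjn, rfl⟩
      exact mem_partSpan_iff.1 this l hl
    -- The invariant subspace generated by e j contains g (e j). Every coordinate of g (e j) is thus
    -- already reached by an element of P, which at level N preserves the flag member F.
    let M : Submodule ℂ V := Submodule.span ℂ {y | ∃ p ∈ P, y = p.1 (e j)}
    have hM : M ∈ invariants P := by
      intro q hq
      have : M ≤ M.comap (q.1 : V →ₗ[ℂ] V) := by
        rw [Submodule.span_le]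
        rintro _ ⟨p, hp, rfl⟩
        exact Submodule.subset_span ⟨q * p, mul_mem hq hp, rfl⟩
      exact fun w hw => this hw
    have hjM : e j ∈ M := Submodule.subset_span ⟨1, one_mem _, rfl⟩
    have hp : ∃ p ∈ P, e.repr (p.1 (e j)) l ≠ 0 := by
      by_contra! hcon
      have : M ≤ LinearMap.ker (e.coord l) := by
        rw [Submodule.span_le]
        rintro _ ⟨p, hp, rfl⟩
        exact hcon p hp
      exact hl (this (hg M hM _ hjM))
    obtain ⟨p, hp, hpB, hpl⟩ := hB (l, j) hp
    have hBN : B (l, j) ⊆ I N := by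
      refine (Finset.subset_biUnion_of_mem B (Finset.mk_mem_product hln hjn)).trans ?_
      exact Finset.subset_union_right.trans hN
    exact h5 F hF _ ((h4 p (hpB _ hBN)).1 hp F hF _ hj) l hpl
  · rw [hgn.2 j hjn]
    exact hj

/-- If 0 and V were the only invariants, their stabilizer P would be the whole group. -/
lemma exists_invariant_ne (h : SplittingBasis D P e I) (hP : P ≠ ⊤) :
    ∃ M ∈ invariants P, (∃ j, e j ∈ M) ∧ ∃ j, e j ∉ M := by
  by_contra! hcon
  apply hP
  rw [eq_top_iff]
  intro g _
  refine h.mem_of_invariants fun M hM x hx => ?_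
  by_cases hj : ∃ j, e j ∈ M
  · exact mem_of_repr (e := e) fun l _ => hcon M hM hj l
  · push Not at hj
    have : x = 0 := by
      refine e.repr.map_eq_zero_iff.1 (Finsupp.ext fun j => ?_)
      by_contra h0
      exact hj j (h.isCoordinate hM x hx j h0)
    simp [this]

section Form

variable {ω : LinearMap.BilinForm ℂ V} {ε : ℂ} {i : ℕ → ℕ}

/-- Taking orthogonals permutes the invariants, and a coordinate subspace contains e j exactly when
its orthogonal omits e (i j). -/
lemma below_dual (h : SplittingBasis D P e I) (hD : D.form = some ω)
    (hi : IsotropicBasis ω ε e i) {j k : ℕ} (hjk : Below P e j k) : Below P e (i k) (i j) := by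
  intro M hM hj
  by_contra hk
  have hMc := h.isCoordinate hM
  have h1 := hjk _ (orthogonal_mem_invariants hD hM) ((hMc.mem_orthogonal hi k).2 hk)
  exact (hMc.mem_orthogonal hi j).1 h1 hj

/-- If the members of the flag at a finite level containing `e k` contain the isotropic vector `v`
with `k`-th coordinate `1`, then `P` contains an element mapping `e k` to `v`. -/
lemma exists_map_eq_of_flag (h : SplittingBasis D P e I) (hD : D.form = some ω)
    (hi : IsotropicBasis ω ε e i) {n k : ℕ} (hkI : k ∈ I n) (hk : i k ≠ k) {v : V}
    (hv : ω v v = 0) (hvk : e.repr v k = 1) (hvI : v ∈ partSpan e (I n))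
    {𝓕 : Set (Submodule ℂ V)}
    (h3 : ∀ ω ∈ D.form, ∀ F ∈ 𝓕, partSpan e (I n) ⊓ ω.orthogonal F ∈ 𝓕)
    (h4 : ∀ g : D.group, MemFiniteLevel D e (I n) g →
      (g ∈ P ↔ ∀ F ∈ 𝓕, ∀ x ∈ F, g.1 x ∈ F)) (h5 : ∀ F ∈ 𝓕, IsCoordinate e F)
    (hF : ∀ F ∈ 𝓕, e k ∈ F → v ∈ F) : ∃ p ∈ P, p.1 (e k) = v := by
  have hI : ∀ j ∈ I n, i j ∈ I n := fun j hj =>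
    h.filt.2.2 ω (by simp [hD]) n j hj _ (hi.gram_ne j)
  obtain ⟨p, hp1, hp2⟩ := exists_siegel hD hi hk hv hvk
  refine ⟨p, (h4 p (memFiniteLevel_of (fun j hj => ?_) fun j hj => ?_)).2 fun F hFm x hx => ?_, hp1⟩
  · by_cases hjk : j = k
    · rw [hjk, hp1]; exact hvI
    · obtain ⟨b, hb, -⟩ := hp2 j hjk
      rw [hb]
      exact Submodule.add_mem _ (basis_mem_partSpan hj)
        (Submodule.smul_mem _ _ (basis_mem_partSpan (hI k hkI)))
  · obtain ⟨b, hb, hb0⟩ := hp2 j fun h0 => hj (h0 ▸ hkI)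
    rw [hb, hb0 ?_, zero_smul, add_zero]
    by_contra h0
    have := hI _ (mem_partSpan_iff.1 hvI _ h0)
    rw [hi.invol] at this
    exact hj this
  · refine siegel_stabilizes hi hp1 hp2 (h5 F hFm) (hF F hFm) (fun hik x hx => ?_) hx
    -- If F omits e (i k), its orthogonal within the level is a flag member containing e k, hence
    -- containing v. This is the dual stability condition of `siegel_stabilizes`.
    have h6 : e k ∈ partSpan e (I n) ⊓ ω.orthogonal F :=
      ⟨basis_mem_partSpan hkI, ((h5 F hFm).mem_orthogonal hi k).2 hik⟩
    exact (hF _ (h3 ω (by simp [hD]) F hFm) h6).2 x hx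

/-- Some p in P sends e k to the isotropic vector e k + e j + d • e (i k), whose j-th coordinate is
nonzero, so invariant subspaces containing e k contain e j. The correction d is needed only when e j
is anisotropic. The case j = i k requires an alternating form, since e k + e (i k) is not isotropic
for a symmetric one. -/
lemma below_of_flag (h : SplittingBasis D P e I) (hD : D.form = some ω)
    (hi : IsotropicBasis ω ε e i) {n j k : ℕ} (hjI : j ∈ I n) (hkI : k ∈ I n) (hk : i k ≠ k)
    (hjk : j ≠ k) (hjik : j ≠ i k ∨ ε = -1)
    {𝓕 : Set (Submodule ℂ V)}
    (h3 : ∀ ω ∈ D.form, ∀ F ∈ 𝓕, partSpan e (I n) ⊓ ω.orthogonal F ∈ 𝓕)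
    (h4 : ∀ g : D.group, MemFiniteLevel D e (I n) g →
      (g ∈ P ↔ ∀ F ∈ 𝓕, ∀ x ∈ F, g.1 x ∈ F)) (h5 : ∀ F ∈ 𝓕, IsCoordinate e F)
    (hF : ∀ F ∈ 𝓕, e k ∈ F → e j ∈ F) : Below P e j k := by
  have hI : ∀ j ∈ I n, i j ∈ I n := fun j hj =>
    h.filt.2.2 ω (by simp [hD]) n j hj _ (hi.gram_ne j)
  suffices H : ∃ d : ℂ, ω (e k + e j + d • e (i k)) (e k + e j + d • e (i k)) = 0 ∧
      (∀ F ∈ 𝓕, e k ∈ F → d • e (i k) ∈ F) ∧ (j = i k → d = 0) by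
    obtain ⟨d, hd1, hd2, hd3⟩ := H
    have hvk : e.repr (e k + e j + d • e (i k)) k = 1 := by simp [hjk, hk]
    obtain ⟨p, hp, hpe⟩ := h.exists_map_eq_of_flag hD hi hkI hk hd1 hvk
      (Submodule.add_mem _ (Submodule.add_mem _ (basis_mem_partSpan hkI) (basis_mem_partSpan hjI))
        (Submodule.smul_mem _ _ (basis_mem_partSpan (hI k hkI)))) h3 h4 h5
      (fun F hFm hkF => F.add_mem (F.add_mem hkF (hF F hFm hkF)) (hd2 F hFm hkF))
    intro M hM hkM
    have h6 := hM p hp _ hkM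
    rw [hpe] at h6
    refine h.isCoordinate hM _ h6 j ?_
    by_cases hj : j = i k
    · simp [hd3 hj, Ne.symm hjk]
    · simp [Ne.symm hjk, Ne.symm hj]
  have hkk : ω (e k) (e k) = 0 := hi.gram_eq_zero (Ne.symm hk)
  by_cases hj : i j = j
  · have hjj := hi.gram_ne j
    rw [hj] at hjj
    have hε : ε = 1 := by
      rcases hi.sign with h1 | h1
      · exact h1
      · exact absurd (hi.apply_self_of_neg h1 _) hjj
    have hj' : j ≠ i k := by
      rintro rfl
      rw [hi.invol] at hj
      exact hk hj.symm
    have hκ := hi.gram_ne k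
    have e1 : ω (e k) (e j) = 0 := hi.gram_eq_zero hj'
    have e2 : ω (e j) (e k) = 0 := by rw [hi.symm, e1, mul_zero]
    have e3 : ω (e j) (e (i k)) = 0 := hi.gram_eq_zero (by rw [hj]; exact Ne.symm hj')
    have e4 : ω (e (i k)) (e j) = 0 := by rw [hi.symm, e3, mul_zero]
    have e5 : ω (e (i k)) (e k) = ω (e k) (e (i k)) := by rw [hi.symm, hε, one_mul]
    have e6 : ω (e (i k)) (e (i k)) = 0 := hi.gram_eq_zero (by rwa [hi.invol])
    -- The value of d solves 2 d ω(e k, e (i k)) + ω(e j, e j) = 0. A flag member F containing e k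
    -- must contain e (i k): otherwise e k, hence e j, would be orthogonal to F, whereas F contains
    -- the anisotropic vector e j.
    refine ⟨-ω (e j) (e j) / (2 * ω (e k) (e (i k))), ?_, fun F hFm hkF => ?_,
      fun h => absurd h hj'⟩
    · simp only [map_add, map_smul, LinearMap.add_apply, LinearMap.smul_apply, smul_eq_mul,
        hkk, e1, e2, e3, e4, e5, e6]
      field_simp
      ring
    · refine F.smul_mem _ ?_
      by_contra h0
      have h6 : e k ∈ partSpan e (I n) ⊓ ω.orthogonal F :=
        ⟨basis_mem_partSpan hkI, ((h5 F hFm).mem_orthogonal hi k).2 h0⟩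
      exact hjj ((hF _ (h3 ω (by simp [hD]) F hFm) h6).2 _ (hF F hFm hkF))
  · refine ⟨0, ?_, fun F _ _ => by simp, fun _ => rfl⟩
    rcases hjik with h1 | h1
    · have e1 : ω (e k) (e j) = 0 := hi.gram_eq_zero h1
      have e2 : ω (e j) (e k) = 0 := by rw [hi.symm, e1, mul_zero]
      have e3 : ω (e j) (e j) = 0 := hi.gram_eq_zero (Ne.symm hj)
      simp [hkk, e1, e2, e3]
    · exact hi.apply_self_of_neg h1 _

/-- Two basis vectors are comparable, except possibly for the two members of a hyperbolic pair in
the orthogonal case. -/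
lemma below_total (h : SplittingBasis D P e I) (hD : D.form = some ω)
    (hi : IsotropicBasis ω ε e i) {j k : ℕ} (hjk : j ≠ k) (hjik : j ≠ i k ∨ ε = -1) :
    Below P e j k ∨ Below P e k j := by
  obtain ⟨n, hn⟩ := h.exists_subset {j, k}
  have hjI : j ∈ I n := hn (by simp)
  have hkI : k ∈ I n := hn (by simp)
  obtain ⟨𝓕, h1, h2, h3, h4, h5⟩ := h.exists_flag n
  have hI : ∀ j ∈ I n, i j ∈ I n := fun j hj =>
    h.filt.2.2 ω (by simp [hD]) n j hj _ (hi.gram_ne j)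
  have key : ∀ j k : ℕ, j ∈ I n → k ∈ I n → j ≠ k → (j ≠ i k ∨ ε = -1) →
      (∀ F ∈ 𝓕, e k ∈ F → e j ∈ F) → Below P e j k := by
    intro j k hjI hkI hjk hjik hF
    -- An anisotropic e k cannot be moved by a Siegel transformation; the dual relation, with e (i
    -- j) as the moved vector, is proved instead and dualized.
    by_cases hk : i k = k
    · have hj : i j ≠ j := fun hj => hjk (hi.fixed j k hj hk)
      have h6 : Below P e k (i j) := by
        refine h.below_of_flag hD hi hkI (hI j hjI) ?_ ?_ (Or.inl ?_) h3 h4 h5 ?_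
        · rw [hi.invol]; exact Ne.symm hj
        · rintro h0; exact hjk (by rw [← hi.invol j, ← h0, hk])
        · rw [hi.invol]; exact Ne.symm hjk
        · intro F hFm hijF
          by_contra hkF
          have h7 : e k ∈ partSpan e (I n) ⊓ ω.orthogonal F :=
            ⟨basis_mem_partSpan hkI, ((h5 F hFm).mem_orthogonal hi k).2 (by rwa [hk])⟩
          have h8 := (hF _ (h3 ω (by simp [hD]) F hFm) h7).2
          exact ((h5 F hFm).mem_orthogonal hi j).1 h8 hijF
      have h7 := h.below_dual hD hi h6
      rwa [hi.invol, hk] at h7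
    · exact h.below_of_flag hD hi hjI hkI hk hjk hjik h3 h4 h5 hF
  -- The flag is a chain, so one of the two implications between membership of e j and of e k holds
  -- for all its members.
  by_cases hF : ∀ F ∈ 𝓕, e k ∈ F → e j ∈ F
  · exact Or.inl (key j k hjI hkI hjk hjik hF)
  · right
    refine key k j hkI hjI hjk.symm (hjik.imp_left fun h0 => hi.invol_ne h0) ?_
    push Not at hF
    obtain ⟨F, hFm, hkF, hjF⟩ := hF
    intro F' hFm' hjF'
    by_contra hkF'
    rcases h2.total hFm hFm' with h6 | h6
    · exact hkF' (h6 hkF)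
    · exact hjF (h6 hjF')

/-- No invariant subspace contains one hyperbolic pair and avoids another one. -/
lemma not_both_and_none (h : SplittingBasis D P e I) (hD : D.form = some ω)
    (hi : IsotropicBasis ω ε e i) {M : Submodule ℂ V} (hM : M ∈ invariants P) {l m : ℕ}
    (h1 : e l ∈ M) (h2 : e (i l) ∈ M) (h3 : e m ∉ M) (h4 : e (i m) ∉ M) : False := by
  -- Comparability of l and m brings e m into M, or, after dualizing, e (i m).
  rcases h.below_total hD hi (j := l) (k := m) (by rintro rfl; exact h3 h1)
    (Or.inl (by rintro rfl; exact h4 h1)) with h5 | h5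
  · exact h4 (h.below_dual hD hi h5 M hM h2)
  · exact h3 (h5 M hM h1)

/-- The index l is comparable with both j and i j. By transitivity it cannot lie between them, so it
lies strictly on the same side of both. -/
lemma below_of_incomparable (h : SplittingBasis D P e I) (hD : D.form = some ω)
    (hi : IsotropicBasis ω ε e i) {j l : ℕ} (h1 : ¬ Below P e j (i j)) (h2 : ¬ Below P e (i j) j)
    (hlj : l ≠ j) (hlij : l ≠ i j) :
    (Below P e l j ∧ Below P e l (i j) ∧ ¬ Below P e j l ∧ ¬ Below P e (i j) l) ∨
      (Below P e j l ∧ Below P e (i j) l ∧ ¬ Below P e l j ∧ ¬ Below P e l (i j)) := by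
  have trans : ∀ a b c, Below P e a b → Below P e b c → Below P e a c :=
    fun a b c hab hbc M hM hc => hab M hM (hbc M hM hc)
  have t1 := h.below_total hD hi hlj (Or.inl hlij)
  have t2 := h.below_total hD hi hlij (Or.inl (by rwa [hi.invol]))
  have a1 : ¬ (Below P e j l ∧ Below P e l (i j)) := fun h0 => h1 (trans _ _ _ h0.1 h0.2)
  have a2 : ¬ (Below P e (i j) l ∧ Below P e l j) := fun h0 => h2 (trans _ _ _ h0.1 h0.2)
  tauto

/-- If a hyperbolic pair is incomparable, then an invariant subspace containing just one of its
members contains exactly one member of every hyperbolic pair. -/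
lemma mem_iff_of_incomparable (h : SplittingBasis D P e I) (hD : D.form = some ω)
    (hi : IsotropicBasis ω ε e i) {M : Submodule ℂ V} (hM : M ∈ invariants P) {j : ℕ}
    (h1 : ¬ Below P e j (i j)) (h2 : ¬ Below P e (i j) j) (hj : e j ∈ M) (hij : e (i j) ∉ M)
    (l : ℕ) : e (i l) ∈ M ↔ e l ∉ M := by
  by_cases hlj : l = j
  · subst hlj; simp [hj, hij]
  by_cases hlij : l = i j
  · subst hlij; simp [hi.invol, hj, hij]
  rcases h.below_of_incomparable hD hi h1 h2 hlj hlij with ⟨a1, a2, a3, a4⟩ | ⟨a1, a2, a3, a4⟩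
  · have hl : e l ∈ M := a1 M hM hj
    have : e (i l) ∉ M := fun h0 => hij (h.below_dual hD hi a1 M hM h0)
    tauto
  · have hl : e l ∉ M := fun h0 => hij (a2 M hM h0)
    have h5 := h.below_dual hD hi a2
    rw [hi.invol] at h5
    have : e (i l) ∈ M := h5 M hM hj
    tauto

end Form

/-- Without a form, the transvection e k ↦ e k + e j lies in P as soon as every flag member
containing e k contains e j, and the flag is a chain. -/
lemma below_total_of_none (h : SplittingBasis D P e I) (hD : D.form = none) (j k : ℕ) :
    Below P e j k ∨ Below P e k j := by
  by_cases hjk : j = k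
  · exact Or.inl fun M _ h => hjk ▸ h
  obtain ⟨n, hn⟩ := h.exists_subset {j, k}
  have hjI : j ∈ I n := hn (by simp)
  have hkI : k ∈ I n := hn (by simp)
  obtain ⟨𝓕, h1, h2, h3, h4, h5⟩ := h.exists_flag n
  have key : ∀ j k : ℕ, j ∈ I n → k ∈ I n → j ≠ k →
      (∀ F ∈ 𝓕, e k ∈ F → e j ∈ F) → Below P e j k := by
    intro j k hjI hkI hjk hF
    obtain ⟨g, hg⟩ := exists_dilatransvection hD (coord_mem_dualSpace h.adm k) (w := e j)
      (by simp [hjk])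
    have hgk : g.1 (e k) = e k + e j := by simp [hg]
    have hgl : ∀ l ≠ k, g.1 (e l) = e l := fun l hl => by simp [hg, hl]
    have hgP : g ∈ P := by
      refine (h4 g (memFiniteLevel_of (fun l hl => ?_) fun l hl => hgl l ?_)).2 fun F hFm x hx => ?_
      · by_cases hlk : l = k
        · rw [hlk, hgk]
          exact Submodule.add_mem _ (basis_mem_partSpan hkI) (basis_mem_partSpan hjI)
        · rw [hgl l hlk]; exact basis_mem_partSpan hl
      · rintro rfl; exact hl hkI
      · refine (h5 F hFm).map_le (f := (g.1 : V →ₗ[ℂ] V)) (fun l hl => ?_) hx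
        change g.1 (e l) ∈ F
        by_cases hlk : l = k
        · subst hlk
          rw [hgk]
          exact F.add_mem hl (hF F hFm hl)
        · rwa [hgl l hlk]
    intro M hM hkM
    have h6 := hM g hgP _ hkM
    rw [hgk] at h6
    exact (M.add_mem_iff_right hkM).1 h6
  by_cases hF : ∀ F ∈ 𝓕, e k ∈ F → e j ∈ F
  · exact Or.inl (key j k hjI hkI hjk hF)
  · right
    refine key k j hkI hjI (Ne.symm hjk) ?_
    push Not at hF
    obtain ⟨F, hFm, hkF, hjF⟩ := hF
    intro F' hFm' hjF'
    by_contra hkF'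
    rcases h2.total hFm hFm' with h6 | h6
    · exact hkF' (h6 hkF)
    · exact hjF (h6 hjF')

end SplittingBasis

end ClassicalDatum

/-! ### Chains of invariant subspaces and largeness -/

namespace ClassicalDatum

variable {V : Type u} [AddCommGroup V] [Module ℂ V]

lemma finite_setOf_basis_mem (e : Module.Basis ℕ ℂ V) (M : Submodule ℂ V)
    [FiniteDimensional ℂ M] : {j | e j ∈ M}.Finite := by
  have h1 : LinearIndependent ℂ (fun j : {j | e j ∈ M} => (⟨e j, j.2⟩ : M)) := by
    apply LinearIndependent.of_comp M.subtype
    exact e.linearIndependent.comp _ Subtype.val_injective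
  have := h1.finite_of_isNoetherian
  exact Set.toFinite _

namespace IsCoordinate

variable {e : Module.Basis ℕ ℂ V} {M : Submodule ℂ V}

lemma finiteDimensional (hM : IsCoordinate e M) (h : {j | e j ∈ M}.Finite) :
    FiniteDimensional ℂ M := by
  have : M ≤ Submodule.span ℂ (e '' {j | e j ∈ M}) :=
    hM.le_of_forall fun j hj => Submodule.subset_span ⟨j, hj, rfl⟩
  have h2 := FiniteDimensional.span_of_finite ℂ (h.image e)
  exact Submodule.finiteDimensional_of_le this

lemma isCompl (hM : IsCoordinate e M) : IsCompl M (Submodule.span ℂ (e '' {j | e j ∉ M})) := by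
  constructor
  · rw [Submodule.disjoint_def]
    intro x hx hx'
    refine e.repr.map_eq_zero_iff.1 (Finsupp.ext fun j => ?_)
    by_contra h0
    exact e.mem_span_image.1 hx' (Finsupp.mem_support_iff.2 h0) (hM x hx j h0)
  · rw [codisjoint_iff, eq_top_iff, ← e.span_eq, Submodule.span_le]
    rintro _ ⟨j, rfl⟩
    by_cases hj : e j ∈ M
    · exact Submodule.mem_sup_left hj
    · exact Submodule.mem_sup_right (Submodule.subset_span ⟨j, hj, rfl⟩)

lemma cofg (hM : IsCoordinate e M) (h : {j | e j ∉ M}.Finite) : M.CoFG :=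
  Submodule.FG.cofg_of_isCompl hM.isCompl.symm (Submodule.fg_span (h.image e))

lemma finite_setOf_notMem (hM : IsCoordinate e M) (h : M.CoFG) : {j | e j ∉ M}.Finite := by
  have h1 := Submodule.CoFG.fg_of_isCompl hM.isCompl h
  have : FiniteDimensional ℂ (Submodule.span ℂ (e '' {j | e j ∉ M})) := Module.Finite.iff_fg.2 h1
  exact (finite_setOf_basis_mem e (Submodule.span ℂ (e '' {j | e j ∉ M}))).subset fun j hj =>
    Submodule.subset_span ⟨j, hj, rfl⟩

end IsCoordinate

lemma bot_mem_invariants {D : ClassicalDatum V} (P : Subgroup D.group) : ⊥ ∈ invariants P := by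
  intro g _ x hx
  rw [Submodule.mem_bot] at hx ⊢
  simp [hx]

lemma top_mem_invariants {D : ClassicalDatum V} (P : Subgroup D.group) : ⊤ ∈ invariants P :=
  fun _ _ _ _ => trivial

namespace SplittingBasis

variable {D : ClassicalDatum V} {P : Subgroup D.group} {e : Module.Basis ℕ ℂ V} {I : ℕ → Finset ℕ}

/-- Two incomparable invariants yield an incomparable pair j, i j. By `mem_iff_of_incomparable` one
of these invariants then contains exactly one member of each pair, which makes both its dimension
and its codimension infinite. -/
lemma isChain_invariants (h : SplittingBasis D P e I)
    (hfin : ∀ M ∈ invariants P, {j | e j ∈ M}.Finite ∨ {j | e j ∉ M}.Finite) :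
    IsChain (· ≤ ·) (invariants P) := by
  intro M hM N hN _
  by_contra! hcon
  obtain ⟨hMN, hNM⟩ := hcon
  have h1 : ∃ j, e j ∈ M ∧ e j ∉ N := by
    by_contra! h0
    exact hMN ((h.isCoordinate hM).le_of_forall h0)
  have h2 : ∃ j, e j ∈ N ∧ e j ∉ M := by
    by_contra! h0
    exact hNM ((h.isCoordinate hN).le_of_forall h0)
  obtain ⟨j, hjM, hjN⟩ := h1
  obtain ⟨k, hkN, hkM⟩ := h2
  have h3 : ¬ Below P e j k := fun h0 => hjN (h0 N hN hkN)
  have h4 : ¬ Below P e k j := fun h0 => hkM (h0 M hM hjM)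
  rcases hD : D.form with _ | ω
  · rcases h.below_total_of_none hD j k with h5 | h5
    · exact h3 h5
    · exact h4 h5
  · obtain ⟨ε, hε⟩ := exists_isotropicBasis hD
    obtain ⟨i, hi⟩ := hε e h.adm
    have hjk : k = i j := by
      by_contra h0
      rcases h.below_total hD hi (j := k) (k := j) (by rintro rfl; exact hkM hjM) (Or.inl h0)
        with h5 | h5
      · exact h4 h5
      · exact h3 h5
    subst hjk
    have key := h.mem_iff_of_incomparable hD hi hM h3 h4 hjM hkM
    have hset : {l | e l ∉ M} = i ⁻¹' {l | e l ∈ M} := by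
      ext l; exact (key l).symm
    have hset' : {l | e l ∈ M} = i ⁻¹' {l | e l ∉ M} := by
      ext l
      have := key l
      simp only [Set.mem_preimage, Set.mem_ofPred_eq]
      tauto
    have hinj : Function.Injective i := fun a b hab => by rw [← hi.invol a, hab, hi.invol]
    have h5 : {l | e l ∈ M}.Finite ∧ {l | e l ∉ M}.Finite := by
      rcases hfin M hM with h0 | h0
      · exact ⟨h0, hset ▸ h0.preimage hinj.injOn⟩
      · exact ⟨hset' ▸ h0.preimage hinj.injOn, h0⟩
    have h6 : (Set.univ : Set ℕ).Finite :=
      (h5.1.union h5.2).subset fun l _ => by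
        by_cases hl : e l ∈ M
        · exact Or.inl hl
        · exact Or.inr hl
    exact Set.infinite_univ h6

/-- A semilarge splitting parabolic subgroup is large if its invariant subspaces are all finite
dimensional or finite codimensional. -/
lemma isLarge (h : SplittingBasis D P e I) (hP : D.IsSemilarge P)
    (hfin : ∀ M ∈ invariants P, {j | e j ∈ M}.Finite ∨ {j | e j ∉ M}.Finite) : D.IsLarge P := by
  refine ⟨hP, ?_⟩
  have hchain := h.isChain_invariants hfin
  classical
  let : LinearOrder (invariants P) :=
    { (inferInstance : PartialOrder (invariants P)) with
      le_total := fun a b => hchain.total a.2 b.2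
      toDecidableLE := Classical.decRel _ }
  have hP' : (invariants P).Finite := hP
  let := hP'.fintype
  have hne : Nonempty (invariants P) := ⟨⟨⊥, bot_mem_invariants P⟩⟩
  obtain ⟨m, hm⟩ : ∃ m, Fintype.card (invariants P) = m + 1 :=
    Nat.exists_eq_succ_of_ne_zero Fintype.card_ne_zero
  let f : Fin (m + 1) ≃o invariants P := monoEquivOfFin _ hm
  have hsurj : ∀ M ∈ invariants P, ∃ k, (f k : Submodule ℂ V) = M := fun M hM =>
    ⟨f.symm ⟨M, hM⟩, by simp⟩
  have hmono : StrictMono fun k => (f k : Submodule ℂ V) := fun a b hab => f.strictMono hab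
  refine ⟨m, fun k => f k, hmono, ?_, ?_, ?_, ?_, ?_⟩
  · obtain ⟨k, hk⟩ := hsurj ⊥ (bot_mem_invariants P)
    have := hmono.monotone (Fin.zero_le k)
    simp only [hk] at this
    exact le_bot_iff.1 this
  · obtain ⟨k, hk⟩ := hsurj ⊤ (top_mem_invariants P)
    have := hmono.monotone (Fin.le_last k)
    simp only [hk] at this
    exact top_le_iff.1 this
  · intro ω hω
    have hD : D.form = some ω := hω
    obtain ⟨ε, hε⟩ := exists_isotropicBasis hD
    obtain ⟨i, hi⟩ := hε e h.adm
    choose t ht using fun k => hsurj _ (orthogonal_mem_invariants hD (f k).2)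
    -- Taking orthogonals reverses the finite chain. Followed by the reversal of indices it is a
    -- strictly increasing self-map of a finite linear order, hence the identity.
    have hmono' : StrictMono fun k => (t k).rev := by
      intro a b hab
      rw [Fin.rev_lt_rev, ← hmono.lt_iff_lt]
      simp only [ht]
      refine lt_of_le_of_ne (ω.orthogonal_le (hmono hab).le) fun h0 => (hmono hab).ne ?_
      have := congrArg ω.orthogonal h0
      rw [(h.isCoordinate (f a).2).orthogonal_orthogonal hi,
        (h.isCoordinate (f b).2).orthogonal_orthogonal hi] at this
      exact this.symm
    have hid : (fun k => (t k).rev) = id := by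
      refine (StrictMono.range_inj hmono' strictMono_id).1 ?_
      rw [Set.range_id, Set.range_eq_univ]
      exact Finite.surjective_of_injective hmono'.injective
    intro k
    have h1 : (t k).rev = k := congrFun hid k
    rw [← ht k, ← h1, Fin.rev_rev, h1]
  · intro g
    constructor
    · intro hg k
      exact map_eq_of_mem_invariants (f k).2 hg
    · intro hg
      refine h.mem_of_invariants fun M hM x hx => ?_
      obtain ⟨k, rfl⟩ := hsurj M hM
      have h1 : Submodule.map (g.1 : V →ₗ[ℂ] V) (f k) = f k := hg k
      rw [← h1]
      exact ⟨x, hx, rfl⟩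
  · intro k
    exact (hfin _ (f k).2).imp (h.isCoordinate (f k).2).finiteDimensional
      (h.isCoordinate (f k).2).cofg

end SplittingBasis

end ClassicalDatum

/-! ### Separating orbits by relative positions -/

namespace ClassicalDatum

variable {V : Type u} [AddCommGroup V] [Module ℂ V]

/-- A finitary automorphism preserves relative dimensions over a common subspace. -/
lemma finrank_eq_of_map_sup_eq {g : V ≃ₗ[ℂ] V} {U : Submodule ℂ V} (hU : U.CoFG)
    (hg : ∀ v ∈ U, g v = v) {X A B : Submodule ℂ V} [FiniteDimensional ℂ A]
    [FiniteDimensional ℂ B] (hA : Disjoint X A) (hB : Disjoint X B)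
    (h : (X ⊔ A).map (g : V →ₗ[ℂ] V) = X ⊔ B) :
    Module.finrank ℂ A = Module.finrank ℂ B := by
  -- Since g is the identity on X ⊓ U, it acts on the quotient by it. There X has finite-dimensional
  -- image, and dimensions can be compared.
  have hX : (X ⊓ U).map (g : V →ₗ[ℂ] V) = X ⊓ U := by
    ext x
    constructor
    · rintro ⟨y, hy, rfl⟩
      change g y ∈ _
      rw [hg y hy.2]
      exact hy
    · intro hx
      exact ⟨x, hx, hg x hx.2⟩
  have hfd : FiniteDimensional ℂ (X.map (X ⊓ U).mkQ) := by
    have h1 : LinearMap.ker ((X ⊓ U).mkQ ∘ₗ X.subtype) = LinearMap.ker (U.mkQ ∘ₗ X.subtype) := by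
      ext x; simp
    have : FiniteDimensional ℂ (V ⧸ U) := hU
    have h2 : (LinearMap.ker ((X ⊓ U).mkQ ∘ₗ X.subtype)).CoFG := by
      rw [h1]; exact Submodule.CoFG.ker _
    have h3 := Submodule.range_fg_iff_ker_cofg.2 h2
    rw [LinearMap.range_comp, Submodule.range_subtype] at h3
    exact Module.Finite.iff_fg.2 h3
  have key : ∀ C : Submodule ℂ V, FiniteDimensional ℂ C → Disjoint X C →
      Module.finrank ℂ ((X ⊔ C).map (X ⊓ U).mkQ) =
        Module.finrank ℂ (X.map (X ⊓ U).mkQ) + Module.finrank ℂ C := by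
    intro C hC hXC
    rw [Submodule.disjoint_def] at hXC
    have hdisj : X.map (X ⊓ U).mkQ ⊓ C.map (X ⊓ U).mkQ = ⊥ := by
      rw [eq_bot_iff]
      rintro _ ⟨⟨x, hx, rfl⟩, ⟨c, hc, hcx⟩⟩
      have h1 : c - x ∈ X ⊓ U := (Submodule.Quotient.eq _).1 hcx
      have h2 : c ∈ X := by simpa using X.add_mem h1.1 hx
      have h3 : c = 0 := hXC c h2 hc
      rw [← hcx, h3]
      simp
    have hinj : Function.Injective ((X ⊓ U).mkQ ∘ₗ C.subtype) := by
      rw [← LinearMap.ker_eq_bot, eq_bot_iff]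
      intro c hc
      have h1 : (c : V) ∈ X ⊓ U := by simpa using hc
      exact Subtype.ext (hXC c h1.1 c.2)
    have h4 := Submodule.finrank_sup_add_finrank_inf_eq (X.map (X ⊓ U).mkQ) (C.map (X ⊓ U).mkQ)
    have h5 : Module.finrank ℂ (C.map (X ⊓ U).mkQ) = Module.finrank ℂ C := by
      rw [← LinearMap.finrank_range_of_inj hinj, LinearMap.range_comp, Submodule.range_subtype]
    rw [hdisj, finrank_bot, add_zero, h5] at h4
    rw [Submodule.map_sup, h4]
  let f := Submodule.Quotient.equiv (X ⊓ U) (X ⊓ U) g hX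
  have h6 : ((X ⊔ A).map (X ⊓ U).mkQ).map (f : _ →ₗ[ℂ] _) = (X ⊔ B).map (X ⊓ U).mkQ := by
    rw [← h, ← Submodule.map_comp, ← Submodule.map_comp]
    rfl
  have h7 := LinearEquiv.finrank_map_eq f ((X ⊔ A).map (X ⊓ U).mkQ)
  rw [h6, key A inferInstance hA, key B inferInstance hB] at h7
  omega

section Links

variable {κ : Type*} [Fintype κ] [DecidableEq κ]

/-- A finite family of vectors with a biorthogonal family of forms in `V_*`, spanning the
orthogonal of its kernel if there is a form. -/
structure DualFamily (D : ClassicalDatum V) (u : κ → V) (us : κ → Module.Dual ℂ V) : Prop where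
  mem : ∀ a, us a ∈ D.dualSpace
  biorth : ∀ a b, us a (u b) = if a = b then 1 else 0
  orth : ∀ ω ∈ D.form, ∀ x, (∀ a, us a x = 0) → ∀ b, ω (u b) x = 0 ∧ ω x (u b) = 0

/-- The family `u` can be moved to the family `w`, permuted by `π`, by an element of the group
whose action on the common kernel of `us` does not depend on `π`. -/
lemma DualFamily.exists_link {D : ClassicalDatum V} {u w : κ → V} {us ws : κ → Module.Dual ℂ V}
    (hu : DualFamily D u us) (hw : DualFamily D w ws) (huw : ∀ a b, us a (w b) = 0)
    (hwu : ∀ a b, ws a (u b) = 0) (π : Equiv.Perm κ) {c : κ → ℂ} (hc : ∀ a, c a ≠ 0)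
    (hω : ∀ ω ∈ D.form, ∀ a b, ω (w a) (w b) = ω (u a) (u b) ∧
      ω (c a • w (π a)) (c b • w (π b)) = ω (u a) (u b)) :
    ∃ g : D.group, (∀ a, g.1 (u a) = c a • w (π a)) ∧
      ∀ x, (∀ a, us a x = 0) → g.1 x = x + ∑ a, ws a x • (u a - w a) := by
  obtain ⟨g, hg1, hg2⟩ := exists_monomial D (κ := κ ⊕ κ) (u := Sum.elim u w)
    (us := Sum.elim us ws) (by rintro (a | a); exacts [hu.mem a, hw.mem a])
    (by
      rintro (a | a) (b | b)
      · simpa using hu.biorth a b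
      · simpa using huw a b
      · simpa using hwu a b
      · simpa using hw.biorth a b)
    -- This sends u a to c a • w (π a) and w a back to u a; only the first half involves π.
    ((Equiv.sumComm κ κ).trans (Equiv.sumCongr (Equiv.refl κ) π)) (c := Sum.elim c fun _ => 1)
    (by rintro (a | a); exacts [hc a, one_ne_zero])
    (by
      intro ω hD
      refine ⟨?_, fun x hx => ?_⟩
      · have h1 : ∀ a b, ω (u a) (w b) = 0 := fun a b => (hu.orth ω hD _ (fun a => huw a b) a).1
        have h2 : ∀ a b, ω (w b) (u a) = 0 := fun a b => (hu.orth ω hD _ (fun a => huw a b) a).2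
        rintro (a | a) (b | b)
        · simpa using (hω ω hD a b).2
        · simp [h1, h2]
        · simp [h1, h2]
        · simpa using (hω ω hD a b).1.symm
      · rintro (b | b)
        · exact hu.orth ω hD x (fun a => hx (Sum.inl a)) b
        · exact hw.orth ω hD x (fun a => hx (Sum.inr a)) b)
  refine ⟨g, fun a => by simpa using hg1 (Sum.inl a), fun x hx => ?_⟩
  -- Once its w-part is removed, x is killed by both dual families, hence fixed.
  have h1 := hg2 (x - ∑ a, ws a x • w a) (by
    rintro (a | a)
    · simp [hx, huw]
    · simp [hw.biorth])
  have h2 : ∀ a, g.1 (w a) = u a := fun a => by simpa using hg1 (Sum.inr a)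
  simp only [map_sub, map_sum, map_smul, h2] at h1
  rw [sub_eq_iff_eq_add] at h1
  rw [h1]
  simp only [smul_sub, Finset.sum_sub_distrib]
  abel

/-- The intersection `g M ⊓ F` for a linking element `g`. -/
lemma DualFamily.map_inf_eq {D : ClassicalDatum V} {u w : κ → V} {us ws : κ → Module.Dual ℂ V}
    (hu : DualFamily D u us) (hw : DualFamily D w ws)
    (hwu : ∀ a b, ws a (u b) = 0) {π : Equiv.Perm κ} {c : κ → ℂ} (hc : ∀ a, c a ≠ 0)
    {g : V ≃ₗ[ℂ] V} (hg1 : ∀ a, g (u a) = c a • w (π a))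
    (hg2 : ∀ x, (∀ a, us a x = 0) → g x = x + ∑ a, ws a x • (u a - w a))
    {M F : Submodule ℂ V} (hM : ∀ x ∈ M, ∀ a, us a x ≠ 0 → u a ∈ M)
    (hF : ∀ x ∈ F, ∀ a, ws a x ≠ 0 → w a ∈ F) :
    M.map (g : V →ₗ[ℂ] V) ⊓ F =
      ((M ⊓ ⨅ a, LinearMap.ker (us a)).map (g : V →ₗ[ℂ] V) ⊓ F) ⊔
        Submodule.span ℂ (Set.range fun a : {a // u a ∈ M ∧ w (π a) ∈ F} => w (π a)) := by
  -- On the common kernel of us, g trades the w-coordinates for u-coordinates, so no w-coordinate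
  -- survives. The w-part of g x then comes only from the u-part of x.
  have hg3 : ∀ x, (∀ a, us a x = 0) → ∀ b, ws b (g x) = 0 := fun x hx b => by
    rw [hg2 x hx]
    simp [hwu, hw.biorth]
  apply le_antisymm
  · rintro _ ⟨⟨x, hx, rfl⟩, hxF⟩
    change g x ∈ F at hxF
    change g x ∈ _
    obtain ⟨x₀, hx₀⟩ : ∃ x₀, x₀ = x - ∑ a, us a x • u a := ⟨_, rfl⟩
    have hx₁ : x = x₀ + ∑ a, us a x • u a := by rw [hx₀]; abel
    have h0 : ∀ a, us a x₀ = 0 := fun a => by simp [hx₀, hu.biorth]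
    have hsum : ∀ a, us a x • u a ∈ M := fun a => by
      by_cases h : us a x = 0
      · simp [h]
      · exact M.smul_mem _ (hM x hx a h)
    have hx₀M : x₀ ∈ M := hx₀ ▸ M.sub_mem hx (M.sum_mem fun a _ => hsum a)
    have hgx : g x = g x₀ + ∑ a, us a x • c a • w (π a) := by
      conv_lhs => rw [hx₁]
      simp [hg1]
    have hws : ∀ a, ws (π a) (g x) = us a x * c a := fun a => by
      rw [hgx]
      simp [hg3 x₀ h0, hw.biorth]
    have hmem : ∀ a, us a x • c a • w (π a) ∈
        Submodule.span ℂ (Set.range fun a : {a // u a ∈ M ∧ w (π a) ∈ F} => w (π a)) := by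
      intro a
      by_cases h : us a x = 0
      · simp [h]
      · have h1 : w (π a) ∈ F := hF _ hxF _ (by rw [hws]; exact mul_ne_zero h (hc a))
        exact Submodule.smul_mem _ _ (Submodule.smul_mem _ _
          (Submodule.subset_span ⟨⟨a, hM x hx a h, h1⟩, rfl⟩))
    have hle : Submodule.span ℂ (Set.range fun a : {a // u a ∈ M ∧ w (π a) ∈ F} => w (π a)) ≤ F := by
      rw [Submodule.span_le]
      rintro _ ⟨a, rfl⟩
      exact a.2.2
    have hS := Submodule.sum_mem _ fun a (_ : a ∈ Finset.univ) => hmem a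
    rw [hgx]
    refine Submodule.add_mem_sup ⟨⟨x₀, ⟨hx₀M, ?_⟩, rfl⟩, ?_⟩ hS
    · simpa using h0
    · have := F.sub_mem hxF (hle hS)
      rwa [hgx, add_sub_cancel_right] at this
  · refine sup_le (inf_le_inf_right _ (Submodule.map_mono inf_le_left)) ?_
    rw [Submodule.span_le]
    rintro _ ⟨⟨a, ha⟩, rfl⟩
    refine ⟨⟨(c a)⁻¹ • u a, M.smul_mem _ ha.1, ?_⟩, ha.2⟩
    simp [hg1, smul_smul, hc]

/-- Elements of the first space are killed by all the forms ws, while an element of the span of the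
w's is determined by its values under them. -/
lemma DualFamily.disjoint_link {D : ClassicalDatum V} {u w : κ → V} {us ws : κ → Module.Dual ℂ V}
    (hw : DualFamily D w ws) (hwu : ∀ a b, ws a (u b) = 0) (π : Equiv.Perm κ)
    {g : V ≃ₗ[ℂ] V}
    (hg2 : ∀ x, (∀ a, us a x = 0) → g x = x + ∑ a, ws a x • (u a - w a))
    {M F : Submodule ℂ V} :
    Disjoint ((M ⊓ ⨅ a, LinearMap.ker (us a)).map (g : V →ₗ[ℂ] V) ⊓ F)
      (Submodule.span ℂ (Set.range fun a : {a // u a ∈ M ∧ w (π a) ∈ F} => w (π a))) := by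
  rw [Submodule.disjoint_def]
  rintro _ ⟨⟨x, ⟨-, hx⟩, rfl⟩, -⟩ hx'
  have hx0 : ∀ a, us a x = 0 := by simpa using hx
  change g x = 0
  change g x ∈ _ at hx'
  have hg3 : ∀ b, ws b (g x) = 0 := fun b => by
    rw [hg2 x hx0]
    simp [hwu, hw.biorth]
  have key : ∀ y ∈ Submodule.span ℂ (Set.range fun a : {a // u a ∈ M ∧ w (π a) ∈ F} => w (π a)),
      y = ∑ a, ws a y • w a := by
    intro y hy
    induction hy using Submodule.span_induction with
    | mem y hy =>
      obtain ⟨a, rfl⟩ := hy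
      simp [hw.biorth]
    | zero => simp
    | add y z _ _ hy hz =>
      simp only [map_add, add_smul, Finset.sum_add_distrib]
      rw [← hy, ← hz]
    | smul t y _ hy =>
      simp only [map_smul, smul_eq_mul, mul_smul]
      rw [← Finset.smul_sum, ← hy]
  rw [key _ hx']
  simp [hg3]

lemma DualFamily.finrank_link {D : ClassicalDatum V} {u w : κ → V} {ws : κ → Module.Dual ℂ V}
    (hw : DualFamily D w ws) (π : Equiv.Perm κ) (M F : Submodule ℂ V) :
    Module.finrank ℂ (Submodule.span ℂ
      (Set.range fun a : {a // u a ∈ M ∧ w (π a) ∈ F} => w (π a))) =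
      Nat.card {a // u a ∈ M ∧ w (π a) ∈ F} := by
  classical
  have hli : LinearIndependent ℂ w := by
    rw [Fintype.linearIndependent_iff]
    intro t ht a
    have := congrArg (ws a) ht
    simpa [hw.biorth] using this
  have hli' : LinearIndependent ℂ fun a : {a // u a ∈ M ∧ w (π a) ∈ F} => w (π a) :=
    hli.comp (fun a : {a // u a ∈ M ∧ w (π a) ∈ F} => π a)
      (π.injective.comp Subtype.val_injective)
  rw [finrank_span_eq_card hli', Nat.card_eq_fintype_card]

/-- If `r` linking elements are pairwise distinguished by their relative positions, there are at
least `r` orbits. -/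
lemma le_card_orbits_of_links {D : ClassicalDatum V} {P₁ P₂ : Subgroup D.group}
    [Finite (MulAction.orbitRel.Quotient D.group ((D.group ⧸ P₁) × (D.group ⧸ P₂)))]
    {u w : κ → V} {us ws : κ → Module.Dual ℂ V}
    (hu : DualFamily D u us) (hw : DualFamily D w ws) (huw : ∀ a b, us a (w b) = 0)
    (hwu : ∀ a b, ws a (u b) = 0) {F : Submodule ℂ V} (hFP : F ∈ invariants P₂)
    (hF : ∀ x ∈ F, ∀ a, ws a x ≠ 0 → w a ∈ F)
    (hM : ∀ M ∈ invariants P₁, ∀ x ∈ M, ∀ a, us a x ≠ 0 → u a ∈ M)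
    {r : ℕ} (π : Fin r → Equiv.Perm κ) {c : Fin r → κ → ℂ} (hc : ∀ s a, c s a ≠ 0)
    (hω : ∀ ω ∈ D.form, ∀ a b, ω (w a) (w b) = ω (u a) (u b) ∧
      ∀ s, ω (c s a • w (π s a)) (c s b • w (π s b)) = ω (u a) (u b))
    (hdist : ∀ s t, s ≠ t → ∃ M ∈ invariants P₁,
      Nat.card {a // u a ∈ M ∧ w (π s a) ∈ F} ≠ Nat.card {a // u a ∈ M ∧ w (π t a) ∈ F}) :
    r ≤ Nat.card (MulAction.orbitRel.Quotient D.group ((D.group ⧸ P₁) × (D.group ⧸ P₂))) := by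
  choose g hg1 hg2 using fun s => hu.exists_link hw huw hwu (π s) (hc s)
    fun ω hD a b => ⟨(hω ω hD a b).1, (hω ω hD a b).2 s⟩
  -- The orbit of the pair (g_s P₁, P₂). If two of these orbits coincide, some p in P₂ carries g_t M
  -- ⊓ F onto g_s M ⊓ F for every P₁-invariant M.
  let f : Fin r → MulAction.orbitRel.Quotient D.group ((D.group ⧸ P₁) × (D.group ⧸ P₂)) :=
    fun s => Quotient.mk _ ((g s : D.group ⧸ P₁), ((1 : D.group) : D.group ⧸ P₂))
  suffices hf : Function.Injective f by
    simpa using Nat.card_le_card_of_injective f hf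
  intro s t hst
  by_contra hne
  obtain ⟨M, hMP, hcard⟩ := hdist s t hne
  apply hcard
  have h1 := MulAction.orbitRel_apply.1 (Quotient.exact hst)
  obtain ⟨p, hp⟩ := h1
  have hp1 : ((p * g t : D.group) : D.group ⧸ P₁) = (g s : D.group ⧸ P₁) := congrArg Prod.fst hp
  have hp2 : ((p * 1 : D.group) : D.group ⧸ P₂) = ((1 : D.group) : D.group ⧸ P₂) :=
    congrArg Prod.snd hp
  have hpP : p ∈ P₂ := by
    have h2 := QuotientGroup.eq.1 hp2
    simpa using h2
  have hqP : (p * g t)⁻¹ * g s ∈ P₁ := QuotientGroup.eq.1 hp1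
  have hmapM : (M.map ((g t).1 : V →ₗ[ℂ] V)).map (p.1 : V →ₗ[ℂ] V) =
      M.map ((g s).1 : V →ₗ[ℂ] V) := by
    have h3 : g s = p * g t * ((p * g t)⁻¹ * g s) := by group
    conv_rhs => rw [h3, ← map_eq_of_mem_invariants hMP (inv_mem hqP)]
    rw [← Submodule.map_comp, ← Submodule.map_comp]
    congr 1
    ext x
    change p.1 ((g t).1 x) = (p * g t * ((p * g t)⁻¹ * g s) * ((p * g t)⁻¹ * g s)⁻¹).1 x
    rw [mul_inv_cancel_right]
    rfl
  have hmap : (M.map ((g t).1 : V →ₗ[ℂ] V) ⊓ F).map (p.1 : V →ₗ[ℂ] V) =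
      M.map ((g s).1 : V →ₗ[ℂ] V) ⊓ F := by
    rw [Submodule.map_inf _ p.1.injective, hmapM, map_eq_of_mem_invariants hFP hpP]
  -- On the common kernel of us all links agree. Both intersections therefore share their first
  -- summand, and p compares the dimensions of the second ones.
  have hX : (M ⊓ ⨅ a, LinearMap.ker (us a)).map ((g t).1 : V →ₗ[ℂ] V) =
      (M ⊓ ⨅ a, LinearMap.ker (us a)).map ((g s).1 : V →ₗ[ℂ] V) := by
    ext y
    constructor
    · rintro ⟨x, hx, rfl⟩
      have hx0 : ∀ a, us a x = 0 := by simpa using hx.2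
      exact ⟨x, hx, (hg2 s x hx0).trans (hg2 t x hx0).symm⟩
    · rintro ⟨x, hx, rfl⟩
      have hx0 : ∀ a, us a x = 0 := by simpa using hx.2
      exact ⟨x, hx, (hg2 t x hx0).trans (hg2 s x hx0).symm⟩
  rw [hu.map_inf_eq hw hwu (hc t) (hg1 t) (hg2 t) (hM M hMP) hF,
    hu.map_inf_eq hw hwu (hc s) (hg1 s) (hg2 s) (hM M hMP) hF, hX] at hmap
  obtain ⟨U, hU, hUp⟩ := p.2.1.2.1
  have d1 := hw.disjoint_link hwu (π t) (hg2 t) (M := M) (F := F)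
  rw [hX] at d1
  have hfd : ∀ s, FiniteDimensional ℂ (Submodule.span ℂ
      (Set.range fun a : {a // u a ∈ M ∧ w (π s a) ∈ F} => w (π s a))) := fun s =>
    FiniteDimensional.span_of_finite ℂ (Set.finite_range _)
  have := hfd s
  have := hfd t
  have := finrank_eq_of_map_sup_eq hU hUp d1
    (hw.disjoint_link hwu (π s) (hg2 s) (M := M) (F := F)) hmap
  rw [hw.finrank_link, hw.finrank_link] at this
  exact this.symm

end Links

end ClassicalDatum

/-! ### Coordinate and hyperbolic families -/

namespace ClassicalDatum

variable {V : Type u} [AddCommGroup V] [Module ℂ V]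

lemma dualFamily_coord {D : ClassicalDatum V} (hD : D.form = none) {e : Module.Basis ℕ ℂ V}
    (he : D.IsAdmissible e) {κ : Type*} [DecidableEq κ] {x : κ → ℕ}
    (hx : Function.Injective x) :
    DualFamily D (fun a => e (x a)) (fun a => e.coord (x a)) where
  mem a := coord_mem_dualSpace he _
  biorth a b := by
    by_cases h : a = b
    · subst h; simp
    · have : x b ≠ x a := fun h0 => h (hx h0).symm
      simp [h, this]
  orth ω hω := by simp [hD] at hω

section Hyperbolic

variable {ι : Type*}

/-- The hyperbolic family attached to the pairs `(x a, i (x a))`. -/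
noncomputable def hyperbolicVector (ω : LinearMap.BilinForm ℂ V) (e : Module.Basis ℕ ℂ V)
    (i : ℕ → ℕ) (x : ι → ℕ) (p : ι × Bool) : V :=
  if p.2 then (ω (e (x p.1)) (e (i (x p.1))))⁻¹ • e (i (x p.1)) else e (x p.1)

/-- The linear forms dual to `hyperbolicVector`. -/
noncomputable def hyperbolicForm (ω : LinearMap.BilinForm ℂ V) (e : Module.Basis ℕ ℂ V)
    (i : ℕ → ℕ) (x : ι → ℕ) (p : ι × Bool) : Module.Dual ℂ V :=
  if p.2 then ω (e (x p.1)) (e (i (x p.1))) • e.coord (i (x p.1)) else e.coord (x p.1)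

variable {D : ClassicalDatum V} {ω : LinearMap.BilinForm ℂ V} {ε : ℂ}
  {e : Module.Basis ℕ ℂ V} {i : ℕ → ℕ} {x : ι → ℕ}

lemma hyperbolicVector_mem_iff (h : IsotropicBasis ω ε e i) {M : Submodule ℂ V} (p : ι × Bool) :
    hyperbolicVector ω e i x p ∈ M ↔ e (if p.2 then i (x p.1) else x p.1) ∈ M := by
  by_cases hp : p.2 = true
  · simp only [hyperbolicVector, hp, if_true]
    exact M.smul_mem_iff (inv_ne_zero (h.gram_ne _))
  · simp [hyperbolicVector, hp]

lemma hyperbolicForm_eq_zero_iff (h : IsotropicBasis ω ε e i) (p : ι × Bool) (v : V) :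
    hyperbolicForm ω e i x p v = 0 ↔ e.repr v (if p.2 then i (x p.1) else x p.1) = 0 := by
  by_cases hp : p.2 = true
  · simp [hyperbolicForm, hp, h.gram_ne]
  · simp [hyperbolicForm, hp]

variable [DecidableEq ι]

lemma hyperbolicVector_gram (h : IsotropicBasis ω ε e i) (hx : Function.Injective x)
    (hix : ∀ a b, i (x a) ≠ x b) (p q : ι × Bool) :
    ω (hyperbolicVector ω e i x p) (hyperbolicVector ω e i x q) =
      if p.1 = q.1 then (if p.2 then (if q.2 then 0 else ε) else (if q.2 then 1 else 0))
        else 0 := by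
  obtain ⟨a, s⟩ := p
  obtain ⟨b, t⟩ := q
  have hinj : ∀ {j k}, i j = i k → j = k := fun {j k} hjk => by
    rw [← h.invol j, hjk, h.invol]
  have h1 : ω (e (x a)) (e (x b)) = 0 := h.gram_eq_zero fun h0 => hix a b h0.symm
  have h2 : ω (e (i (x a))) (e (i (x b))) = 0 := h.gram_eq_zero (by
    rw [h.invol]; exact hix b a)
  have hne := h.gram_ne
  by_cases hab : a = b
  · subst hab
    have h3 := h.symm (e (i (x a))) (e (x a))
    have h4 := hne (x a)
    cases s <;> cases t <;> simp [hyperbolicVector, h1, h2, h3, hne]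
    field_simp
  · have h3 : ω (e (i (x a))) (e (x b)) = 0 := h.gram_eq_zero (by
      rw [h.invol]; exact fun h0 => hab (hx h0.symm))
    have h4 : ω (e (x a)) (e (i (x b))) = 0 :=
      h.gram_eq_zero fun h0 => hab (hx (hinj h0).symm)
    cases s <;> cases t <;> simp [hyperbolicVector, h1, h2, h3, h4, hab]

lemma dualFamily_hyperbolic (hD : D.form = some ω) (he : D.IsAdmissible e)
    (h : IsotropicBasis ω ε e i) (hx : Function.Injective x) (hix : ∀ a b, i (x a) ≠ x b) :
    DualFamily D (hyperbolicVector ω e i x) (hyperbolicForm ω e i x) where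
  mem p := by
    unfold hyperbolicForm
    split_ifs
    · exact Submodule.smul_mem _ _ (coord_mem_dualSpace he _)
    · exact coord_mem_dualSpace he _
  biorth p q := by
    obtain ⟨a, s⟩ := p
    obtain ⟨b, t⟩ := q
    have hinj : ∀ {j k}, i j = i k → j = k := fun {j k} hjk => by
      rw [← h.invol j, hjk, h.invol]
    have hne := h.gram_ne
    have h1 := hix a b
    have h2 := hix b a
    by_cases hab : a = b
    · subst hab
      cases s <;> cases t <;>
        simp [hyperbolicVector, hyperbolicForm, hne, h1, Ne.symm h1, mul_comm]
    · have h3 : x b ≠ x a := fun h0 => hab (hx h0.symm)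
      have h4 : i (x b) ≠ i (x a) := fun h0 => h3 (hinj h0)
      cases s <;> cases t <;>
        simp [hyperbolicVector, hyperbolicForm, hab, h2, h3, h4, Ne.symm h1]
  orth ω' hω' v hv p := by
    obtain rfl : ω = ω' := by simpa [hD] using hω'
    have h0 : ∀ a (s : Bool), e.repr v (if s then i (x a) else x a) = 0 := fun a s =>
      (hyperbolicForm_eq_zero_iff h (a, s) v).1 (hv _)
    have h1 : ∀ a, e.repr v (x a) = 0 := fun a => by simpa using h0 a false
    have h2 : ∀ a, e.repr v (i (x a)) = 0 := fun a => by simpa using h0 a true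
    obtain ⟨a, s⟩ := p
    cases s
    · simp [hyperbolicVector, h.apply_left _ v, h.apply_right _ v, h2]
    · simp [hyperbolicVector, h.apply_left _ v, h.apply_right _ v, h1, h.invol]

/-- The permutation exchanging the members of the pairs with index in `A`. -/
def flipPerm (A : Set ι) [DecidablePred (· ∈ A)] : Equiv.Perm (ι × Bool) :=
  Function.Involutive.toPerm (fun p => (p.1, if p.1 ∈ A then !p.2 else p.2)) fun p => by
    by_cases h : p.1 ∈ A <;> simp [h]

omit [DecidableEq ι] in
lemma flipPerm_apply (A : Set ι) [DecidablePred (· ∈ A)] (p : ι × Bool) :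
    flipPerm A p = (p.1, if p.1 ∈ A then !p.2 else p.2) := rfl

/-- The scalars making `flipPerm` isometric on a hyperbolic family. -/
def flipScalar (ε : ℂ) (A : Set ι) [DecidablePred (· ∈ A)] (p : ι × Bool) : ℂ :=
  if p.1 ∈ A then (if p.2 then ε else 1) else 1

/-- For a pair (x, y) with ω(x, y) = 1 and ω(y, x) = ε, the flipped pair is (y, ε x), and ω(y, ε x)
= ε² = 1. -/
lemma hyperbolicVector_gram_flip (h : IsotropicBasis ω ε e i) (hx : Function.Injective x)
    (hix : ∀ a b, i (x a) ≠ x b) (A : Set ι) [DecidablePred (· ∈ A)] (p q : ι × Bool) :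
    ω (flipScalar ε A p • hyperbolicVector ω e i x (flipPerm A p))
      (flipScalar ε A q • hyperbolicVector ω e i x (flipPerm A q)) =
      ω (hyperbolicVector ω e i x p) (hyperbolicVector ω e i x q) := by
  obtain ⟨a, s⟩ := p
  obtain ⟨b, t⟩ := q
  simp only [map_smul, LinearMap.smul_apply, smul_eq_mul, hyperbolicVector_gram h hx hix,
    flipPerm_apply, flipScalar]
  by_cases hab : a = b
  · subst hab
    by_cases ha : a ∈ A
    · cases s <;> cases t <;> simp [ha, h.eps_mul]
    · simp [ha]
  · simp [hab]

end Hyperbolic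

lemma finite_setOf_apply_ne_zero {D : ClassicalDatum V} {e : Module.Basis ℕ ℂ V}
    (he : D.IsAdmissible e) {φ : Module.Dual ℂ V} (hφ : φ ∈ D.dualSpace) :
    {x | φ (e x) ≠ 0}.Finite := by
  rw [← span_coord_of_isAdmissible he] at hφ
  induction hφ using Submodule.span_induction with
  | mem φ hφ =>
    obtain ⟨j, rfl⟩ := hφ
    refine (Set.finite_singleton j).subset fun x hx => ?_
    by_contra h0
    have h1 : x ≠ j := h0
    exact hx (by simp [h1])
  | zero => simp
  | add φ ψ _ _ h1 h2 =>
    refine (h1.union h2).subset fun x hx => ?_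
    by_contra h0
    simp only [Set.mem_union, Set.mem_ofPred_eq, not_or, not_not] at h0
    exact hx (by simp [h0.1, h0.2])
  | smul t φ _ h1 =>
    refine h1.subset fun x hx => ?_
    exact right_ne_zero_of_mul (show t * φ (e x) ≠ 0 from hx)

/-- Two admissible bases are almost biorthogonal. -/
lemma exists_far {D : ClassicalDatum V} {e₁ e₂ : Module.Basis ℕ ℂ V}
    (he₁ : D.IsAdmissible e₁) (he₂ : D.IsAdmissible e₂) (J : Finset ℕ) :
    ∃ B : Finset ℕ, ∀ x ∉ B, ∀ y ∈ J, e₁.repr (e₂ y) x = 0 ∧ e₂.repr (e₁ x) y = 0 := by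
  classical
  have h1 : ∀ y, {x | e₂.coord y (e₁ x) ≠ 0}.Finite := fun y =>
    finite_setOf_apply_ne_zero he₁ (coord_mem_dualSpace he₂ y)
  refine ⟨J.biUnion fun y => (e₁.repr (e₂ y)).support ∪ (h1 y).toFinset, fun x hx y hy => ?_⟩
  have h2 : x ∉ (e₁.repr (e₂ y)).support ∪ (h1 y).toFinset := fun h0 =>
    hx (Finset.mem_biUnion.2 ⟨y, hy, h0⟩)
  simpa using h2

lemma orbits_swap {D : ClassicalDatum V} {P₁ P₂ : Subgroup D.group}
    (h : Finite (MulAction.orbitRel.Quotient D.group ((D.group ⧸ P₁) × (D.group ⧸ P₂)))) :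
    Finite (MulAction.orbitRel.Quotient D.group ((D.group ⧸ P₂) × (D.group ⧸ P₁))) := by
  let f : MulAction.orbitRel.Quotient D.group ((D.group ⧸ P₁) × (D.group ⧸ P₂)) →
      MulAction.orbitRel.Quotient D.group ((D.group ⧸ P₂) × (D.group ⧸ P₁)) :=
    Quotient.map Prod.swap (by
      rintro _ b ⟨g, rfl⟩
      exact ⟨g, rfl⟩)
  refine Finite.of_surjective f ?_
  rintro ⟨⟨a, b⟩⟩
  exact ⟨Quotient.mk _ (b, a), rfl⟩

lemma card_subtype_and_eq {κ : Type*} [Finite κ] (p : κ → Prop) (s : κ) [Decidable (p s)] :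
    Nat.card {a // p a ∧ a = s} = if p s then 1 else 0 := by
  split_ifs with h
  · rw [Nat.card_eq_one_iff_unique]
    exact ⟨⟨fun a b => Subtype.ext (a.2.2.trans b.2.2.symm)⟩, ⟨⟨s, h, rfl⟩⟩⟩
  · rw [Nat.card_eq_zero]
    left
    exact ⟨fun a => h (a.2.2 ▸ a.2.1)⟩

lemma card_subtype_lt {κ : Type*} [Finite κ] {p q : κ → Prop} (h : ∀ a, p a → q a) {s : κ}
    (hp : ¬ p s) (hq : q s) : Nat.card {a // p a} < Nat.card {a // q a} := by
  classical
  have := Fintype.ofFinite κ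
  rw [Nat.card_eq_fintype_card, Nat.card_eq_fintype_card]
  rw [Fintype.card_subtype, Fintype.card_subtype]
  refine Finset.card_lt_card ⟨fun a ha => ?_, fun hsub => ?_⟩
  · simp only [Finset.mem_filter, Finset.mem_univ, true_and] at ha ⊢
    exact h a ha
  · have := hsub (show s ∈ Finset.univ.filter q by simpa using hq)
    exact hp (by simpa using this)

end ClassicalDatum

/-! ### Classes of basis vectors under the invariants, and orbit counts -/

namespace ClassicalDatum

variable {V : Type u} [AddCommGroup V] [Module ℂ V]

lemma exists_injective_fin {S : Set ℕ} (hS : S.Infinite) (n : ℕ) :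
    ∃ y : Fin n → ℕ, Function.Injective y ∧ ∀ a, y a ∈ S :=
  ⟨fun a => hS.natEmbedding S a, fun a b hab => by
    have h1 := (hS.natEmbedding S).injective (Subtype.ext hab)
    exact Fin.ext h1, fun a => (hS.natEmbedding S a).2⟩

lemma exists_injective_comp_fin {α : Type*} {f : ℕ → α} {S : Set ℕ} (hS : (f '' S).Infinite)
    (n : ℕ) : ∃ x : Fin n → ℕ, Function.Injective (f ∘ x) ∧ ∀ a, x a ∈ S := by
  choose x hx hfx using fun a : Fin n => (hS.natEmbedding (f '' S) a).2
  refine ⟨x, fun a b hab => ?_, hx⟩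
  have h1 : f (x a) = f (x b) := hab
  rw [hfx, hfx] at h1
  exact Fin.ext ((hS.natEmbedding (f '' S)).injective (Subtype.ext h1))

/-- The invariant subspaces containing the `x`-th basis vector. -/
def invariantsAt {D : ClassicalDatum V} (P : Subgroup D.group) (e : Module.Basis ℕ ℂ V) (x : ℕ) :
    Set (Submodule ℂ V) :=
  {M | M ∈ invariants P ∧ e x ∈ M}

namespace SplittingBasis

variable {D : ClassicalDatum V} {P : Subgroup D.group} {e : Module.Basis ℕ ℂ V} {I : ℕ → Finset ℕ}

/-- An invariant subspace is determined by which classes of basis vectors it contains, so finitely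
many classes would leave finitely many invariants. -/
lemma infinite_range_invariantsAt (h : SplittingBasis D P e I) (hP : ¬ D.IsSemilarge P) :
    (Set.range (invariantsAt P e)).Infinite := by
  intro hfin
  apply hP
  change (invariants P).Finite
  have : Finite (Set.range (invariantsAt P e)) := hfin
  have hinj : Function.Injective
      (fun M : invariants P => {c : Set.range (invariantsAt P e) | (M : Submodule ℂ V) ∈ c.1}) := by
    intro M N hMN
    refine Subtype.ext ((h.isCoordinate M.2).ext (h.isCoordinate N.2) fun j => ?_)
    have h1 := Set.ext_iff.1 hMN ⟨_, j, rfl⟩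
    have h2 : ∀ M : invariants P, (M : Submodule ℂ V) ∈ invariantsAt P e j ↔ e j ∈ (M : Submodule ℂ V) :=
      fun M => and_iff_right M.2
    exact (h2 M).symm.trans (h1.trans (h2 N))
  exact Finite.of_injective _ hinj

lemma infinite_image_compl (h : SplittingBasis D P e I) (hP : ¬ D.IsSemilarge P) (B : Finset ℕ) :
    (invariantsAt P e '' {x | x ∉ B}).Infinite := by
  intro hfin
  refine h.infinite_range_invariantsAt hP ((hfin.union (B.finite_toSet.image (invariantsAt P e))).subset ?_)
  rintro _ ⟨x, rfl⟩
  by_cases hx : x ∈ B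
  · exact Or.inr ⟨x, hx, rfl⟩
  · exact Or.inl ⟨x, hx, rfl⟩

/-- One may keep a single member of each pair without losing the infinitude of classes, because the
class of x is a function of the class of i x. -/
lemma infinite_image_lt (h : SplittingBasis D P e I) (hP : ¬ D.IsSemilarge P)
    {ω : LinearMap.BilinForm ℂ V} {ε : ℂ} {i : ℕ → ℕ} (hD : D.form = some ω)
    (hi : IsotropicBasis ω ε e i) (B : Finset ℕ) :
    (invariantsAt P e '' {x | x ∉ B ∧ i x ∉ B ∧ x < i x}).Infinite := by
  intro hfin
  have hfix : {x | i x = x}.Finite := Set.Subsingleton.finite fun a ha b hb => hi.fixed a b ha hb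
  let φ : Set (Submodule ℂ V) → Set (Submodule ℂ V) := fun c =>
    {M | M ∈ invariants P ∧ ω.orthogonal M ∉ c}
  -- An invariant M contains e x exactly when its orthogonal omits e (i x).
  have hφ : ∀ x, invariantsAt P e x = φ (invariantsAt P e (i x)) := by
    intro x
    ext M
    simp only [invariantsAt, φ, Set.mem_ofPred_eq]
    refine and_congr_right fun hM => ?_
    rw [and_iff_right (orthogonal_mem_invariants hD hM), (h.isCoordinate hM).mem_orthogonal hi,
      hi.invol, not_not]
  have hB : ((B : Set ℕ) ∪ i '' B ∪ {x | i x = x}).Finite :=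
    (B.finite_toSet.union (B.finite_toSet.image i)).union hfix
  refine h.infinite_range_invariantsAt hP
    (((hB.image (invariantsAt P e)).union (hfin.union (hfin.image φ))).subset ?_)
  rintro _ ⟨x, rfl⟩
  by_cases hx : x ∈ (B : Set ℕ) ∪ i '' B ∪ {x | i x = x}
  · exact Or.inl ⟨x, hx, rfl⟩
  · simp only [Set.mem_union, Finset.mem_coe, Set.mem_image, Set.mem_ofPred_eq, not_or, not_exists,
      not_and] at hx
    obtain ⟨⟨h1, h2⟩, h3⟩ := hx
    have h4 : i x ∉ B := fun h0 => h2 _ h0 (hi.invol x)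
    right
    rcases lt_or_gt_of_ne h3 with h5 | h5
    · right
      rw [hφ x]
      refine ⟨_, ⟨i x, ⟨h4, ?_, ?_⟩, rfl⟩, rfl⟩
      · rwa [hi.invol]
      · rwa [hi.invol]
    · left
      exact ⟨x, ⟨h1, h4, h5⟩, rfl⟩

/-- Inequivalent indices are separated by an invariant subspace. -/
lemma exists_separating {x y : ℕ} (h : invariantsAt P e x ≠ invariantsAt P e y) :
    ∃ M ∈ invariants P, (e x ∈ M ∧ e y ∉ M) ∨ (e y ∈ M ∧ e x ∉ M) := by
  by_contra! hcon
  apply h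
  ext M
  simp only [invariantsAt, Set.mem_ofPred_eq]
  refine and_congr_right fun hM => ?_
  have := hcon M hM
  tauto

end SplittingBasis

section Counting

variable {D : ClassicalDatum V} {P₁ P₂ : Subgroup D.group} {e₁ e₂ : Module.Basis ℕ ℂ V}
  {I₁ I₂ : ℕ → Finset ℕ}
  [Finite (MulAction.orbitRel.Quotient D.group ((D.group ⧸ P₁) × (D.group ⧸ P₂)))]

/-- Counting orbits with families of basis vectors, in the absence of a form. -/
lemma le_card_orbits_of_none (hD : D.form = none) (h₁ : SplittingBasis D P₁ e₁ I₁)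
    (h₂ : SplittingBasis D P₂ e₂ I₂) {κ : Type*} [Fintype κ] [DecidableEq κ] {x y : κ → ℕ}
    (hx : Function.Injective x) (hy : Function.Injective y)
    (hxy : ∀ a b, e₁.repr (e₂ (y b)) (x a) = 0 ∧ e₂.repr (e₁ (x a)) (y b) = 0)
    {F : Submodule ℂ V} (hF : F ∈ invariants P₂) {r : ℕ} (π : Fin r → Equiv.Perm κ)
    (hdist : ∀ s t, s ≠ t → ∃ M ∈ invariants P₁,
      Nat.card {a // e₁ (x a) ∈ M ∧ e₂ (y (π s a)) ∈ F} ≠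
        Nat.card {a // e₁ (x a) ∈ M ∧ e₂ (y (π t a)) ∈ F}) :
    r ≤ Nat.card (MulAction.orbitRel.Quotient D.group ((D.group ⧸ P₁) × (D.group ⧸ P₂))) :=
  le_card_orbits_of_links (dualFamily_coord hD h₁.adm hx) (dualFamily_coord hD h₂.adm hy)
    (fun a b => (hxy a b).1) (fun a b => (hxy b a).2) hF
    (fun v hv a ha => h₂.isCoordinate hF v hv _ ha)
    (fun M hM v hv a ha => h₁.isCoordinate hM v hv _ ha) π (c := fun _ _ => 1) (by simp)
    (by simp [hD]) hdist

/-- Counting orbits with hyperbolic families. -/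
lemma le_card_orbits_of_form {ω : LinearMap.BilinForm ℂ V} {ε : ℂ} {i₁ i₂ : ℕ → ℕ}
    (hD : D.form = some ω) (hi₁ : IsotropicBasis ω ε e₁ i₁) (hi₂ : IsotropicBasis ω ε e₂ i₂)
    (h₁ : SplittingBasis D P₁ e₁ I₁) (h₂ : SplittingBasis D P₂ e₂ I₂)
    {ι : Type*} [Fintype ι] [DecidableEq ι] {x y : ι → ℕ}
    (hx : Function.Injective x) (hy : Function.Injective y)
    (hix : ∀ a b, i₁ (x a) ≠ x b) (hiy : ∀ a b, i₂ (y a) ≠ y b)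
    (hxy : ∀ a b (s t : Bool), e₁.repr (e₂ (if t then i₂ (y b) else y b))
        (if s then i₁ (x a) else x a) = 0 ∧
      e₂.repr (e₁ (if s then i₁ (x a) else x a)) (if t then i₂ (y b) else y b) = 0)
    {F : Submodule ℂ V} (hF : F ∈ invariants P₂) {r : ℕ} (π : Fin r → Equiv.Perm (ι × Bool))
    {c : Fin r → ι × Bool → ℂ} (hc : ∀ s a, c s a ≠ 0)
    (hω : ∀ s p q, ω (c s p • hyperbolicVector ω e₂ i₂ y (π s p))
      (c s q • hyperbolicVector ω e₂ i₂ y (π s q)) =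
        ω (hyperbolicVector ω e₂ i₂ y p) (hyperbolicVector ω e₂ i₂ y q))
    (hdist : ∀ s t, s ≠ t → ∃ M ∈ invariants P₁,
      Nat.card {p : ι × Bool // e₁ (if p.2 then i₁ (x p.1) else x p.1) ∈ M ∧
        e₂ (if (π s p).2 then i₂ (y (π s p).1) else y (π s p).1) ∈ F} ≠
      Nat.card {p : ι × Bool // e₁ (if p.2 then i₁ (x p.1) else x p.1) ∈ M ∧
        e₂ (if (π t p).2 then i₂ (y (π t p).1) else y (π t p).1) ∈ F}) :
    r ≤ Nat.card (MulAction.orbitRel.Quotient D.group ((D.group ⧸ P₁) × (D.group ⧸ P₂))) := by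
  have hgram : ∀ p q, ω (hyperbolicVector ω e₂ i₂ y p) (hyperbolicVector ω e₂ i₂ y q) =
      ω (hyperbolicVector ω e₁ i₁ x p) (hyperbolicVector ω e₁ i₁ x q) := fun p q => by
    rw [hyperbolicVector_gram hi₁ hx hix, hyperbolicVector_gram hi₂ hy hiy]
  have hmem₁ : ∀ (M : Submodule ℂ V) (p : ι × Bool), hyperbolicVector ω e₁ i₁ x p ∈ M ↔
      e₁ (if p.2 then i₁ (x p.1) else x p.1) ∈ M := fun M p => hyperbolicVector_mem_iff hi₁ p
  have hmem₂ : ∀ (M : Submodule ℂ V) (p : ι × Bool), hyperbolicVector ω e₂ i₂ y p ∈ M ↔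
      e₂ (if p.2 then i₂ (y p.1) else y p.1) ∈ M := fun M p => hyperbolicVector_mem_iff hi₂ p
  have hz : ∀ {f : Module.Dual ℂ V} {e : Module.Basis ℕ ℂ V} {i : ℕ → ℕ} {z : ι → ℕ}
      {p : ι × Bool}, f (e (if p.2 then i (z p.1) else z p.1)) = 0 →
        f (hyperbolicVector ω e i z p) = 0 := by
    intro f e i z p h0
    by_cases hp : p.2 = true
    · simp only [hp, if_true] at h0
      simp [hyperbolicVector, hp, h0]
    · simp only [hp] at h0
      simpa [hyperbolicVector, hp] using h0
  refine le_card_orbits_of_links (dualFamily_hyperbolic hD h₁.adm hi₁ hx hix)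
    (dualFamily_hyperbolic hD h₂.adm hi₂ hy hiy) (fun p q => ?_) (fun p q => ?_) hF
    (fun v hv p hp => ?_) (fun M hM v hv p hp => ?_) π hc ?_ fun s t hst => ?_
  · refine hz ((hyperbolicForm_eq_zero_iff hi₁ p _).2 ?_)
    exact (hxy p.1 q.1 p.2 q.2).1
  · refine hz ((hyperbolicForm_eq_zero_iff hi₂ p _).2 ?_)
    exact (hxy q.1 p.1 q.2 p.2).2
  · rw [hmem₂]
    exact h₂.isCoordinate hF v hv _ fun h0 => hp ((hyperbolicForm_eq_zero_iff hi₂ p v).2 h0)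
  · rw [hmem₁]
    exact h₁.isCoordinate hM v hv _ fun h0 => hp ((hyperbolicForm_eq_zero_iff hi₁ p v).2 h0)
  · intro ω' hω' p q
    obtain rfl : ω = ω' := by simpa [hD] using hω'
    exact ⟨hgram p q, fun s => (hω s p q).trans (hgram p q)⟩
  · obtain ⟨M, hM, hne⟩ := hdist s t hst
    refine ⟨M, hM, ?_⟩
    simpa only [hmem₁, hmem₂] using hne

end Counting

end ClassicalDatum

/-! ### Finitely many orbits force semilargeness -/

namespace ClassicalDatum

variable {V : Type u} [AddCommGroup V] [Module ℂ V]

lemma exists_injective_cons {S : Set ℕ} (hS : S.Infinite) {y₀ : ℕ} (hy₀ : y₀ ∉ S) (n : ℕ) :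
    ∃ y : Fin (n + 1) → ℕ, Function.Injective y ∧ y 0 = y₀ ∧ ∀ a, a ≠ 0 → y a ∈ S := by
  obtain ⟨z, hz, hzS⟩ := exists_injective_fin hS n
  refine ⟨Fin.cons y₀ z, ?_, rfl, fun a ha => ?_⟩
  · rw [Fin.cons_injective_iff]
    refine ⟨?_, hz⟩
    rintro ⟨a, rfl⟩
    exact hy₀ (hzS a)
  · obtain ⟨b, rfl⟩ := Fin.exists_succ_eq_of_ne_zero ha
    simpa using hzS b

lemma swap_apply_eq_zero_iff {n : ℕ} (s a : Fin (n + 1)) : Equiv.swap 0 s a = 0 ↔ a = s := by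
  rw [Equiv.swap_apply_eq_iff, Equiv.swap_apply_left]

section

variable {D : ClassicalDatum V} {P₁ P₂ : Subgroup D.group} {e₁ e₂ : Module.Basis ℕ ℂ V}
  {I₁ I₂ : ℕ → Finset ℕ}
  [Finite (MulAction.orbitRel.Quotient D.group ((D.group ⧸ P₁) × (D.group ⧸ P₂)))]

/-- Take r + 1 pairwise separated indices x and target indices y among which exactly one is
exceptional with respect to F. The swap of 0 and s sends x s to the exceptional target; an invariant
separating x s from x t detects the difference, giving more than r orbits. -/
lemma isSemilarge_of_none (hD : D.form = none) (h₁ : SplittingBasis D P₁ e₁ I₁)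
    (h₂ : SplittingBasis D P₂ e₂ I₂) (hP₂ : P₂ ≠ ⊤) : D.IsSemilarge P₁ := by
  by_contra hP₁
  obtain ⟨F, hF, ⟨y₀, hy₀⟩, ⟨y₁, hy₁⟩⟩ := h₂.exists_invariant_ne hP₂
  obtain ⟨r, hr⟩ : ∃ r, r = Nat.card
    (MulAction.orbitRel.Quotient D.group ((D.group ⧸ P₁) × (D.group ⧸ P₂))) := ⟨_, rfl⟩
  have hy : ∃ y : Fin (r + 1) → ℕ, Function.Injective y ∧
      ((∀ a, e₂ (y a) ∈ F ↔ a = 0) ∨ (∀ a, e₂ (y a) ∈ F ↔ a ≠ 0)) := by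
    -- The exceptional target is the only one outside F, or the only one inside, according to which
    -- side has infinitely many basis vectors to spare.
    by_cases hfin : {y | e₂ y ∉ F}.Finite
    · have hinf : {y | e₂ y ∈ F}.Infinite := fun h0 => Set.infinite_univ
        ((h0.union hfin).subset fun y _ => em (e₂ y ∈ F))
      obtain ⟨y, hy, hy0, hyS⟩ := exists_injective_cons hinf hy₁ r
      refine ⟨y, hy, Or.inr fun a => ⟨?_, hyS a⟩⟩
      rintro h0 rfl
      exact hy₁ (hy0 ▸ h0)
    · obtain ⟨y, hy, hy0, hyS⟩ := exists_injective_cons (S := {y | e₂ y ∉ F}) hfin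
        (y₀ := y₀) (fun h0 => h0 hy₀) r
      refine ⟨y, hy, Or.inl fun a => ⟨fun h0 => ?_, ?_⟩⟩
      · by_contra ha
        exact hyS a ha h0
      · rintro rfl
        rwa [hy0]
  obtain ⟨y, hy, hyF⟩ := hy
  obtain ⟨B, hB⟩ := exists_far h₁.adm h₂.adm (Finset.univ.image y)
  obtain ⟨x, hx, hxB⟩ := exists_injective_comp_fin (h₁.infinite_image_compl hP₁ B) (r + 1)
  have key := le_card_orbits_of_none hD h₁ h₂ hx.of_comp hy
    (fun a b => hB (x a) (hxB a) (y b) (Finset.mem_image_of_mem y (Finset.mem_univ b))) hF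
    (fun s : Fin (r + 1) => Equiv.swap 0 s) (fun s t hst => ?_)
  · omega
  · obtain ⟨M, hM, hsep⟩ := SplittingBasis.exists_separating fun h0 => hst (hx h0)
    refine ⟨M, hM, ?_⟩
    classical
    rcases hyF with hyF | hyF
    · simp only [hyF, swap_apply_eq_zero_iff, card_subtype_and_eq (fun a => e₁ (x a) ∈ M)]
      rcases hsep with hsep | hsep <;> simp [hsep]
    · simp only [hyF, ne_eq, swap_apply_eq_zero_iff]
      rcases hsep with ⟨hs, ht⟩ | ⟨ht, hs⟩
      · refine ne_of_lt (card_subtype_lt (s := s) (fun a ha => ⟨ha.1, ?_⟩) ?_ ?_)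
        · rintro rfl; exact ht ha.1
        · exact fun h0 => h0.2 rfl
        · exact ⟨hs, hst⟩
      · refine ne_of_gt (card_subtype_lt (s := t) (fun a ha => ⟨ha.1, ?_⟩) ?_ ?_)
        · rintro rfl; exact hs ha.1
        · exact fun h0 => h0.2 rfl
        · exact ⟨ht, Ne.symm hst⟩

variable {ω : LinearMap.BilinForm ℂ V} {ε : ℂ} {i₁ i₂ : ℕ → ℕ}

omit [Finite (MulAction.orbitRel.Quotient D.group ((D.group ⧸ P₁) × (D.group ⧸ P₂)))] in
lemma exists_far_pairs (h₁ : SplittingBasis D P₁ e₁ I₁)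
    (h₂ : SplittingBasis D P₂ e₂ I₂) (i₁ i₂ : ℕ → ℕ) {ι : Type*} [Fintype ι] (y : ι → ℕ) :
    ∃ B : Finset ℕ, ∀ x, x ∉ B → i₁ x ∉ B → ∀ b (s t : Bool),
      e₁.repr (e₂ (if t then i₂ (y b) else y b)) (if s then i₁ x else x) = 0 ∧
      e₂.repr (e₁ (if s then i₁ x else x)) (if t then i₂ (y b) else y b) = 0 := by
  classical
  obtain ⟨B, hB⟩ := exists_far h₁.adm h₂.adm
    (Finset.univ.image fun p : ι × Bool => if p.2 then i₂ (y p.1) else y p.1)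
  refine ⟨B, fun x hx hix b s t => hB _ ?_ _ ?_⟩
  · cases s <;> simpa
  · exact Finset.mem_image.2 ⟨(b, t), Finset.mem_univ _, rfl⟩

/-- Targets must now be hyperbolic pairs, and F is first replaced by a nonzero isotropic invariant.
If F is finite dimensional, one pair meets F, the others avoid it, and pairs are swapped. If F is
infinite dimensional, all the pairs meet F, and a single one is flipped. -/
lemma isSemilarge_of_form (hD : D.form = some ω) (hi₁ : IsotropicBasis ω ε e₁ i₁)
    (hi₂ : IsotropicBasis ω ε e₂ i₂) (h₁ : SplittingBasis D P₁ e₁ I₁)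
    (h₂ : SplittingBasis D P₂ e₂ I₂) (hP₂ : P₂ ≠ ⊤) : D.IsSemilarge P₁ := by
  by_contra hP₁
  have hF : ∃ F ∈ invariants P₂, (∃ y, e₂ y ∈ F) ∧ ∀ y, e₂ y ∈ F → e₂ (i₂ y) ∉ F := by
    obtain ⟨F, hF, ⟨y₀, hy₀⟩, ⟨y₁, hy₁⟩⟩ := h₂.exists_invariant_ne hP₂
    have hFo := orthogonal_mem_invariants hD hF
    have hmem := (h₂.isCoordinate hF).mem_orthogonal hi₂
    -- If this intersection were zero, F would contain or avoid each pair as a whole, and both kinds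
    -- would occur, contrary to `not_both_and_none`.
    refine ⟨F ⊓ ω.orthogonal F, inf_mem_invariants hF hFo, ?_, fun y hy hiy => ?_⟩
    · by_contra! hcon
      have hcon' : ∀ y, e₂ y ∈ F → e₂ (i₂ y) ∈ F := fun y hy => by
        by_contra h0
        exact hcon y ⟨hy, (hmem y).2 h0⟩
      refine h₂.not_both_and_none hD hi₂ hF hy₀ (hcon' _ hy₀) hy₁ fun h0 => hy₁ ?_
      rw [← hi₂.invol y₁]
      exact hcon' _ h0
    · exact (hmem y).1 hy.2 hiy.1
  obtain ⟨F, hF, ⟨y₀, hy₀⟩, hiso⟩ := hF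
  obtain ⟨r, hr⟩ : ∃ r, r = Nat.card
    (MulAction.orbitRel.Quotient D.group ((D.group ⧸ P₁) × (D.group ⧸ P₂))) := ⟨_, rfl⟩
  have hx : ∀ y : Fin (r + 1) → ℕ, ∃ x : Fin (r + 1) → ℕ, Function.Injective x ∧
      (∀ a b, i₁ (x a) ≠ x b) ∧ (∀ a b, a ≠ b → invariantsAt P₁ e₁ (x a) ≠ invariantsAt P₁ e₁ (x b)) ∧
      ∀ a b (s t : Bool), e₁.repr (e₂ (if t then i₂ (y b) else y b))
        (if s then i₁ (x a) else x a) = 0 ∧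
      e₂.repr (e₁ (if s then i₁ (x a) else x a)) (if t then i₂ (y b) else y b) = 0 := by
    intro y
    obtain ⟨B, hB⟩ := exists_far_pairs h₁ h₂ i₁ i₂ y
    obtain ⟨x, hx, hxB⟩ := exists_injective_comp_fin (h₁.infinite_image_lt hP₁ hD hi₁ B) (r + 1)
    refine ⟨x, hx.of_comp, fun a b hab => ?_, fun a b hab h0 => hab (hx h0),
      fun a b s t => hB _ (hxB a).1 (hxB a).2.1 b s t⟩
    have h1 := (hxB a).2.2
    have h2 := (hxB b).2.2
    rw [← hab, hi₁.invol] at h2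
    omega
  by_cases hfin : {y | e₂ y ∈ F}.Finite
  · have hi2inj : Function.Injective i₂ := fun a b hab => by rw [← hi₂.invol a, hab, hi₂.invol]
    have hS : {y | e₂ y ∉ F ∧ e₂ (i₂ y) ∉ F ∧ y < i₂ y}.Infinite := by
      intro hS
      have hfix : {y | i₂ y = y}.Finite :=
        Set.Subsingleton.finite fun a ha b hb => hi₂.fixed a b ha hb
      have hfin' : (i₂ ⁻¹' {y | e₂ y ∈ F}).Finite := hfin.preimage hi2inj.injOn
      refine Set.infinite_univ ((((hfin.union hfin').union hfix).union
        (hS.union (hS.preimage hi2inj.injOn))).subset fun y _ => ?_)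
      by_cases a1 : e₂ y ∈ F
      · exact Or.inl (Or.inl (Or.inl a1))
      by_cases a2 : e₂ (i₂ y) ∈ F
      · exact Or.inl (Or.inl (Or.inr a2))
      by_cases a3 : i₂ y = y
      · exact Or.inl (Or.inr a3)
      right
      rcases lt_or_gt_of_ne a3 with a4 | a4
      · right
        refine ⟨a2, ?_, ?_⟩
        · rwa [hi₂.invol]
        · rwa [hi₂.invol]
      · left
        exact ⟨a1, a2, a4⟩
    obtain ⟨y, hy, hy0, hyS⟩ := exists_injective_cons hS (y₀ := y₀) (fun h0 => h0.1 hy₀) r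
    have hy0F : e₂ (y 0) ∈ F := by rwa [hy0]
    have hiy : ∀ a b, i₂ (y a) ≠ y b := by
      intro a b hab
      by_cases ha : a = 0
      · subst ha
        by_cases hb : b = 0
        · subst hb
          exact hiso _ hy0F (by rw [hab]; exact hy0F)
        · have h1 : e₂ (i₂ (y b)) ∉ F := (hyS b hb).2.1
          rw [← hab, hi₂.invol] at h1
          exact h1 hy0F
      · by_cases hb : b = 0
        · subst hb
          have h1 : e₂ (i₂ (y a)) ∉ F := (hyS a ha).2.1
          rw [hab] at h1
          exact h1 hy0F
        · have h1 : y a < i₂ (y a) := (hyS a ha).2.2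
          have h2 : y b < i₂ (y b) := (hyS b hb).2.2
          rw [← hab, hi₂.invol] at h2
          omega
    obtain ⟨x, hx, hix, hsep, hxy⟩ := hx y
    have hyF : ∀ p : Fin (r + 1) × Bool,
        e₂ (if p.2 then i₂ (y p.1) else y p.1) ∈ F ↔ p = (0, false) := by
      rintro ⟨a, s⟩
      by_cases ha : a = 0
      · subst ha
        cases s
        · simpa using hy0F
        · simpa using hiso _ hy0F
      · cases s
        · simpa [ha] using (hyS a ha).1
        · simpa [ha] using (hyS a ha).2.1
    let π : Fin (r + 1) → Equiv.Perm (Fin (r + 1) × Bool) := fun s =>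
      Equiv.prodCongr (Equiv.swap 0 s) (Equiv.refl Bool)
    have hπ : ∀ s p, π s p = (0, false) ↔ p = (s, false) := by
      rintro s ⟨a, b⟩
      change ((Equiv.swap 0 s a, b) : Fin (r + 1) × Bool) = (0, false) ↔ _
      rw [Prod.mk.injEq, Prod.mk.injEq, swap_apply_eq_zero_iff]
    have key := le_card_orbits_of_form hD hi₁ hi₂ h₁ h₂ hx hy hix hiy hxy hF π
      (c := fun _ _ => 1) (by simp) (fun s p q => ?_) (fun s t hst => ?_)
    · omega
    · obtain ⟨a, u⟩ := p
      obtain ⟨b, v⟩ := q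
      rw [one_smul, one_smul, hyperbolicVector_gram hi₂ hy hiy, hyperbolicVector_gram hi₂ hy hiy]
      change (if Equiv.swap 0 s a = Equiv.swap 0 s b then _ else _) = _
      by_cases hab : a = b
      · subst hab
        rw [if_pos rfl, if_pos rfl]
        rfl
      · rw [if_neg fun h0 => hab ((Equiv.swap 0 s).injective h0), if_neg hab]
    · obtain ⟨M, hM, hMst⟩ := SplittingBasis.exists_separating (hsep s t hst)
      refine ⟨M, hM, ?_⟩
      classical
      simp only [hyF, hπ, card_subtype_and_eq
        (fun p : Fin (r + 1) × Bool => e₁ (if p.2 = true then i₁ (x p.1) else x p.1) ∈ M)]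
      rcases hMst with hMst | hMst <;> simp [hMst]
  -- With the s-th pair flipped, x s is sent outside F and i₁ (x s) inside. The count for M is
  -- therefore the number of x a in M, minus 1 if x s is in M, plus 1 if i₁ (x s) is in M
  -- (identifying indices with basis vectors).
  · obtain ⟨y, hy, hyF⟩ := exists_injective_fin (S := {y | e₂ y ∈ F}) hfin (r + 1)
    have hiy : ∀ a b, i₂ (y a) ≠ y b := fun a b hab => hiso _ (hyF a) (by rw [hab]; exact hyF b)
    obtain ⟨x, hx, hix, hsep, hxy⟩ := hx y
    have hyF' : ∀ p : Fin (r + 1) × Bool,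
        e₂ (if p.2 then i₂ (y p.1) else y p.1) ∈ F ↔ p.2 = false := by
      rintro ⟨a, s⟩
      cases s
      · simpa using hyF a
      · simpa using hiso _ (hyF a)
    have key := le_card_orbits_of_form hD hi₁ hi₂ h₁ h₂ hx hy hix hiy hxy hF
      (fun s : Fin (r + 1) => flipPerm {s}) (c := fun s => flipScalar ε {s})
      (fun s p => ?_) (fun s p q => hyperbolicVector_gram_flip hi₂ hy hiy {s} p q)
      (fun s t hst => ?_)
    · omega
    · unfold flipScalar
      split_ifs
      exacts [hi₂.eps_ne, one_ne_zero, one_ne_zero]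
    · obtain ⟨M, hM, hMst⟩ := SplittingBasis.exists_separating (hsep s t hst)
      refine ⟨M, hM, ?_⟩
      have hlt : ∀ s t, s ≠ t → e₁ (x s) ∈ M → e₁ (x t) ∉ M →
          Nat.card {p : Fin (r + 1) × Bool // e₁ (if p.2 then i₁ (x p.1) else x p.1) ∈ M ∧
            (flipPerm {s} p).2 = false} <
          Nat.card {p : Fin (r + 1) × Bool // e₁ (if p.2 then i₁ (x p.1) else x p.1) ∈ M ∧
            (flipPerm {t} p).2 = false} := by
        intro s t hst hs ht
        by_cases his : e₁ (i₁ (x s)) ∈ M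
        · have hit : e₁ (i₁ (x t)) ∈ M := by
            by_contra hit
            exact h₁.not_both_and_none hD hi₁ hM hs his ht hit
          -- Both i₁ (x s) and i₁ (x t) give vectors of M. Exchanging these two contributions turns
          -- the comparison of counts into a strict inclusion, missing (s, false).
          let f : Equiv.Perm (Fin (r + 1) × Bool) := Equiv.swap (s, true) (t, true)
          rw [← Nat.card_congr (f.subtypeEquiv fun p => Iff.rfl)]
          refine card_subtype_lt (s := (s, false)) ?_ ?_ ?_
          · rintro ⟨a, b⟩ hab
            cases b
            · have hf : f (a, false) = (a, false) :=
                Equiv.swap_apply_of_ne_of_ne (by simp) (by simp)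
              rw [hf] at hab
              have hat : a ≠ t := by rintro rfl; exact ht (by simpa using hab.1)
              exact ⟨hab.1, by simp [flipPerm_apply, hat]⟩
            · by_cases hat : a = t
              · subst hat
                exact ⟨by simpa using hit, by simp [flipPerm_apply]⟩
              · by_cases has : a = s
                · subst has
                  have hf : f (a, true) = (t, true) := Equiv.swap_apply_left _ _
                  rw [hf] at hab
                  simp [flipPerm_apply, Ne.symm hat] at hab
                · have hf : f (a, true) = (a, true) :=
                    Equiv.swap_apply_of_ne_of_ne (by simp [has]) (by simp [hat])
                  rw [hf] at hab
                  simp [flipPerm_apply, has] at hab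
          · have hf : f (s, false) = (s, false) :=
              Equiv.swap_apply_of_ne_of_ne (by simp) (by simp)
            rw [hf]
            simp [flipPerm_apply]
          · exact ⟨by simpa using hs, by simp [flipPerm_apply, hst]⟩
        · refine card_subtype_lt (s := (s, false)) ?_ ?_ ?_
          · rintro ⟨a, b⟩ hab
            by_cases has : a = s
            · subst has
              cases b
              · simp [flipPerm_apply] at hab
              · exact absurd (by simpa using hab.1) his
            · cases b
              · have hat : a ≠ t := by rintro rfl; exact ht (by simpa using hab.1)
                exact ⟨hab.1, by simp [flipPerm_apply, hat]⟩
              · simp [flipPerm_apply, has] at hab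
          · simp [flipPerm_apply]
          · exact ⟨by simpa using hs, by simp [flipPerm_apply, hst]⟩
      simp only [hyF']
      rcases hMst with ⟨hs, ht⟩ | ⟨ht, hs⟩
      · exact (hlt s t hst hs ht).ne
      · exact (hlt t s hst.symm ht hs).ne'

end

end ClassicalDatum

/-! ### Finitely many orbits and two semilarge groups force one of them to be large -/

namespace ClassicalDatum

variable {V : Type u} [AddCommGroup V] [Module ℂ V]

/-- Flipping the pairs with index below s leaves exactly n - s indices on the `false` side, so the
count decreases strictly in s. -/
lemma card_flipPerm_lt {n : ℕ} {s t : Fin n} (hst : s < t) :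
    Nat.card {p : Fin n × Bool // p.2 = false ∧ (flipPerm (Set.Iio t) p).2 = false} <
      Nat.card {p : Fin n × Bool // p.2 = false ∧ (flipPerm (Set.Iio s) p).2 = false} := by
  refine card_subtype_lt (s := (s, false)) ?_ ?_ ?_
  · rintro ⟨a, b⟩ ⟨h1, h2⟩
    refine ⟨h1, ?_⟩
    have hb : b = false := h1
    subst hb
    have hat : ¬ a < t := by
      intro hat
      simp [flipPerm_apply, hat] at h2
    have has : ¬ a < s := fun h0 => hat (h0.trans hst)
    simp [flipPerm_apply, has]
  · simp [flipPerm_apply, hst]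
  · simp [flipPerm_apply]

lemma ne_of_forall_lt {n : ℕ} {p : Fin n → ℕ} (h : ∀ s t, s < t → p t < p s) {s t : Fin n}
    (hst : s ≠ t) : p s ≠ p t := by
  rcases lt_or_gt_of_ne hst with h1 | h1
  · exact (h s t h1).ne'
  · exact (h t s h1).ne

/-- Choosing elements alternatingly in a set and in its complement. -/
lemma exists_injective_bool {S B : Set ℕ} (hS : S.Infinite) (hS' : Sᶜ.Infinite) (hB : B.Finite)
    (n : ℕ) : ∃ y : Fin n × Bool → ℕ, Function.Injective y ∧ (∀ p, y p ∈ S ↔ p.2 = false) ∧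
      ∀ p, y p ∉ B := by
  obtain ⟨y₀, h1, h2⟩ := exists_injective_fin (hS.sdiff hB) n
  obtain ⟨y₁, h3, h4⟩ := exists_injective_fin (hS'.sdiff hB) n
  refine ⟨fun p => if p.2 then y₁ p.1 else y₀ p.1, ?_, ?_, ?_⟩
  · rintro ⟨a, s⟩ ⟨b, t⟩ hab
    cases s <;> cases t
    · simpa using h1 (by simpa using hab)
    · have h5 : y₀ a = y₁ b := by simpa using hab
      exact absurd (h5 ▸ (h2 a).1) (h4 b).1
    · have h5 : y₁ a = y₀ b := by simpa using hab
      exact absurd (h5 ▸ (h2 b).1) (h4 a).1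
    · simpa using h3 (by simpa using hab)
  · rintro ⟨a, s⟩
    cases s
    · simpa using (h2 a).1
    · simpa using (h4 a).1
  · rintro ⟨a, s⟩
    cases s
    · simpa using (h2 a).2
    · simpa using (h4 a).2

section

variable {D : ClassicalDatum V} {P₁ P₂ : Subgroup D.group} {e₁ e₂ : Module.Basis ℕ ℂ V}
  {I₁ I₂ : ℕ → Finset ℕ}
  [Finite (MulAction.orbitRel.Quotient D.group ((D.group ⧸ P₁) × (D.group ⧸ P₂)))]

/-- Choose r + 1 basis vectors inside and r + 1 outside each of M and F, and match them. Flipping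
the first s matches leaves r + 1 - s vectors of M sent into F, which gives r + 1 different relative
positions. -/
lemma false_of_infinite_of_none (hD : D.form = none) (h₁ : SplittingBasis D P₁ e₁ I₁)
    (h₂ : SplittingBasis D P₂ e₂ I₂) {M F : Submodule ℂ V} (hM : M ∈ invariants P₁)
    (hF : F ∈ invariants P₂) (hM1 : {j | e₁ j ∈ M}.Infinite) (hM2 : {j | e₁ j ∉ M}.Infinite)
    (hF1 : {j | e₂ j ∈ F}.Infinite) (hF2 : {j | e₂ j ∉ F}.Infinite) : False := by
  obtain ⟨r, hr⟩ : ∃ r, r = Nat.card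
    (MulAction.orbitRel.Quotient D.group ((D.group ⧸ P₁) × (D.group ⧸ P₂))) := ⟨_, rfl⟩
  obtain ⟨y, hy, hyF, -⟩ := exists_injective_bool (S := {j | e₂ j ∈ F}) hF1 hF2
    Set.finite_empty (r + 1)
  obtain ⟨B, hB⟩ := exists_far h₁.adm h₂.adm (Finset.univ.image y)
  obtain ⟨x, hx, hxM, hxB⟩ := exists_injective_bool (S := {j | e₁ j ∈ M}) hM1 hM2
    B.finite_toSet (r + 1)
  have key := le_card_orbits_of_none hD h₁ h₂ hx hy
    (fun a b => hB (x a) (hxB a) (y b) (Finset.mem_image_of_mem y (Finset.mem_univ b))) hF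
    (fun s : Fin (r + 1) => flipPerm (Set.Iio s)) fun s t hst => ⟨M, hM, ?_⟩
  · omega
  · have h1 : ∀ p, e₁ (x p) ∈ M ↔ p.2 = false := hxM
    have h2 : ∀ p, e₂ (y p) ∈ F ↔ p.2 = false := hyF
    simp only [h1, h2]
    exact ne_of_forall_lt (fun s t hst => card_flipPerm_lt hst) hst

variable {ω : LinearMap.BilinForm ℂ V} {ε : ℂ} {i₁ i₂ : ℕ → ℕ}

omit [Finite (MulAction.orbitRel.Quotient D.group ((D.group ⧸ P₁) × (D.group ⧸ P₂)))] in
/-- An invariant subspace of infinite dimension and codimension contains exactly one member of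
infinitely many hyperbolic pairs. -/
lemma SplittingBasis.infinite_setOf_single (hD : D.form = some ω)
    (hi₁ : IsotropicBasis ω ε e₁ i₁) (h₁ : SplittingBasis D P₁ e₁ I₁) {M : Submodule ℂ V}
    (hM : M ∈ invariants P₁) (hM1 : {j | e₁ j ∈ M}.Infinite) (hM2 : {j | e₁ j ∉ M}.Infinite) :
    {j | e₁ j ∈ M ∧ e₁ (i₁ j) ∉ M}.Infinite := by
  intro hfin
  have hinj : Function.Injective i₁ := fun a b hab => by rw [← hi₁.invol a, hab, hi₁.invol]
  -- Were single pairs finite in number, some pair would lie entirely in M and another entirely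
  -- outside.
  obtain ⟨l, hl, hl'⟩ := (hM1.sdiff hfin).nonempty
  obtain ⟨m, hm, hm'⟩ := (hM2.sdiff (hfin.preimage hinj.injOn)).nonempty
  have hlM : e₁ l ∈ M := hl
  have hmM : e₁ m ∉ M := hm
  refine h₁.not_both_and_none hD hi₁ hM (l := l) (m := m) hlM ?_ hmM fun h0 => ?_
  · by_contra h0
    exact hl' ⟨hlM, h0⟩
  · refine hm' ⟨h0, ?_⟩
    rwa [hi₁.invol]

/-- The count of `false_of_infinite_of_none`, with hyperbolic pairs of which M and F contain exactly
one member; flips of such pairs are isometric after rescaling. -/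
lemma false_of_infinite_of_form (hD : D.form = some ω) (hi₁ : IsotropicBasis ω ε e₁ i₁)
    (hi₂ : IsotropicBasis ω ε e₂ i₂) (h₁ : SplittingBasis D P₁ e₁ I₁)
    (h₂ : SplittingBasis D P₂ e₂ I₂) {M F : Submodule ℂ V} (hM : M ∈ invariants P₁)
    (hF : F ∈ invariants P₂) (hM1 : {j | e₁ j ∈ M}.Infinite) (hM2 : {j | e₁ j ∉ M}.Infinite)
    (hF1 : {j | e₂ j ∈ F}.Infinite) (hF2 : {j | e₂ j ∉ F}.Infinite) : False := by
  obtain ⟨r, hr⟩ : ∃ r, r = Nat.card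
    (MulAction.orbitRel.Quotient D.group ((D.group ⧸ P₁) × (D.group ⧸ P₂))) := ⟨_, rfl⟩
  have hi1inj : Function.Injective i₁ := fun a b hab => by rw [← hi₁.invol a, hab, hi₁.invol]
  obtain ⟨y, hy, hyF⟩ := exists_injective_fin (h₂.infinite_setOf_single hD hi₂ hF hF1 hF2) (r + 1)
  obtain ⟨B, hB⟩ := exists_far_pairs h₁ h₂ i₁ i₂ y
  obtain ⟨x, hx, hxM⟩ := exists_injective_fin
    ((h₁.infinite_setOf_single hD hi₁ hM hM1 hM2).sdiff
      (B.finite_toSet.union (B.finite_toSet.preimage hi1inj.injOn))) (r + 1)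
  have hiy : ∀ a b, i₂ (y a) ≠ y b := fun a b hab => by
    have h1 := (hyF a).2
    rw [hab] at h1
    exact h1 (hyF b).1
  have hix : ∀ a b, i₁ (x a) ≠ x b := fun a b hab => by
    have h1 := (hxM a).1.2
    rw [hab] at h1
    exact h1 (hxM b).1.1
  have key := le_card_orbits_of_form hD hi₁ hi₂ h₁ h₂ hx hy hix hiy
    (fun a b s t => hB _ (fun h0 => (hxM a).2 (Or.inl h0)) (fun h0 => (hxM a).2 (Or.inr h0)) b s t) hF
    (fun s : Fin (r + 1) => flipPerm (Set.Iio s)) (c := fun s => flipScalar ε (Set.Iio s))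
    (fun s p => ?_) (fun s p q => hyperbolicVector_gram_flip hi₂ hy hiy (Set.Iio s) p q)
    fun s t hst => ⟨M, hM, ?_⟩
  · omega
  · unfold flipScalar
    split_ifs
    exacts [hi₂.eps_ne, one_ne_zero, one_ne_zero]
  · have h1 : ∀ p : Fin (r + 1) × Bool,
        e₁ (if p.2 then i₁ (x p.1) else x p.1) ∈ M ↔ p.2 = false := by
      rintro ⟨a, b⟩
      cases b
      · simpa using (hxM a).1.1
      · simpa using (hxM a).1.2
    have h2 : ∀ p : Fin (r + 1) × Bool,
        e₂ (if p.2 then i₂ (y p.1) else y p.1) ∈ F ↔ p.2 = false := by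
      rintro ⟨a, b⟩
      cases b
      · simpa using (hyF a).1
      · simpa using (hyF a).2
    simp only [h1, h2]
    exact ne_of_forall_lt (fun s t hst => card_flipPerm_lt hst) hst

lemma isSemilarge_of_finite (h₁ : SplittingBasis D P₁ e₁ I₁)
    (h₂ : SplittingBasis D P₂ e₂ I₂) (hP₂ : P₂ ≠ ⊤) : D.IsSemilarge P₁ := by
  rcases hD : D.form with _ | ω
  · exact isSemilarge_of_none hD h₁ h₂ hP₂
  · obtain ⟨ε, hε⟩ := exists_isotropicBasis hD
    obtain ⟨i₁, hi₁⟩ := hε e₁ h₁.adm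
    obtain ⟨i₂, hi₂⟩ := hε e₂ h₂.adm
    exact isSemilarge_of_form hD hi₁ hi₂ h₁ h₂ hP₂

lemma isLarge_or_isLarge_of_finite (h₁ : SplittingBasis D P₁ e₁ I₁)
    (h₂ : SplittingBasis D P₂ e₂ I₂) (hP₁ : D.IsSemilarge P₁) (hP₂ : D.IsSemilarge P₂) :
    D.IsLarge P₁ ∨ D.IsLarge P₂ := by
  by_contra! hcon
  obtain ⟨hl₁, hl₂⟩ := hcon
  have hM : ∃ M ∈ invariants P₁, {j | e₁ j ∈ M}.Infinite ∧ {j | e₁ j ∉ M}.Infinite := by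
    by_contra! h0
    refine hl₁ (h₁.isLarge hP₁ fun M hM => ?_)
    by_cases hfin : {j | e₁ j ∈ M}.Finite
    · exact Or.inl hfin
    · exact Or.inr (h0 M hM hfin)
  have hF : ∃ F ∈ invariants P₂, {j | e₂ j ∈ F}.Infinite ∧ {j | e₂ j ∉ F}.Infinite := by
    by_contra! h0
    refine hl₂ (h₂.isLarge hP₂ fun M hM => ?_)
    by_cases hfin : {j | e₂ j ∈ M}.Finite
    · exact Or.inl hfin
    · exact Or.inr (h0 M hM hfin)
  obtain ⟨M, hM, hM1, hM2⟩ := hM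
  obtain ⟨F, hF, hF1, hF2⟩ := hF
  rcases hD : D.form with _ | ω
  · exact false_of_infinite_of_none hD h₁ h₂ hM hF hM1 hM2 hF1 hF2
  · obtain ⟨ε, hε⟩ := exists_isotropicBasis hD
    obtain ⟨i₁, hi₁⟩ := hε e₁ h₁.adm
    obtain ⟨i₂, hi₂⟩ := hε e₂ h₂.adm
    exact false_of_infinite_of_form hD hi₁ hi₂ h₁ h₂ hM hF hM1 hM2 hF1 hF2

end

end ClassicalDatum

/-! ### Gaussian elimination of isotropic flags -/

namespace ClassicalDatum

section Lists

variable {Y : Type*} [AddCommGroup Y] [Module ℂ Y]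

/-- The span of the members of a list. -/
def listSpan (l : List Y) : Submodule ℂ Y := Submodule.span ℂ {x | x ∈ l}

lemma listSpan_nil : listSpan ([] : List Y) = ⊥ := by simp [listSpan]

lemma listSpan_cons (v : Y) (l : List Y) :
    listSpan (v :: l) = Submodule.span ℂ {v} ⊔ listSpan l := by
  rw [listSpan, listSpan, ← Submodule.span_union]
  congr 1
  ext x
  simp

lemma map_listSpan (f : Y →ₗ[ℂ] Y) (l : List Y) : (listSpan l).map f = listSpan (l.map f) := by
  rw [listSpan, listSpan, Submodule.map_span]
  congr 1
  ext x
  simp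

lemma sup_listSpan_map {b : Y} {f : Y → Y} (hf : ∀ y, f y - y ∈ Submodule.span ℂ {b})
    (l : List Y) :
    Submodule.span ℂ {b} ⊔ listSpan (l.map f) = Submodule.span ℂ {b} ⊔ listSpan l := by
  apply le_antisymm
  · refine sup_le le_sup_left (Submodule.span_le.2 ?_)
    intro x hx
    obtain ⟨y, hy, rfl⟩ := List.mem_map.1 hx
    have h1 : f y = (f y - y) + y := by abel
    rw [h1]
    exact Submodule.add_mem_sup (hf y) (Submodule.subset_span hy)
  · refine sup_le le_sup_left (Submodule.span_le.2 ?_)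
    intro y hy
    have h1 : y = -(f y - y) + f y := by abel
    rw [h1]
    exact Submodule.add_mem_sup (Submodule.neg_mem _ (hf y))
      (Submodule.subset_span (List.mem_map.2 ⟨y, hy, rfl⟩))

/-- Concatenating spanning lists of successive members realizes the chain by initial segments of one
list; linear independence is not required. -/
lemma exists_list_of_chain {F : ℕ → Submodule ℂ Y} (hF : Monotone F) (hfin : ∀ k, (F k).FG)
    (n : ℕ) : ∃ l : List Y, (∀ v ∈ l, v ∈ F n) ∧
      ∀ k ≤ n, ∃ t ≤ l.length, listSpan (l.take t) = F k := by
  have hlist : ∀ k, ∃ l : List Y, listSpan l = F k := fun k => by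
    obtain ⟨s, hs⟩ := hfin k
    refine ⟨s.toList, ?_⟩
    rw [← hs, listSpan]
    congr 1
    ext x
    simp
  induction n with
  | zero =>
    obtain ⟨l, hl⟩ := hlist 0
    refine ⟨l, fun v hv => hl ▸ Submodule.subset_span hv, fun k hk => ⟨l.length, le_rfl, ?_⟩⟩
    rw [List.take_length, hl, Nat.le_zero.1 hk]
  | succ n ih =>
    obtain ⟨l, hl1, hl2⟩ := ih
    obtain ⟨l', hl'⟩ := hlist (n + 1)
    have hmem : ∀ v ∈ l ++ l', v ∈ F (n + 1) := fun v hv => by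
      rcases List.mem_append.1 hv with h | h
      · exact hF (Nat.le_succ n) (hl1 v h)
      · exact hl' ▸ Submodule.subset_span h
    refine ⟨l ++ l', hmem, fun k hk => ?_⟩
    rcases Nat.lt_or_eq_of_le hk with h | rfl
    · obtain ⟨t, ht, ht'⟩ := hl2 k (Nat.lt_succ_iff.1 h)
      refine ⟨t, ht.trans (by simp), ?_⟩
      rw [List.take_append_of_le_length ht, ht']
    · refine ⟨_, le_rfl, ?_⟩
      rw [List.take_length]
      refine le_antisymm (Submodule.span_le.2 hmem) ?_
      rw [← hl']
      exact Submodule.span_mono fun v hv => List.mem_append.2 (Or.inr hv)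

end Lists

variable {V : Type u} [AddCommGroup V] [Module ℂ V]

section Elimination

variable {D : ClassicalDatum V} {Y : Type*} [AddCommGroup Y] [Module ℂ Y] {T : Type*}

/-- A family of groups acting on a space with a distinguished family of vectors, rich enough to
bring isotropic flags into a normal form. -/
structure EliminationData (S : Set ℕ → Subgroup D.group) (i : ℕ → ℕ)
    (ρ : D.group → Y →ₗ[ℂ] Y) (Y₀ : Submodule ℂ Y) (b : ℕ → Y) (bs : ℕ → Y →ₗ[ℂ] ℂ)
    (B : Y →ₗ[ℂ] Y →ₗ[ℂ] ℂ) (τ : ℕ → T) (good : ℕ → Prop) (le : ℕ → ℕ → Prop) : Prop where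
  invol : ∀ j, i (i j) = j
  map_one : ∀ y, ρ 1 y = y
  map_mul : ∀ p q y, ρ (p * q) y = ρ p (ρ q y)
  mono : ∀ {R R'}, R' ⊆ R → S R' ≤ S R
  fix_left : ∀ {R p}, p ∈ S R → ∀ l ∉ R, ρ p (b l) = b l
  fix_right : ∀ {R p}, p ∈ S R → ∀ l ∉ R, ∀ y, bs l (ρ p y) = bs l y
  biorth : ∀ l j, bs l (b j) = if j = l then 1 else 0
  mem : ∀ j, b j ∈ Y₀
  map_mem : ∀ p, ∀ y ∈ Y₀, ρ p y ∈ Y₀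
  isometry : ∀ p x y, B (ρ p x) (ρ p y) = B x y
  perp : ∀ j y, B (b j) y = 0 → i j ≠ j → bs (i j) y = 0
  transvection : ∀ R : Set ℕ, (∀ l ∈ R, i l ∈ R) → ∀ y ∈ Y₀, (∀ l ∉ R, bs l y = 0) → B y y = 0 →
    ∀ k, bs k y ≠ 0 → good k → (∀ l, bs l y ≠ 0 → le l k) →
      ∃ p ∈ S R, ∃ c : ℂ, c ≠ 0 ∧ ρ p y = c • b k
  max : ∀ y ∈ Y₀, y ≠ 0 → B y y = 0 → ∃ k, good k ∧ bs k y ≠ 0 ∧ ∀ l, bs l y ≠ 0 → le l k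
  le_of_eq : ∀ j k, τ j = τ k → le j k
  good_of_eq : ∀ j k, τ j = τ k → good j → good k
  isotropic : ∀ j k, τ j = τ k → good j → j ≠ k → B (b j + b k) (b j + b k) = 0

/-- The canonical index of type `t` in `R`. -/
noncomputable def canonicalIndex (τ : ℕ → T) (R : Set ℕ) (t : T) : ℕ :=
  Classical.epsilon fun y => y ∈ R ∧ τ y = t

/-- The indices remaining after removing the canonical pairs of prescribed types. -/
noncomputable def remaining (i : ℕ → ℕ) (τ : ℕ → T) : Set ℕ → List (Option T) → Set ℕ
  | R, [] => R
  | R, none :: ts => remaining i τ R ts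
  | R, some t :: ts =>
    remaining i τ (R \ {canonicalIndex τ R t, i (canonicalIndex τ R t)}) ts

/-- The list of canonical vectors of prescribed types. -/
noncomputable def normalList (i : ℕ → ℕ) (τ : ℕ → T) (b : ℕ → Y) :
    Set ℕ → List (Option T) → List Y
  | _, [] => []
  | R, none :: ts => 0 :: normalList i τ b R ts
  | R, some t :: ts => b (canonicalIndex τ R t) ::
    normalList i τ b (R \ {canonicalIndex τ R t, i (canonicalIndex τ R t)}) ts

lemma remaining_subset (i : ℕ → ℕ) (τ : ℕ → T) (R : Set ℕ) (ts : List (Option T)) :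
    remaining i τ R ts ⊆ R := by
  induction ts generalizing R with
  | nil => exact subset_rfl
  | cons t ts ih =>
    cases t with
    | none => exact ih R
    | some t => exact (ih _).trans Set.sdiff_subset

omit [Module ℂ Y] in
lemma mem_normalList (i : ℕ → ℕ) (τ : ℕ → T) (b : ℕ → Y) (R : Set ℕ) (ts : List (Option T))
    {w : Y} (hw : w ∈ normalList i τ b R ts) : w = 0 ∨ ∃ j ∉ remaining i τ R ts, w = b j := by
  induction ts generalizing R with
  | nil => simp [normalList] at hw
  | cons t ts ih =>
    cases t with
    | none =>
      rcases List.mem_cons.1 hw with h | h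
      · exact Or.inl h
      · exact ih R h
    | some t =>
      rcases List.mem_cons.1 hw with h | h
      · refine Or.inr ⟨_, fun h0 => ?_, h⟩
        exact (remaining_subset i τ _ ts h0).2 (by simp)
      · exact ih _ h

namespace EliminationData

variable {S : Set ℕ → Subgroup D.group} {i : ℕ → ℕ}
  {ρ : D.group → Y →ₗ[ℂ] Y} {Y₀ : Submodule ℂ Y} {b : ℕ → Y} {bs : ℕ → Y →ₗ[ℂ] ℂ}
  {B : Y →ₗ[ℂ] Y →ₗ[ℂ] ℂ} {τ : ℕ → T} {good : ℕ → Prop} {le : ℕ → ℕ → Prop}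

lemma inv_apply (h : EliminationData S i ρ Y₀ b bs B τ good le) (p : D.group) (y : Y) :
    ρ p⁻¹ (ρ p y) = y := by
  rw [← h.map_mul, inv_mul_cancel, h.map_one]

/-- An isotropic vector can be moved to a multiple of a canonical one. -/
lemma exists_step (h : EliminationData S i ρ Y₀ b bs B τ good le) {R : Set ℕ}
    (hR : ∀ l ∈ R, i l ∈ R) {y : Y} (hy : y ∈ Y₀) (hyR : ∀ l ∉ R, bs l y = 0) (hB : B y y = 0)
    (hy0 : y ≠ 0) : ∃ t, canonicalIndex τ R t ∈ R ∧
      ∃ p ∈ S R, ∃ c : ℂ, c ≠ 0 ∧ ρ p y = c • b (canonicalIndex τ R t) := by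
  obtain ⟨k, hkg, hk0, hkle⟩ := h.max y hy hy0 hB
  have hkR : k ∈ R := by
    by_contra h0
    exact hk0 (hyR k h0)
  obtain ⟨p₁, hp₁, c₁, hc₁, hpc₁⟩ := h.transvection R hR y hy hyR hB k hk0 hkg hkle
  have hj : canonicalIndex τ R (τ k) ∈ R ∧ τ (canonicalIndex τ R (τ k)) = τ k :=
    Classical.epsilon_spec (p := fun y => y ∈ R ∧ τ y = τ k) ⟨k, hkR, rfl⟩
  refine ⟨τ k, hj.1, ?_⟩
  obtain ⟨j, hjdef⟩ : ∃ j, j = canonicalIndex τ R (τ k) := ⟨_, rfl⟩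
  rw [← hjdef] at hj ⊢
  -- When j ≠ k have the same type, b k + b j is isotropic and either index is highest in it. It can
  -- thus be reduced to a multiple of b k as well as to one of b j, and composing one reduction with
  -- the inverse of the other moves b k to a multiple of b j.
  by_cases hjk : j = k
  · exact ⟨p₁, hp₁, c₁, hc₁, by rw [hpc₁, hjk]⟩
  have hmem : b k + b j ∈ Y₀ := Y₀.add_mem (h.mem k) (h.mem j)
  have hout : ∀ l ∉ R, bs l (b k + b j) = 0 := fun l hl => by
    have h1 : k ≠ l := fun h0 => hl (h0 ▸ hkR)
    have h2 : j ≠ l := fun h0 => hl (h0 ▸ hj.1)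
    simp [h.biorth, h1, h2]
  have hiso := h.isotropic k j hj.2.symm hkg (Ne.symm hjk)
  have hsupp : ∀ l, bs l (b k + b j) ≠ 0 → l = k ∨ l = j := fun l hl => by
    by_contra! h0
    exact hl (by simp [h.biorth, Ne.symm h0.1, Ne.symm h0.2])
  obtain ⟨p₂, hp₂, c₂, hc₂, hpc₂⟩ := h.transvection R hR _ hmem hout hiso k
    (by simp [h.biorth, hjk]) hkg (fun l hl => by
      rcases hsupp l hl with rfl | rfl
      · exact h.le_of_eq _ _ rfl
      · exact h.le_of_eq _ _ hj.2)
  obtain ⟨p₃, hp₃, c₃, hc₃, hpc₃⟩ := h.transvection R hR _ hmem hout hiso j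
    (by simp [h.biorth, Ne.symm hjk]) (h.good_of_eq _ _ hj.2.symm hkg) (fun l hl => by
      rcases hsupp l hl with rfl | rfl
      · exact h.le_of_eq _ _ hj.2.symm
      · exact h.le_of_eq _ _ rfl)
  refine ⟨p₃ * (p₂⁻¹ * p₁), mul_mem hp₃ (mul_mem (inv_mem hp₂) hp₁), c₁ * (c₂⁻¹ * c₃),
    mul_ne_zero hc₁ (mul_ne_zero (inv_ne_zero hc₂) hc₃), ?_⟩
  have h1 : ρ p₂⁻¹ (b k) = c₂⁻¹ • (b k + b j) := by
    rw [← h.inv_apply p₂ (b k + b j), hpc₂, _root_.map_smul, smul_smul, inv_mul_cancel₀ hc₂,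
      one_smul]
  rw [h.map_mul, h.map_mul, hpc₁, _root_.map_smul, _root_.map_smul, h1, _root_.map_smul, hpc₃,
    smul_smul, smul_smul, mul_assoc]

/-- An isotropic flag can be brought into normal form. -/
lemma exists_normalList (h : EliminationData S i ρ Y₀ b bs B τ good le) (vs : List Y) {R : Set ℕ}
    (hR : ∀ l ∈ R, i l ∈ R) (hY : ∀ v ∈ vs, v ∈ Y₀) (hvR : ∀ v ∈ vs, ∀ l ∉ R, bs l v = 0)
    (hB : ∀ v ∈ vs, ∀ w ∈ vs, B v w = 0) :
    ∃ p ∈ S R, ∃ ts : List (Option T), ts.length = vs.length ∧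
      ∀ n, (listSpan (vs.take n)).map (ρ p) = listSpan ((normalList i τ b R ts).take n) := by
  obtain ⟨N, hN⟩ : ∃ N, vs.length = N := ⟨_, rfl⟩
  induction N generalizing vs R with
  | zero =>
    obtain rfl := List.length_eq_zero_iff.1 hN
    exact ⟨1, one_mem _, [], rfl, fun n => by simp [normalList, listSpan_nil]⟩
  | succ N ih =>
    obtain ⟨v, vs, rfl⟩ := List.exists_cons_of_length_eq_add_one hN
    have hN' : vs.length = N := by simpa using hN
    -- Vectors may be zero, initially or after earlier reductions. The entry `none` records them, so
    -- that initial segments keep their length.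
    by_cases hv0 : v = 0
    · obtain ⟨p, hp, ts, hts, hpts⟩ := ih vs hR (fun w hw => hY w (List.mem_cons_of_mem _ hw))
        (fun w hw => hvR w (List.mem_cons_of_mem _ hw))
        (fun w hw w' hw' => hB w (List.mem_cons_of_mem _ hw) w' (List.mem_cons_of_mem _ hw')) hN'
      refine ⟨p, hp, none :: ts, by simp [hts], fun n => ?_⟩
      cases n with
      | zero => simp [listSpan_nil]
      | succ n =>
        rw [normalList, List.take_succ_cons, List.take_succ_cons, listSpan_cons, listSpan_cons,
          Submodule.map_sup, hpts n, hv0]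
        simp
    · obtain ⟨t, htR, p₁, hp₁, c, hc, hpc⟩ := h.exists_step hR (hY v List.mem_cons_self)
        (hvR v List.mem_cons_self) (hB v List.mem_cons_self v List.mem_cons_self) hv0
      obtain ⟨j, hj⟩ : ∃ j, j = canonicalIndex τ R t := ⟨_, rfl⟩
      rw [← hj] at htR hpc
      have hbj : b j = c⁻¹ • ρ p₁ v := by rw [hpc, smul_smul, inv_mul_cancel₀ hc, one_smul]
      have hBl : ∀ w ∈ v :: vs, B (b j) (ρ p₁ w) = 0 := fun w hw => by
        rw [hbj, _root_.map_smul, LinearMap.smul_apply, h.isometry, hB v List.mem_cons_self w hw,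
          smul_zero]
      have hBr : ∀ w ∈ v :: vs, B (ρ p₁ w) (b j) = 0 := fun w hw => by
        rw [hbj, _root_.map_smul, h.isometry, hB w hw v List.mem_cons_self, smul_zero]
      have hBj : B (b j) (b j) = 0 := by
        have h1 := hBr v List.mem_cons_self
        rw [hpc, _root_.map_smul, LinearMap.smul_apply, smul_eq_mul] at h1
        exact (mul_eq_zero.1 h1).resolve_left hc
      -- The remaining vectors are made free of b j; this changes no span that already contains b j.
      let red : Y → Y := fun y => ρ p₁ y - bs j (ρ p₁ y) • b j
      let R' : Set ℕ := R \ {j, i j}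
      have hR' : ∀ l ∈ R', i l ∈ R' := by
        rintro l ⟨hl, hl'⟩
        refine ⟨hR l hl, ?_⟩
        simp only [Set.mem_insert_iff, Set.mem_singleton_iff, not_or] at hl' ⊢
        exact ⟨fun h0 => hl'.2 (by rw [← h0, h.invol]),
          fun h0 => hl'.1 (by rw [← h.invol l, h0, h.invol])⟩
      have hjR' : j ∉ R' := fun h0 => h0.2 (by simp)
      obtain ⟨p₂, hp₂, ts, hts, hpts⟩ := ih (vs.map red) (R := R') hR' (by
          intro w hw
          obtain ⟨y, hy, rfl⟩ := List.mem_map.1 hw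
          exact Y₀.sub_mem (h.map_mem _ _ (hY y (List.mem_cons_of_mem _ hy)))
            (Y₀.smul_mem _ (h.mem j))) (by
          intro w hw l hl
          obtain ⟨y, hy, rfl⟩ := List.mem_map.1 hw
          have hy' := List.mem_cons_of_mem v hy
          change bs l (ρ p₁ y - bs j (ρ p₁ y) • b j) = 0
          rw [map_sub, _root_.map_smul, h.biorth]
          by_cases hlj : j = l
          · subst hlj; simp
          · rw [if_neg hlj, smul_zero, sub_zero]
            -- Coordinates outside R are preserved by p₁, and the one at i j vanishes because the
            -- flag is isotropic. The reduced vectors thus live on R with the pair of j removed.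
            by_cases hlR : l ∈ R
            · have hlij : l = i j := by
                by_contra h0
                refine hl ⟨hlR, ?_⟩
                simp [h0, Ne.symm hlj]
              subst hlij
              exact h.perp j _ (hBl y hy') (Ne.symm hlj)
            · rw [h.fix_right hp₁ l hlR]
              exact hvR y hy' l hlR) (by
          intro w hw w' hw'
          obtain ⟨y, hy, rfl⟩ := List.mem_map.1 hw
          obtain ⟨y', hy', rfl⟩ := List.mem_map.1 hw'
          have h1 := hBr y (List.mem_cons_of_mem v hy)
          have h2 := hBl y' (List.mem_cons_of_mem v hy')
          have h3 := hB y (List.mem_cons_of_mem v hy) y' (List.mem_cons_of_mem v hy')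
          simp [red, h1, h2, h3, hBj, h.isometry]) (by simpa using hN')
      refine ⟨p₂ * p₁, mul_mem (h.mono Set.sdiff_subset hp₂) hp₁, some t :: ts,
        by simpa using hts, fun n => ?_⟩
      cases n with
      | zero => simp [listSpan_nil]
      | succ n =>
        have hcomp : ρ (p₂ * p₁) = ρ p₂ ∘ₗ ρ p₁ := by
          ext y; exact h.map_mul _ _ _
        have hspan : (Submodule.span ℂ {v}).map (ρ p₁) = Submodule.span ℂ {b j} := by
          rw [Submodule.map_span, Set.image_singleton, hpc]
          exact Submodule.span_singleton_smul_eq (IsUnit.mk0 c hc) _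
        have hred : Submodule.span ℂ {b j} ⊔ listSpan ((vs.map red).take n) =
            Submodule.span ℂ {b j} ⊔ listSpan ((vs.take n).map (ρ p₁)) := by
          have h1 : (vs.map red).take n =
              ((vs.take n).map (ρ p₁)).map fun y => y - bs j y • b j := by
            rw [← List.map_take, List.map_map]
            rfl
          rw [h1]
          refine sup_listSpan_map (fun y => ?_) _
          have h2 : y - bs j y • b j - y = (-bs j y) • b j := by rw [neg_smul]; abel
          rw [h2]
          exact Submodule.smul_mem _ _ (Submodule.mem_span_singleton_self _)
        rw [normalList, List.take_succ_cons, List.take_succ_cons, listSpan_cons, listSpan_cons,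
          ← hj, hcomp, Submodule.map_comp, Submodule.map_sup, hspan, map_listSpan (ρ p₁), ← hred,
          Submodule.map_sup, hpts n, Submodule.map_span, Set.image_singleton,
          h.fix_left hp₂ j hjR']

end EliminationData

end Elimination

end ClassicalDatum

/-! ### Elimination for vectors, for linear forms, and for isotropic vectors -/

namespace ClassicalDatum

variable {V : Type u} [AddCommGroup V] [Module ℂ V]

/-- The elements of `P` that act trivially in the directions outside `R`. -/
def supportedSubgroup {D : ClassicalDatum V} (P : Subgroup D.group) (e : Module.Basis ℕ ℂ V)
    (R : Set ℕ) : Subgroup D.group where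
  carrier := {p | p ∈ P ∧ ∀ l ∉ R, p.1 (e l) = e l ∧ ∀ x, e.repr (p.1 x) l = e.repr x l}
  one_mem' := ⟨one_mem _, fun _ _ => ⟨rfl, fun _ => rfl⟩⟩
  mul_mem' := by
    rintro a b ⟨ha, ha'⟩ ⟨hb, hb'⟩
    refine ⟨mul_mem ha hb, fun l hl => ⟨?_, fun x => ?_⟩⟩
    · change a.1 (b.1 (e l)) = e l
      rw [(hb' l hl).1, (ha' l hl).1]
    · change e.repr (a.1 (b.1 x)) l = e.repr x l
      rw [(ha' l hl).2, (hb' l hl).2]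
  inv_mem' := by
    rintro a ⟨ha, ha'⟩
    refine ⟨inv_mem ha, fun l hl => ⟨?_, fun x => ?_⟩⟩
    · change a.1.symm (e l) = e l
      rw [LinearEquiv.symm_apply_eq, (ha' l hl).1]
    · change e.repr (a.1.symm x) l = e.repr x l
      rw [← (ha' l hl).2, a.1.apply_symm_apply]

/-- The position of `e x` with respect to the invariants of `P` and to the involution `i`. -/
noncomputable def basisType {D : ClassicalDatum V} (P : Subgroup D.group)
    (e : Module.Basis ℕ ℂ V) (i : ℕ → ℕ) (x : ℕ) : Set (invariants P) × Bool × Bool :=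
  ({M | e x ∈ M.1}, decide (x < i x), decide (i x < x))

lemma below_of_basisType_eq {D : ClassicalDatum V} {P : Subgroup D.group}
    {e : Module.Basis ℕ ℂ V} {i : ℕ → ℕ} {j k : ℕ}
    (h : basisType P e i j = basisType P e i k) : Below P e j k := by
  intro M hM hk
  have h1 : (⟨M, hM⟩ : invariants P) ∈ (basisType P e i j).1 := by
    rw [h]; exact hk
  exact h1

lemma Below.trans {D : ClassicalDatum V} {P : Subgroup D.group} {e : Module.Basis ℕ ℂ V}
    {j k l : ℕ} (h : Below P e j k) (h' : Below P e k l) : Below P e j l :=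
  fun M hM hl => h M hM (h' M hM hl)

lemma Below.refl {D : ClassicalDatum V} {P : Subgroup D.group} {e : Module.Basis ℕ ℂ V}
    (j : ℕ) : Below P e j j := fun _ _ h => h

/-- An index is high for `Below` when few invariants contain its basis vector, so a minimal set of
such invariants gives a maximal index. -/
lemma exists_maximal_below {D : ClassicalDatum V} (P : Subgroup D.group)
    (e : Module.Basis ℕ ℂ V) {s : Set ℕ} (hs : s.Finite) (hne : s.Nonempty) :
    ∃ k ∈ s, ∀ l ∈ s, Below P e k l → Below P e l k := by
  obtain ⟨k, hk, hk'⟩ := hs.exists_minimalFor (fun k => {M | M ∈ invariants P ∧ e k ∈ M}) s hne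
  refine ⟨k, hk, fun l hl hkl M hM hkM => ?_⟩
  exact (hk' hl (fun N hN => ⟨hN.1, hkl N hN.1 hN.2⟩) ⟨hM, hkM⟩).2

lemma exists_minimal_below {D : ClassicalDatum V} (P : Subgroup D.group)
    (e : Module.Basis ℕ ℂ V) {s : Set ℕ} (hs : s.Finite) (hne : s.Nonempty) :
    ∃ k ∈ s, ∀ l ∈ s, Below P e l k → Below P e k l := by
  obtain ⟨k, hk, hk'⟩ := hs.exists_maximalFor (fun k => {M | M ∈ invariants P ∧ e k ∈ M}) s hne
  refine ⟨k, hk, fun l hl hkl M hM hkM => ?_⟩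
  exact (hk' hl (fun N hN => ⟨hN.1, hkl N hN.1 hN.2⟩) ⟨hM, hkM⟩).2

lemma finite_setOf_repr_ne (e : Module.Basis ℕ ℂ V) (y : V) : {l | e.repr y l ≠ 0}.Finite :=
  (e.repr y).support.finite_toSet.subset fun _ hl => Finsupp.mem_support_iff.2 hl

lemma exists_repr_ne (e : Module.Basis ℕ ℂ V) {y : V} (hy : y ≠ 0) : ∃ l, e.repr y l ≠ 0 := by
  by_contra! h
  exact hy (e.repr.map_eq_zero_iff.1 (Finsupp.ext h))

lemma repr_basis (e : Module.Basis ℕ ℂ V) (l j : ℕ) :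
    e.coord l (e j) = if j = l then 1 else 0 := by
  simp [Finsupp.single_apply]

/-- A dilatransvection preserving the invariants of `P` and supported in `R`. -/
lemma SplittingBasis.exists_dilatransvection {D : ClassicalDatum V} {P : Subgroup D.group}
    {e : Module.Basis ℕ ℂ V} {I : ℕ → Finset ℕ} (h : SplittingBasis D P e I)
    (hD : D.form = none) {R : Set ℕ} {f : Module.Dual ℂ V} (hf : f ∈ D.dualSpace) {w : V}
    (hw : 1 + f w ≠ 0) (hfR : ∀ l ∉ R, f (e l) = 0) (hwR : ∀ l ∉ R, e.repr w l = 0)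
    (hfw : ∀ l, f (e l) ≠ 0 → ∀ M ∈ invariants P, e l ∈ M → w ∈ M) :
    ∃ p ∈ supportedSubgroup P e R, ∀ x, p.1 x = x + f x • w := by
  obtain ⟨g, hg⟩ := ClassicalDatum.exists_dilatransvection hD hf hw
  refine ⟨g, ⟨h.mem_of_invariants fun M hM x hx => ?_, fun l hl => ⟨?_, fun x => ?_⟩⟩, hg⟩
  · refine (h.isCoordinate hM).map_le (f := (g.1 : V →ₗ[ℂ] V)) (fun l hl => ?_) hx
    change g.1 (e l) ∈ M
    rw [hg]
    by_cases h0 : f (e l) = 0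
    · simpa [h0] using hl
    · exact M.add_mem hl (M.smul_mem _ (hfw l h0 M hM hl))
  · simp [hg, hfR l hl]
  · simp [hg, hwR l hl]

section TypeA

variable {D : ClassicalDatum V} {P : Subgroup D.group} {e : Module.Basis ℕ ℂ V} {I : ℕ → Finset ℕ}

/-- Elimination of vectors in type A. -/
lemma SplittingBasis.eliminationData_of_none (h : SplittingBasis D P e I) (hD : D.form = none) :
    EliminationData (supportedSubgroup P e) id (fun p => (p.1 : V →ₗ[ℂ] V)) ⊤ e e.coord 0
      (basisType P e id) (fun _ => True) (Below P e) where
  invol _ := rfl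
  map_one _ := rfl
  map_mul _ _ _ := rfl
  mono hR _ hp := ⟨hp.1, fun l hl => hp.2 l fun h0 => hl (hR h0)⟩
  fix_left hp l hl := (hp.2 l hl).1
  fix_right hp l hl := (hp.2 l hl).2
  biorth := repr_basis e
  mem _ := trivial
  map_mem _ _ _ := trivial
  isometry _ _ _ := rfl
  perp _ _ _ h0 := absurd rfl h0
  transvection R _ y _ hyR _ k hk _ hle := by
    have hkR : k ∈ R := by
      by_contra h0
      exact hk (hyR k h0)
    have hk' : e.repr y k ≠ 0 := hk
    -- This map sends e k to y divided by its k-th coordinate and fixes the other basis vectors; its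
    -- inverse performs the elimination.
    obtain ⟨p, hp, hpx⟩ := h.exists_dilatransvection hD (R := R) (f := e.coord k)
      (w := (e.repr y k)⁻¹ • y - e k) (coord_mem_dualSpace h.adm k) (by simp [hk']) (by
        intro l hl
        rw [repr_basis, if_neg]
        rintro rfl; exact hl hkR) (by
        intro l hl
        have h1 : k ≠ l := by rintro rfl; exact hl hkR
        have h2 : e.repr y l = 0 := hyR l hl
        simp [h2, h1]) (by
        intro l hl M hM hlM
        have hlk : l = k := by
          by_contra h0
          exact hl (by rw [repr_basis, if_neg h0])
        subst hlk
        exact M.sub_mem (M.smul_mem _ (mem_of_repr fun j hj => hle j hj M hM hlM)) hlM)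
    refine ⟨p⁻¹, inv_mem hp, e.repr y k, hk', ?_⟩
    change p.1.symm y = e.repr y k • e k
    rw [LinearEquiv.symm_apply_eq, hpx]
    simp [hk', smul_sub, smul_smul]
  max y _ hy _ := by
    obtain ⟨k, hk, hk'⟩ := exists_maximal_below P e (finite_setOf_repr_ne e y)
      (exists_repr_ne e hy)
    refine ⟨k, trivial, hk, fun l hl => ?_⟩
    rcases h.below_total_of_none hD l k with h1 | h1
    · exact h1
    · exact hk' l hl h1
  le_of_eq _ _ := below_of_basisType_eq
  good_of_eq _ _ _ _ := trivial
  isotropic _ _ _ _ _ := rfl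

/-- Elimination of linear forms in type A. -/
lemma SplittingBasis.eliminationData_dual (h : SplittingBasis D P e I) (hD : D.form = none) :
    EliminationData (supportedSubgroup P e) id
      (fun p => (p.1.symm.dualMap : Module.Dual ℂ V →ₗ[ℂ] Module.Dual ℂ V)) D.dualSpace e.coord
      (fun l => Module.Dual.eval ℂ V (e l)) 0
      (basisType P e id) (fun _ => True) (fun j k => Below P e k j) where
  invol _ := rfl
  map_one _ := rfl
  map_mul _ _ _ := rfl
  mono hR _ hp := ⟨hp.1, fun l hl => hp.2 l fun h0 => hl (hR h0)⟩
  fix_left {R p} hp l hl := by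
    ext x
    exact ((inv_mem hp).2 l hl).2 x
  fix_right {R p} hp l hl φ := by
    change φ ((p⁻¹).1 (e l)) = φ (e l)
    rw [((inv_mem hp).2 l hl).1]
  biorth l j := by
    change e.coord j (e l) = _
    rw [repr_basis]
    simp [eq_comm]
  mem j := coord_mem_dualSpace h.adm j
  map_mem p φ hφ := by
    have h1 := p.2.1.1
    rw [← h1]
    exact ⟨φ, hφ, rfl⟩
  isometry _ _ _ := rfl
  perp _ _ _ h0 := absurd rfl h0
  transvection R _ φ hφ hyR _ k hk _ hle := by
    change φ (e k) ≠ 0 at hk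
    have hkR : k ∈ R := by
      by_contra h0
      exact hk (hyR k h0)
    -- With this choice the k-th coordinate of p x is φ x / φ (e k), so the action of p turns φ into
    -- φ (e k) times the k-th coordinate form.
    obtain ⟨p, hp, hpx⟩ := h.exists_dilatransvection hD (R := R)
      (f := (φ (e k))⁻¹ • φ - e.coord k) (w := e k)
      (D.dualSpace.sub_mem (D.dualSpace.smul_mem _ hφ) (coord_mem_dualSpace h.adm k))
      (by simp [hk]) (by
        intro l hl
        have h1 : l ≠ k := by rintro rfl; exact hl hkR
        have h2 : φ (e l) = 0 := hyR l hl
        simp [h2, h1]) (by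
        intro l hl
        have h1 : k ≠ l := by rintro rfl; exact hl hkR
        simp [h1]) (by
        intro l hl M hM hlM
        by_cases hlk : l = k
        · exact hlk ▸ hlM
        · refine hle l (fun h0 => hl ?_) M hM hlM
          have h2 : φ (e l) = 0 := h0
          simp [h2, hlk])
    refine ⟨p, hp, φ (e k), hk, ?_⟩
    ext x
    obtain ⟨y, rfl⟩ := p.1.surjective x
    change φ (p.1.symm (p.1 y)) = φ (e k) * e.coord k (p.1 y)
    rw [LinearEquiv.symm_apply_apply, hpx]
    simp [hk]
  max φ hφ hne _ := by
    have hne' : ∃ l, φ (e l) ≠ 0 := by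
      by_contra! h0
      exact hne (e.ext fun l => by simpa using h0 l)
    obtain ⟨k, hk, hk'⟩ := exists_minimal_below P e (finite_setOf_apply_ne_zero h.adm hφ) hne'
    refine ⟨k, trivial, hk, fun l hl => ?_⟩
    rcases h.below_total_of_none hD l k with h1 | h1
    · exact hk' l hl h1
    · exact h1
  le_of_eq _ _ hjk := below_of_basisType_eq hjk.symm
  good_of_eq _ _ _ _ := trivial
  isotropic _ _ _ _ _ := rfl

end TypeA

section Form

variable {D : ClassicalDatum V} {P : Subgroup D.group} {e : Module.Basis ℕ ℂ V} {I : ℕ → Finset ℕ}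
  {ω : LinearMap.BilinForm ℂ V} {ε : ℂ} {i : ℕ → ℕ}

lemma IsotropicBasis.apply_self (h : IsotropicBasis ω ε e i) (y : V) {s : Finset ℕ}
    (hs : ∀ l ∉ s, e.repr y l * e.repr y (i l) = 0) :
    ω y y = ∑ l ∈ s, e.repr y l * (ω (e l) (e (i l)) * e.repr y (i l)) := by
  have h1 : y = ∑ l ∈ (e.repr y).support, e.repr y l • e l := by
    conv_lhs => rw [← e.linearCombination_repr y, Finsupp.linearCombination_apply]
    rfl
  have h2 : ω y y = ∑ l ∈ (e.repr y).support, e.repr y l * (ω (e l) (e (i l)) * e.repr y (i l)) := by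
    have h3 : ω y y = ω (∑ l ∈ (e.repr y).support, e.repr y l • e l) y := by rw [← h1]
    rw [h3, map_sum, LinearMap.sum_apply]
    refine Finset.sum_congr rfl fun l _ => ?_
    rw [map_smul, LinearMap.smul_apply, smul_eq_mul, h.apply_left]
  classical
  rw [h2, Finset.sum_subset Finset.subset_union_left (s₂ := (e.repr y).support ∪ s) (by
      intro l _ hl
      simp [Finsupp.notMem_support_iff.1 hl])]
  refine (Finset.sum_subset Finset.subset_union_right ?_).symm
  intro l _ hl
  linear_combination ω (e l) (e (i l)) * hs l hl

/-- The support of an isotropic vector cannot contain a single pair. -/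
lemma IsotropicBasis.exists_pair (h : IsotropicBasis ω ε e i) {y : V} (hy : ω y y = 0) {k : ℕ}
    (hk : e.repr y k ≠ 0) (hik : e.repr y (i k) ≠ 0) (hε : i k = k ∨ ε = 1) :
    ∃ l, l ≠ k ∧ l ≠ i k ∧ e.repr y l ≠ 0 ∧ e.repr y (i l) ≠ 0 := by
  by_contra! hcon
  have h1 : ∀ l ∉ ({k, i k} : Finset ℕ), e.repr y l * e.repr y (i l) = 0 := fun l hl => by
    simp only [Finset.mem_insert, Finset.mem_singleton, not_or] at hl
    by_cases h0 : e.repr y l = 0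
    · rw [h0, zero_mul]
    · rw [hcon l hl.1 hl.2 h0, mul_zero]
  have h2 := h.apply_self y h1
  rw [hy] at h2
  have hne : e.repr y k * (ω (e k) (e (i k)) * e.repr y (i k)) ≠ 0 :=
    mul_ne_zero hk (mul_ne_zero (h.gram_ne k) hik)
  by_cases hkk : i k = k
  · rw [hkk] at h2 hne
    simp only [Finset.mem_singleton, Finset.insert_eq_of_mem, Finset.sum_singleton, hkk] at h2
    exact hne h2.symm
  · have hε1 : ε = 1 := hε.resolve_left hkk
    rw [Finset.sum_pair (Ne.symm hkk), h.invol, h.symm (e (i k)) (e k), hε1] at h2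
    apply hne
    linear_combination -h2 / 2

/-- A maximal index k of the support can fail in two ways: it is fixed by i, or i k is in the
support and incomparable with k. In both cases isotropy forces a further pair into the support
(`IsotropicBasis.exists_pair`). In the first case a member of that pair is a non-fixed maximum; in
the second, one of its members lies strictly above k, contradicting maximality. -/
lemma SplittingBasis.exists_max_support (h : SplittingBasis D P e I) (hD : D.form = some ω)
    (hi : IsotropicBasis ω ε e i) {y : V} (hy0 : y ≠ 0) (hy : ω y y = 0) :
    ∃ k, i k ≠ k ∧ e.repr y k ≠ 0 ∧ ∀ l, e.repr y l ≠ 0 → Below P e l k := by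
  obtain ⟨k, hk, hmax⟩ := exists_maximal_below P e (finite_setOf_repr_ne e y)
    (exists_repr_ne e hy0)
  change e.repr y k ≠ 0 at hk
  by_cases hkk : i k = k
  · obtain ⟨l, hlk, -, hl, hil⟩ := hi.exists_pair hy hk (by rwa [hkk]) (Or.inl hkk)
    have hkl : Below P e k l := by
      rcases h.below_total hD hi (j := l) (k := k) hlk (Or.inl (by rwa [hkk])) with h1 | h1
      · have h2 := h.below_dual hD hi h1
        rw [hkk] at h2
        have h3 := h.below_dual hD hi (hmax _ hil h2)
        rwa [hi.invol, hkk] at h3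
      · exact h1
    refine ⟨l, fun h0 => hlk (hi.fixed l k h0 hkk), hl, fun m hm => ?_⟩
    by_cases hmk : m = k
    · exact hmk ▸ hkl
    · rcases h.below_total hD hi (j := m) (k := k) hmk (Or.inl (by rwa [hkk])) with h1 | h1
      · exact h1.trans hkl
      · exact (hmax m hm h1).trans hkl
  · refine ⟨k, hkk, hk, fun l hl => ?_⟩
    by_cases hlk : l = k
    · rw [hlk]; exact Below.refl k
    by_cases hlik : l ≠ i k ∨ ε = -1
    · rcases h.below_total hD hi hlk hlik with h1 | h1
      · exact h1
      · exact hmax l hl h1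
    push Not at hlik
    obtain ⟨rfl, hε⟩ := hlik
    have hε1 : ε = 1 := hi.sign.resolve_right hε
    by_contra hcon
    have hcon' : ¬ Below P e k (i k) := fun h0 => hcon (hmax _ hl h0)
    obtain ⟨m, hmk, hmik, hm, him⟩ := hi.exists_pair hy hk hl (Or.inr hε1)
    rcases h.below_of_incomparable hD hi hcon' hcon hmk hmik with ⟨a1, a2, a3, a4⟩ | ⟨a1, a2, a3, a4⟩
    · have h1 := h.below_dual hD hi a2
      rw [hi.invol] at h1
      have h2 := h.below_dual hD hi (hmax _ him h1)
      rw [hi.invol] at h2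
      exact a4 h2
    · exact a3 (hmax m hm a1)

/-- Elimination of isotropic vectors in types BD and C. -/
lemma SplittingBasis.eliminationData_of_form (h : SplittingBasis D P e I) (hD : D.form = some ω)
    (hi : IsotropicBasis ω ε e i) :
    EliminationData (supportedSubgroup P e) i (fun p => (p.1 : V →ₗ[ℂ] V)) ⊤ e e.coord ω
      (basisType P e i) (fun k => i k ≠ k) (Below P e) where
  invol := hi.invol
  map_one _ := rfl
  map_mul _ _ _ := rfl
  mono hR _ hp := ⟨hp.1, fun l hl => hp.2 l fun h0 => hl (hR h0)⟩
  fix_left hp l hl := (hp.2 l hl).1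
  fix_right hp l hl := (hp.2 l hl).2
  biorth := repr_basis e
  mem _ := trivial
  map_mem _ _ _ := trivial
  isometry p x y := p.2.2 ω (by simp [hD]) x y
  perp j y hj _ := (hi.apply_left_eq_zero_iff j y).1 hj
  transvection R hR y _ hyR hy k hk hkk hle := by
    have hk' : e.repr y k ≠ 0 := hk
    have hkR : k ∈ R := by
      by_contra h0
      exact hk (hyR k h0)
    obtain ⟨v, hv⟩ : ∃ v, v = (e.repr y k)⁻¹ • y := ⟨_, rfl⟩
    have hvle : ∀ M ∈ invariants P, e k ∈ M → v ∈ M := fun M hM hkM =>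
      hv ▸ M.smul_mem _ (mem_of_repr fun j hj => hle j hj M hM hkM)
    obtain ⟨g, hg1, hg2⟩ := exists_siegel hD hi hkk (v := v) (by simp [hv, hy]) (by simp [hv, hk'])
    have hgP : g ∈ P := h.mem_of_invariants fun M hM x hx => by
      refine siegel_stabilizes hi hg1 hg2 (h.isCoordinate hM) (hvle M hM) (fun hik x hx => ?_) hx
      exact hvle _ (orthogonal_mem_invariants hD hM)
        (((h.isCoordinate hM).mem_orthogonal hi k).2 hik) x hx
    have hgl : ∀ l ∉ R, g.1 (e l) = e l := fun l hl => by
      have hilR : i l ∉ R := fun h0 => hl (by have := hR _ h0; rwa [hi.invol] at this)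
      obtain ⟨b, hb, hb0⟩ := hg2 l (by rintro rfl; exact hl hkR)
      have h1 : e.repr y (i l) = 0 := hyR _ hilR
      rw [hb, hb0 (by simp [hv, h1]), zero_smul, add_zero]
    have hgS : g ∈ supportedSubgroup P e R := by
      refine ⟨hgP, fun l hl => ⟨hgl l hl, fun x => ?_⟩⟩
      have hilR : i l ∉ R := fun h0 => hl (by have := hR _ h0; rwa [hi.invol] at this)
      -- The l-th coordinate is a multiple of ω(e (i l), ·), and the isometry g fixes e (i l).
      have h1 := g.2.2 ω (by simp [hD]) (e (i l)) x
      rw [hgl _ hilR, hi.apply_left, hi.apply_left (i l) x, hi.invol] at h1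
      have h2 := hi.gram_ne (i l)
      rw [hi.invol] at h2
      exact mul_left_cancel₀ h2 h1
    refine ⟨g⁻¹, inv_mem hgS, e.repr y k, hk', ?_⟩
    change g.1.symm y = e.repr y k • e k
    rw [LinearEquiv.symm_apply_eq, map_smul, hg1, hv, smul_smul, mul_inv_cancel₀ hk', one_smul]
  max y _ hy0 hy := h.exists_max_support hD hi hy0 hy
  le_of_eq _ _ := below_of_basisType_eq
  good_of_eq j k hjk hj := by
    obtain ⟨-, h1, h2⟩ := by simpa [basisType] using hjk
    omega
  isotropic j k hjk hj hne := by
    obtain ⟨-, h1, h2⟩ := by simpa [basisType] using hjk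
    -- The type records the order of an index and its partner, which is opposite for the two members
    -- of a pair; so two indices of the same type are never partners.
    have hkj : k ≠ i j := by
      rintro rfl
      rw [hi.invol] at h1 h2
      omega
    have hjj : ω (e j) (e j) = 0 := hi.gram_eq_zero (Ne.symm hj)
    have hkk : ω (e k) (e k) = 0 := hi.gram_eq_zero (by omega)
    simp [hjj, hkk, hi.gram_eq_zero hkj, hi.gram_eq_zero (hi.invol_ne hkj)]

end Form

end ClassicalDatum

/-! ### Finiteness of the number of orbits -/

namespace ClassicalDatum

variable {V : Type u} [AddCommGroup V] [Module ℂ V]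

/-- Finitely many normal forms for the flags `g • F` under `P₂` bound the number of orbits. -/
lemma finite_orbits_of_normalForm {D : ClassicalDatum V} {P₁ P₂ : Subgroup D.group} {κ : Type*}
    {F : κ → Submodule ℂ V} {Θ : Type*} [Finite Θ] (N : Θ → κ → Submodule ℂ V)
    (hF : ∀ g : D.group, (∀ k, (F k).map (g.1 : V →ₗ[ℂ] V) = F k) → g ∈ P₁)
    (hN : ∀ g : D.group, ∃ p ∈ P₂, ∃ θ, ∀ k,
      ((F k).map (g.1 : V →ₗ[ℂ] V)).map (p.1 : V →ₗ[ℂ] V) = N θ k) :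
    Finite (MulAction.orbitRel.Quotient D.group ((D.group ⧸ P₁) × (D.group ⧸ P₂))) := by
  choose p hp θ hθ using hN
  have hmap : ∀ (a b : D.group) (W : Submodule ℂ V), W.map ((a * b).1 : V →ₗ[ℂ] V) =
      (W.map (b.1 : V →ₗ[ℂ] V)).map (a.1 : V →ₗ[ℂ] V) := fun a b W => by
    rw [← Submodule.map_comp]
    rfl
  -- Equal normal forms mean that p g • g and p g' • g' carry the flag F to the same flag, so they
  -- differ by an element of P₁.
  have key : ∀ g g', θ g = θ g' → (p g' * g')⁻¹ * (p g * g) ∈ P₁ := fun g g' h => by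
    refine hF _ fun k => ?_
    rw [hmap, hmap (p g), hθ, h, ← hθ, ← hmap (p g'), ← hmap, inv_mul_cancel]
    exact Submodule.map_id _
  -- Every orbit contains a pair whose second component is the base point.
  have hrep : ∀ q : MulAction.orbitRel.Quotient D.group ((D.group ⧸ P₁) × (D.group ⧸ P₂)),
      ∃ g : D.group, q = Quotient.mk _ ((g : D.group ⧸ P₁), ((1 : D.group) : D.group ⧸ P₂)) := by
    intro q
    obtain ⟨⟨x, y⟩, rfl⟩ := Quotient.exists_rep q
    obtain ⟨a, rfl⟩ := QuotientGroup.mk_surjective x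
    obtain ⟨b, rfl⟩ := QuotientGroup.mk_surjective y
    refine ⟨b⁻¹ * a, Quotient.sound ⟨b, Prod.ext ?_ ?_⟩⟩
    · change ((b * (b⁻¹ * a) : D.group) : D.group ⧸ P₁) = a
      rw [mul_inv_cancel_left]
    · change ((b * 1 : D.group) : D.group ⧸ P₂) = b
      rw [mul_one]
  choose r hr using hrep
  refine Finite.of_injective (fun q => θ (r q)) fun q q' h => ?_
  rw [hr q, hr q']
  refine Quotient.sound ⟨(p (r q))⁻¹ * p (r q'), Prod.ext ?_ ?_⟩
  · change (((p (r q))⁻¹ * p (r q') * r q' : D.group) : D.group ⧸ P₁) = (r q : D.group ⧸ P₁)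
    rw [QuotientGroup.eq]
    convert key _ _ h using 1
    group
  · change (((p (r q))⁻¹ * p (r q') * 1 : D.group) : D.group ⧸ P₂) = ((1 : D.group) : D.group ⧸ P₂)
    rw [QuotientGroup.eq]
    simpa using mul_mem (inv_mem (hp (r q'))) (hp (r q))

lemma exists_list_of_fin_chain {Y : Type*} [AddCommGroup Y] [Module ℂ Y] {m : ℕ}
    {F : Fin (m + 1) → Submodule ℂ Y} (hF : Monotone F) {n : Fin (m + 1)}
    (hn : FiniteDimensional ℂ (F n)) :
    ∃ l : List Y, (∀ v ∈ l, v ∈ F n) ∧ ∀ k ≤ n, ∃ t, listSpan (l.take t) = F k := by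
  obtain ⟨l, hl, hl'⟩ := exists_list_of_chain
    (F := fun k => F ⟨min k n, (min_le_right k n.1).trans_lt n.2⟩)
    (fun a b hab => hF (by simp only [Fin.mk_le_mk]; omega)) (fun k => by
      have h1 : F ⟨min k n, (min_le_right k n.1).trans_lt n.2⟩ ≤ F n := hF (by
        rw [Fin.le_def]; exact min_le_right _ _)
      have := Submodule.finiteDimensional_of_le h1
      exact Module.Finite.iff_fg.1 this) n
  refine ⟨l, by simpa using hl, fun k hk => ?_⟩
  obtain ⟨t, -, ht⟩ := hl' k hk
  refine ⟨t, ht.trans ?_⟩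
  congr 1
  exact Fin.ext (min_eq_left hk)

lemma exists_last {m : ℕ} (p : Fin (m + 1) → Prop) (h0 : p 0) : ∃ n, p n ∧ ∀ k, p k → k ≤ n := by
  obtain ⟨n, hn, hn'⟩ := (Set.toFinite {k | p k}).exists_maximal ⟨0, h0⟩
  exact ⟨n, hn, fun k hk => (le_total k n).elim id fun h => hn' hk h⟩

lemma map_orthogonal {D : ClassicalDatum V} {ω : LinearMap.BilinForm ℂ V} (hD : D.form = some ω)
    (g : D.group) (W : Submodule ℂ V) :
    (ω.orthogonal W).map (g.1 : V →ₗ[ℂ] V) = ω.orthogonal (W.map (g.1 : V →ₗ[ℂ] V)) := by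
  have hg : ∀ x y, ω (g.1 x) (g.1 y) = ω x y := g.2.2 ω (by simp [hD])
  apply le_antisymm
  · rintro _ ⟨x, hx, rfl⟩ _ ⟨y, hy, rfl⟩
    exact (hg y x).trans (hx y hy)
  · intro x hx
    refine ⟨g.1.symm x, fun y hy => ?_, by simp⟩
    have h1 : ω (g.1 y) x = 0 := hx _ ⟨y, hy, rfl⟩
    rw [← g.1.apply_symm_apply x, hg] at h1
    exact h1

lemma map_dualCoannihilator (g : V ≃ₗ[ℂ] V) (Φ : Submodule ℂ (Module.Dual ℂ V)) :
    Φ.dualCoannihilator.map (g : V →ₗ[ℂ] V) =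
      (Φ.map (g.symm.dualMap : Module.Dual ℂ V →ₗ[ℂ] Module.Dual ℂ V)).dualCoannihilator := by
  ext x
  simp only [Submodule.mem_map, Submodule.mem_dualCoannihilator]
  constructor
  · rintro ⟨y, hy, rfl⟩ _ ⟨φ, hφ, rfl⟩
    simpa using hy φ hφ
  · intro h
    exact ⟨g.symm x, fun φ hφ => h _ ⟨φ, hφ, rfl⟩, by simp⟩

lemma basis_mem_normalList {Y T : Type*} [AddCommGroup Y] (τ : ℕ → T) (b : ℕ → Y) (R : Set ℕ)
    (ts : List (Option T)) {l : ℕ} (hl : l ∈ R) (hl' : l ∉ remaining id τ R ts) :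
    b l ∈ normalList id τ b R ts := by
  induction ts generalizing R with
  | nil => exact absurd hl hl'
  | cons t ts ih =>
    cases t with
    | none => exact List.mem_cons_of_mem _ (ih R hl hl')
    | some t =>
      by_cases h : l = canonicalIndex τ R t
      · rw [h]
        exact List.mem_cons_self
      · exact List.mem_cons_of_mem _ (ih _ ⟨hl, by simpa using h⟩ hl')

lemma IsCoordinate.not_finiteDimensional_and_cofg {e : Module.Basis ℕ ℂ V} {M : Submodule ℂ V}
    (hM : IsCoordinate e M) (h : FiniteDimensional ℂ M) (h' : M.CoFG) : False := by
  have h1 := (finite_setOf_basis_mem e M).union (hM.finite_setOf_notMem h')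
  refine Set.infinite_univ (α := ℕ) (h1.subset fun j _ => ?_)
  by_cases hj : e j ∈ M
  · exact Or.inl hj
  · exact Or.inr hj

instance finite_lists (T : Type*) [Finite T] (n : ℕ) : Finite {l : List T // l.length = n} :=
  List.finite_length_eq T n

section

variable {D : ClassicalDatum V} {P₁ P₂ : Subgroup D.group} {e₁ e₂ : Module.Basis ℕ ℂ V}
  {I₁ I₂ : ℕ → Finset ℕ}

/-- Only the finite-dimensional members of the flag need a normal form: the others are their
orthogonals, and elements of the group commute with taking orthogonals. The largest
finite-dimensional member is isotropic, so elimination applies to it. -/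
lemma finite_orbits_of_form {ω : LinearMap.BilinForm ℂ V} {ε : ℂ} {i₁ i₂ : ℕ → ℕ}
    (hD : D.form = some ω) (hi₁ : IsotropicBasis ω ε e₁ i₁) (hi₂ : IsotropicBasis ω ε e₂ i₂)
    (h₁ : SplittingBasis D P₁ e₁ I₁) (h₂ : SplittingBasis D P₂ e₂ I₂)
    (hP₁ : D.IsLarge P₁) (hP₂ : D.IsSemilarge P₂) :
    Finite (MulAction.orbitRel.Quotient D.group ((D.group ⧸ P₁) × (D.group ⧸ P₂))) := by
  obtain ⟨-, m, F, hF, hF0, -, hFo, hFP, hFfin⟩ := hP₁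
  have hinv : Finite (invariants P₂) := hP₂.to_subtype
  have hFo' := hFo ω (by simp [hD])
  have hFc : ∀ k, IsCoordinate e₁ (F k) := fun k => h₁.isCoordinate fun g hg x hx => by
    rw [← (hFP g).1 hg k]
    exact ⟨x, hx, rfl⟩
  obtain ⟨n, hn, hnmax⟩ := exists_last (fun k => FiniteDimensional ℂ (F k))
    (by rw [hF0]; infer_instance)
  obtain ⟨vs, hvs, ht⟩ := exists_list_of_fin_chain hF.monotone hn
  have hiso : F n ≤ ω.orthogonal (F n) := by
    rw [hFo']
    refine hF.monotone ((le_total n n.rev).elim id fun h0 => ?_)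
    -- Otherwise the orthogonal of F n, which has finite codimension, would be contained in the
    -- finite-dimensional F n.
    exfalso
    have h1 : FiniteDimensional ℂ (F n.rev) := Submodule.finiteDimensional_of_le (hF.monotone h0)
    refine (hFc n.rev).not_finiteDimensional_and_cofg h1 ((hFc n.rev).cofg ?_)
    refine ((finite_setOf_basis_mem e₁ (F n)).preimage
      (Function.LeftInverse.injective hi₁.invol).injOn).subset fun j hj => ?_
    change e₁ j ∉ F n.rev at hj
    rw [← hFo', (hFc n).mem_orthogonal hi₁, not_not] at hj
    exact hj
  have hrev : ∀ k, ¬ FiniteDimensional ℂ (F k) → FiniteDimensional ℂ (F k.rev) := fun k hk => by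
    rw [← hFo']
    refine ((hFc k).orthogonal hi₁).finiteDimensional ?_
    refine (((hFc k).finite_setOf_notMem ((hFfin k).resolve_left hk)).preimage
      (Function.LeftInverse.injective hi₁.invol).injOn).subset fun j hj => ?_
    exact ((hFc k).mem_orthogonal hi₁ j).1 hj
  choose! t ht using ht
  refine finite_orbits_of_normalForm (κ := {k // FiniteDimensional ℂ (F k)}) (F := fun k => F k)
    (Θ := {ts : List (Option (Set (invariants P₂) × Bool × Bool)) // ts.length = vs.length})
    (fun ts k => listSpan ((normalList i₂ (basisType P₂ e₂ i₂) e₂ Set.univ ts.1).take (t k)))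
    (fun g hg => ?_) fun g => ?_
  · rw [hFP]
    intro k
    by_cases hk : FiniteDimensional ℂ (F k)
    · exact hg ⟨k, hk⟩
    · have h1 : F k = ω.orthogonal (F k.rev) := by rw [hFo', Fin.rev_rev]
      rw [h1, map_orthogonal hD, hg ⟨_, hrev k hk⟩]
  · obtain ⟨p, hp, ts, hts, hpts⟩ := (h₂.eliminationData_of_form hD hi₂).exists_normalList
      (vs.map g.1) (R := Set.univ) (fun _ _ => trivial) (fun _ _ => trivial)
      (fun _ _ l hl => absurd trivial hl) (by
        intro v hv w hw
        obtain ⟨x, hx, rfl⟩ := List.mem_map.1 hv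
        obtain ⟨y, hy, rfl⟩ := List.mem_map.1 hw
        rw [g.2.2 ω (by simp [hD])]
        exact hiso (hvs y hy) x (hvs x hx))
    refine ⟨p, hp.1, ⟨ts, by simpa using hts⟩, fun k => ?_⟩
    rw [← ht k (hnmax k k.2), map_listSpan, List.map_take]
    exact hpts _

/-- The finite-dimensional members are normalized through a list of vectors, the
finite-codimensional ones through a list of linear forms cutting them out. The second elimination
uses only the indices left by the first, and so does not disturb its result. -/
lemma finite_orbits_of_none (hD : D.form = none)
    (h₁ : SplittingBasis D P₁ e₁ I₁) (h₂ : SplittingBasis D P₂ e₂ I₂)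
    (hP₁ : D.IsLarge P₁) (hP₂ : D.IsSemilarge P₂) :
    Finite (MulAction.orbitRel.Quotient D.group ((D.group ⧸ P₁) × (D.group ⧸ P₂))) := by
  obtain ⟨-, m, F, hF, hF0, hFl, -, hFP, hFfin⟩ := hP₁
  have hinv : Finite (invariants P₂) := hP₂.to_subtype
  have hFc : ∀ k, IsCoordinate e₁ (F k) := fun k => h₁.isCoordinate fun g hg x hx => by
    rw [← (hFP g).1 hg k]
    exact ⟨x, hx, rfl⟩
  obtain ⟨n, hn, hnmax⟩ := exists_last (fun k => FiniteDimensional ℂ (F k))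
    (by rw [hF0]; infer_instance)
  obtain ⟨vs, hvs, ht⟩ := exists_list_of_fin_chain hF.monotone hn
  choose! t ht using ht
  -- The coordinate forms vanishing on a member of the flag cut it out; indices are reversed so that
  -- Φ increases.
  let Φ : Fin (m + 1) → Submodule ℂ (Module.Dual ℂ V) := fun k =>
    Submodule.span ℂ (e₁.coord '' {x | e₁ x ∉ F k.rev})
  have hΦ : Monotone Φ := fun a b hab => Submodule.span_mono (Set.image_mono fun x hx h0 =>
    hx (hF.monotone (Fin.rev_le_rev.2 hab) h0))
  have hΦF : ∀ k, (Φ k.rev).dualCoannihilator = F k := fun k => by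
    ext x
    simp only [Φ, Fin.rev_rev, Submodule.mem_dualCoannihilator]
    constructor
    · intro h
      refine mem_of_repr (e := e₁) fun j hj => ?_
      by_contra h0
      exact hj (h _ (Submodule.subset_span ⟨j, h0, rfl⟩))
    · intro hx φ hφ
      induction hφ using Submodule.span_induction with
      | mem φ hφ =>
        obtain ⟨j, hj, rfl⟩ := hφ
        by_contra h0
        exact hj (hFc k x hx j h0)
      | zero => rfl
      | add a b _ _ ha hb => simp [ha, hb]
      | smul c a _ ha => simp [ha]
  obtain ⟨n', hn', hnmax'⟩ := exists_last (fun k => (F k.rev).CoFG)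
    (by simp [hFl])
  obtain ⟨φs, hφs, ht'⟩ := exists_list_of_fin_chain hΦ (n := n')
    (FiniteDimensional.span_of_finite ℂ (((hFc _).finite_setOf_notMem hn').image _))
  choose! t' ht' using ht'
  have hzero : ∀ φ ∈ φs, ∀ v ∈ vs, φ v = 0 := fun φ hφ v hv => by
    have hle : F n ≤ F n'.rev := by
      refine hF.monotone ((le_total n n'.rev).elim id fun h0 => ?_)
      exfalso
      have h1 : FiniteDimensional ℂ (F n'.rev) :=
        Submodule.finiteDimensional_of_le (hF.monotone h0)
      exact (hFc n'.rev).not_finiteDimensional_and_cofg h1 hn'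
    have h2 := hle (hvs v hv)
    rw [← hΦF, Fin.rev_rev, Submodule.mem_dualCoannihilator] at h2
    exact h2 φ (hφs φ hφ)
  have hφD : ∀ φ ∈ φs, φ ∈ D.dualSpace := fun φ hφ => by
    have h1 : Φ n' ≤ D.dualSpace := by
      rw [Submodule.span_le]
      rintro _ ⟨j, -, rfl⟩
      exact coord_mem_dualSpace h₁.adm j
    exact h1 (hφs φ hφ)
  classical
  let τ := basisType P₂ e₂ id
  refine finite_orbits_of_normalForm (F := F)
    (Θ := {ts : List (Option (Set (invariants P₂) × Bool × Bool)) // ts.length = vs.length} ×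
      {ts : List (Option (Set (invariants P₂) × Bool × Bool)) // ts.length = φs.length})
    (fun θ k => if FiniteDimensional ℂ (F k) then
      listSpan ((normalList id τ e₂ Set.univ θ.1.1).take (t k)) else
      (listSpan ((normalList id τ e₂.coord (remaining id τ Set.univ θ.1.1) θ.2.1).take
        (t' k.rev))).dualCoannihilator)
    (fun g hg => (hFP g).2 hg) fun g => ?_
  obtain ⟨p, hp, ts, hts, hpts⟩ := (h₂.eliminationData_of_none hD).exists_normalList
    (vs.map g.1) (R := Set.univ) (fun _ _ => trivial) (fun _ _ => trivial)
    (fun _ _ l hl => absurd trivial hl) (fun _ _ _ _ => rfl)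
  have hmem := (h₂.eliminationData_dual hD).map_mem
  -- The forms vanish on the finite-dimensional members, hence after p on the canonical vectors
  -- already chosen. They are thus supported on the remaining indices, to which q is confined.
  obtain ⟨q, hq, us, hus, hqus⟩ := (h₂.eliminationData_dual hD).exists_normalList
    (φs.map (p * g).1.symm.dualMap) (R := remaining id τ Set.univ ts) (fun _ h => h)
    (by
      intro ψ hψ
      obtain ⟨φ, hφ, rfl⟩ := List.mem_map.1 hψ
      exact hmem _ _ (hφD φ hφ))
    (by
      intro ψ hψ l hl
      obtain ⟨φ, hφ, rfl⟩ := List.mem_map.1 hψ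
      have h1 := basis_mem_normalList τ e₂ Set.univ ts (Set.mem_univ l) hl
      -- A length exceeding both lists, so that both initial segments are the whole lists.
      have h2 := hpts (vs.length + (normalList id τ e₂ Set.univ ts).length)
      rw [List.take_of_length_le (by simp), List.take_of_length_le (by simp [τ])] at h2
      have h3 : e₂ l ∈ listSpan (normalList id τ e₂ Set.univ ts) := Submodule.subset_span h1
      rw [← h2, map_listSpan] at h3
      change φ ((p * g).1.symm (e₂ l)) = 0
      have h4 : listSpan ((vs.map g.1).map (p.1 : V →ₗ[ℂ] V)) ≤
          LinearMap.ker ((p * g).1.symm.dualMap φ) := by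
        refine Submodule.span_le.2 fun x hx => ?_
        obtain ⟨y, hy, rfl⟩ := List.mem_map.1 hx
        obtain ⟨v, hv, rfl⟩ := List.mem_map.1 hy
        change φ ((p * g).1.symm ((p * g).1 v)) = 0
        rw [LinearEquiv.symm_apply_apply]
        exact hzero φ hφ v hv
      exact h4 h3)
    (fun _ _ _ _ => rfl)
  refine ⟨q * p, mul_mem hq.1 hp.1, ⟨⟨ts, by simpa using hts⟩, ⟨us, by simpa using hus⟩⟩,
    fun k => ?_⟩
  have hmap : ∀ (a b : D.group) (W : Submodule ℂ V), W.map ((a * b).1 : V →ₗ[ℂ] V) =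
      (W.map (b.1 : V →ₗ[ℂ] V)).map (a.1 : V →ₗ[ℂ] V) := fun a b W => by
    rw [← Submodule.map_comp]
    rfl
  by_cases hk : FiniteDimensional ℂ (F k)
  · rw [if_pos hk, hmap, ← ht k (hnmax k hk), map_listSpan, List.map_take]
    refine (congrArg (Submodule.map (q.1 : V →ₗ[ℂ] V)) (hpts (t k))).trans ?_
    rw [map_listSpan, List.map_take]
    congr 2
    refine (List.map_congr_left fun w hw => ?_).trans (List.map_id _)
    rcases mem_normalList id τ e₂ Set.univ ts hw with rfl | ⟨j, hj, rfl⟩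
    · exact map_zero _
    · exact (hq.2 j hj).1
  · rw [if_neg hk, ← Submodule.map_comp, ← hΦF k]
    change (Submodule.dualCoannihilator _).map (((q * p * g).1 : V ≃ₗ[ℂ] V) : V →ₗ[ℂ] V) = _
    rw [map_dualCoannihilator,
      ← ht' k.rev (hnmax' _ (by simpa using (hFfin k).resolve_left hk))]
    congr 1
    refine Eq.trans ?_ (hqus _)
    rw [← List.map_take]
    refine Eq.trans ?_ (congrArg (Submodule.map _) (map_listSpan (((p * g).1.symm.dualMap :
      Module.Dual ℂ V ≃ₗ[ℂ] Module.Dual ℂ V) : Module.Dual ℂ V →ₗ[ℂ] Module.Dual ℂ V) _))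
    rw [← Submodule.map_comp]
    rfl

end

end ClassicalDatum

/-- A large and a semilarge splitting parabolic subgroup yield finitely many orbits. -/
lemma ClassicalDatum.finite_orbits {V : Type u} [AddCommGroup V] [Module ℂ V]
    {D : ClassicalDatum V} {P₁ P₂ : Subgroup D.group} {e₁ e₂ : Module.Basis ℕ ℂ V}
    {I₁ I₂ : ℕ → Finset ℕ} (h₁ : SplittingBasis D P₁ e₁ I₁) (h₂ : SplittingBasis D P₂ e₂ I₂)
    (hP₁ : D.IsLarge P₁) (hP₂ : D.IsSemilarge P₂) :
    Finite (MulAction.orbitRel.Quotient D.group ((D.group ⧸ P₁) × (D.group ⧸ P₂))) := by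
  rcases hD : D.form with _ | ω
  · exact finite_orbits_of_none hD h₁ h₂ hP₁ hP₂
  · obtain ⟨ε, hε⟩ := exists_isotropicBasis hD
    obtain ⟨i₁, hi₁⟩ := hε e₁ h₁.adm
    obtain ⟨i₂, hi₂⟩ := hε e₂ h₂.adm
    exact finite_orbits_of_form hD hi₁ hi₂ h₁ h₂ hP₁ hP₂

theorem theorem1 {V : Type u} [AddCommGroup V] [Module ℂ V]
    (hV : Module.rank ℂ V = Cardinal.aleph0) (D : ClassicalDatum V)
    (P₁ P₂ : Subgroup D.group)
    (hP₁ : D.IsSplittingParabolic P₁) (hP₂ : D.IsSplittingParabolic P₂)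
    (hne₁ : P₁ ≠ ⊤) (hne₂ : P₂ ≠ ⊤) :
    Finite (MulAction.orbitRel.Quotient D.group ((D.group ⧸ P₁) × (D.group ⧸ P₂))) ↔
      (D.IsLarge P₁ ∧ D.IsSemilarge P₂) ∨ (D.IsLarge P₂ ∧ D.IsSemilarge P₁) := by
  obtain ⟨e₁, he₁, hd₁, I₁, hI₁, hp₁⟩ := hP₁
  obtain ⟨e₂, he₂, hd₂, I₂, hI₂, hp₂⟩ := hP₂
  have h₁ : D.SplittingBasis P₁ e₁ I₁ := ⟨he₁, hd₁, hI₁, hp₁⟩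
  have h₂ : D.SplittingBasis P₂ e₂ I₂ := ⟨he₂, hd₂, hI₂, hp₂⟩
  constructor
  · intro hfin
    have hs₁ := ClassicalDatum.isSemilarge_of_finite h₁ h₂ hne₂
    have hs₂ : D.IsSemilarge P₂ := by
      have := ClassicalDatum.orbits_swap hfin
      exact ClassicalDatum.isSemilarge_of_finite h₂ h₁ hne₁
    exact (ClassicalDatum.isLarge_or_isLarge_of_finite h₁ h₂ hs₁ hs₂).imp
      (fun h => ⟨h, hs₂⟩) fun h => ⟨h, hs₁⟩
  · rintro (⟨hl, hs⟩ | ⟨hl, hs⟩)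
    · exact ClassicalDatum.finite_orbits h₁ h₂ hl hs
    · exact ClassicalDatum.orbits_swap (ClassicalDatum.finite_orbits h₂ h₁ hl hs)
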